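/- **Setting.** Let $d\ge 1$ and $l\ge 2$ be integers. Points of the phase space $\mathbb R^{2d}$ are written $z=(x,\xi)$ or $z=(q,p)$, with $x,\xi,q,p\in\mathbb R^d$. Set $$\mathtt k_0(x,\xi)=(1+|x|^{2l}+|\xi|^2)^{\frac{l+1}{2l}},\qquad E(q,p)=\frac{|p|^2}{2}+\frac1{2l}\sum_{j=1}^d q_j^{2l},\qquad J(x,\xi)=(\xi,-x).$$ For $m\in\mathbb R$, $\Sigma^m$ is the set of smooth $a:\mathbb R^{2d}\to\mathbb R$ such that every partial derivative satisfies $|\partial_x^\alpha\partial_\xi^\beta a|\le C_{\alpha\beta}\,\mathtt k_0^m$. For $\hbar>0$, $\mathrm{Op}(a)$ is the $\hbar$-Weyl quantization $$\mathrm{Op}(a)\psi(x)=\frac1{(2\pi\hbar)^d}\int\!\!\int e^{\frac i\hbar(x-y)\cdot\xi}\,a\Big(\frac{x+y}2,\xi\Big)\psi(y)\,dy\,d\xi .$$ For $z=(q,p)$, the coherent state centred at $z$ is $$\varphi_z(x)=(\pi\hbar)^{-d/4}e^{\frac i\hbar(p\cdot x-\frac12p\cdot q)}e^{-\frac{|x-q|^2}{2\hbar}}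 .$$ Let $H(t,x,\xi)$ be a real Hamiltonian. Condition $(\mathrm H_{\rm cl})$ on $[0,T]$ means: $H$ is $C^\infty$ on $[0,T]\times\mathbb R^{2d}$, there is $m>0$ with $H(t,\cdot)\in\Sigma^m$ for all $t\in[0,T]$, and $\dot z=J\nabla H(t,z)$ has a solution on all of $[0,T]$ for every initial datum. In that case let $z_t$ be the solution with initial datum $z_0$, let $M_t$ be the Hessian of $H(t,\cdot)$ at $z_t$, and let $F_t$ solve $\dot F_t=JM_tF_t$, $F_0=\mathbb 1$, with Euclidean operator norm $|F_t|$. Put $|F|_T=\sup_{0\le t\le T}|F_t|$ and $\mathcal E_t=\sup_{0\le s\le t}E(z_s)$. Let $H_2(t,\cdot)$ be the second order Taylor polynomial of $H(t,\cdot)$ at $z_t$, and let $\mathcal U_2^\hbar(t,s)$ be the unitary propagator on $L^2(\mathbb R^d)$ generated by $\mathrm{Op}(H_2(t))$. Thus $\mathcal U_2^\hbar(t,0)\varphi_{z_0}$ is the solution $\psi(t)$ of $i\hbar\partial_t\psi=\mathrm{Op}(H_2(t))\psi$, $\psi(0)=\varphi_{z_0}$. **Proposition.** Fix $H$, $z_0\in\mathbb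 R^{2d}$, $\kappa\in(0,1]$, $\rho\ge 0$, and $a\in\Sigma^\rho$ such that $$|\partial_x^\alpha\partial_\xi^\beta a|\le C_{\alpha\beta}\,\mathtt k_0^{\,\rho-\frac{l|\beta|+|\alpha|}{l+1}}\qquad\text{for } |\alpha|+|\beta|\le 1 .$$ Then there is a constant $\Gamma_1>0$ such that, for all $\hbar_0,T>0$ for which $(\mathrm H_{\rm cl})$ holds on $[0,T]$ and $\sqrt{\hbar_0}\,|F|_T\le\kappa$, there is a smooth function $b:(0,\hbar_0]\times[0,T]\to\mathbb R$ with the following properties for all $\hbar\in(0,\hbar_0]$ and $t\in[0,T]$. 1. The evolved state $\mathcal U_2^\hbar(t,0)\varphi_{z_0}$ exists as a Schwartz-class solution of the Cauchy problem above, with time derivative in $L^2$. It coincides with the image of $\varphi_{z_0}$ under any unitary propagator generated by $\mathrm{Op}(H_2(t))$. It satisfies $$\big\langle \mathrm{Op}(a)\,\mathcal U_2^\hbar(t,0)\varphi_{z_0},\ \mathcal U_2^\hbar(t,0)\varphi_{z_0}\big\rangle=a(z_t)+b(\hbar,t).$$ 2. $\displaystyle |b(\hbar,t)|\le\Gamma_1\,\hbar^{1/2}\,|F_t|\,\big(1+E(z_t)\big)^{\frac{(l+1)\rho-1}{2l}}.$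 3. If $(l+1)\rho\ge 1$, then also $\displaystyle |b(\hbar,t)|\le\Gamma_1\,\hbar^{1/2}\,|F_t|\,\big(1+\mathcal E_t\big)^{\frac{(l+1)\rho-1}{2l}}.$ -/

import Mathlib

open scoped ContDiff SchwartzMap

namespace Semiclassical

noncomputable section

/-- Configuration space `ℝ^d` with its Euclidean structure. -/
abbrev Conf (d : ℕ) : Type := EuclideanSpace ℝ (Fin d)

/-- Phase space `ℝ^{2d} = ℝ^d × ℝ^d` with its Euclidean structure; the first `d` coordinates of a
point `z = (x, ξ)` are the position `x`, the last `d` ones the momentum `ξ`. -/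
abbrev Phase (d : ℕ) : Type := EuclideanSpace ℝ (Fin d ⊕ Fin d)

/-- The Hilbert space `L²(ℝ^d)` of complex valued functions. -/
abbrev L2 (d : ℕ) : Type :=
  MeasureTheory.Lp (α := Conf d) ℂ 2 MeasureTheory.volume

variable {d : ℕ}

/-- The point `(x, ξ)` of phase space. -/
def phasePoint (x ξ : Conf d) : Phase d :=
  WithLp.toLp 2 (Sum.elim (fun j => x j) (fun j => ξ j))

/-- The position component of a point of phase space. -/
def pos (z : Phase d) : Conf d :=
  WithLp.toLp 2 (fun j => z (Sum.inl j))

/-- The momentum component of a point of phase space. -/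
def mom (z : Phase d) : Conf d :=
  WithLp.toLp 2 (fun j => z (Sum.inr j))

/-! ### Weight, symbols, energy -/

/-- The weight `k₀(x, ξ) = (1 + |x|^{2l} + |ξ|²)^{(l+1)/(2l)}`. -/
def weight (l : ℕ) (z : Phase d) : ℝ :=
  (1 + ‖pos z‖ ^ (2 * l) + ‖mom z‖ ^ 2) ^ (((l : ℝ) + 1) / (2 * l))

/-- The symbol class `Σ^m`: smooth functions all of whose derivatives, of every order, are
bounded by a constant times `k₀^m`. The bound on all partial derivatives of order `n` is
expressed by the norm of the full `n`-th derivative. -/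
def IsSymbol (l : ℕ) (m : ℝ) (a : Phase d → ℝ) : Prop :=
  ContDiff ℝ ∞ a ∧
    ∀ n : ℕ, ∃ C : ℝ, ∀ z : Phase d, ‖iteratedFDeriv ℝ n a z‖ ≤ C * weight l z ^ m

/-- The anisotropic bounds `|∂_x^α ∂_ξ^β a| ≤ C k₀^{ρ - (l|β| + |α|)/(l+1)}` for
`|α| + |β| ≤ 1`; the components of the gradient are `∂_x a` and `∂_ξ a`. -/
def HasAnisotropicBounds (l : ℕ) (ρ : ℝ) (a : Phase d → ℝ) : Prop :=
  ∃ C : ℝ, ∀ z : Phase d,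
    |a z| ≤ C * weight l z ^ ρ ∧
    ‖pos (gradient a z)‖ ≤ C * weight l z ^ (ρ - 1 / ((l : ℝ) + 1)) ∧
    ‖mom (gradient a z)‖ ≤ C * weight l z ^ (ρ - (l : ℝ) / ((l : ℝ) + 1))

/-- The anharmonic energy `E(q, p) = |p|²/2 + (1/(2l)) ∑_j q_j^{2l}`. -/
def energy (l : ℕ) (z : Phase d) : ℝ :=
  ‖mom z‖ ^ 2 / 2 + 1 / (2 * (l : ℝ)) * ∑ j, (pos z j) ^ (2 * l)

/-! ### Classical dynamics -/

/-- The standard Poisson tensor `J (x, ξ) = (ξ, -x)`. -/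
def poisson (d : ℕ) : Phase d →L[ℝ] Phase d :=
  LinearMap.toContinuousLinearMap
    { toFun := fun z => phasePoint (mom z) (-pos z)
      map_add' := by
        intro z w
        ext j
        cases j <;> simp [phasePoint, pos, mom, add_comm]
      map_smul' := by
        intro c z
        ext j
        cases j <;> simp [phasePoint, pos, mom] }

/-- `z` solves Hamilton's equations `ẋ = ∂_ξ H`, `ξ̇ = -∂_x H` on `[0, T]`. -/
def IsHamiltonSolution (H : ℝ → Phase d → ℝ) (T : ℝ) (z : ℝ → Phase d) : Prop :=
  ∀ t ∈ Set.Icc 0 T,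
    HasDerivWithinAt z (poisson d (gradient (H t) (z t))) (Set.Icc 0 T) t

/-- The classical assumption on the Hamiltonian on the time interval `[0, T]`: smoothness in all
variables, symbol bounds of some order `m > 0` at each time, and existence of the Hamiltonian
flow on `[0, T]` for every initial datum. -/
structure ClassicalAssumption (l : ℕ) (H : ℝ → Phase d → ℝ) (T : ℝ) : Prop where
  smooth : ContDiffOn ℝ ∞ (fun p : ℝ × Phase d => H p.1 p.2) (Set.Icc 0 T ×ˢ Set.univ)
  symbol : ∃ m : ℝ, 0 < m ∧ ∀ t ∈ Set.Icc 0 T, IsSymbol l m (H t)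
  flow : ∀ w : Phase d, ∃ z : ℝ → Phase d, z 0 = w ∧ IsHamiltonSolution H T z

/-- The Hessian `M_t` of `H(t, ·)` at `z_t`, as a linear map of phase space. -/
def hessianAlong (H : ℝ → Phase d → ℝ) (z : ℝ → Phase d) (t : ℝ) : Phase d →L[ℝ] Phase d :=
  fderiv ℝ (gradient (H t)) (z t)

/-- `F` is the solution of the linearized flow `Ḟ_t = J M_t F_t`, `F_0 = 1`, on `[0, T]`. -/
def IsLinearizedFlow (H : ℝ → Phase d → ℝ) (z : ℝ → Phase d) (T : ℝ)
    (F : ℝ → Phase d →L[ℝ] Phase d) : Prop :=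
  F 0 = ContinuousLinearMap.id ℝ (Phase d) ∧
    ∀ t ∈ Set.Icc 0 T,
      HasDerivWithinAt F ((poisson d ∘L hessianAlong H z t) ∘L F t) (Set.Icc 0 T) t

/-- The supremum `|F|_T` of the operator norms `|F_t|`, `0 ≤ t ≤ T`. -/
def supNorm (F : ℝ → Phase d →L[ℝ] Phase d) (T : ℝ) : ℝ :=
  sSup ((fun t => ‖F t‖) '' Set.Icc 0 T)

/-- The supremum of the energies `E(z_s)`, `0 ≤ s ≤ t`. -/
def supEnergy (l : ℕ) (z : ℝ → Phase d) (t : ℝ) : ℝ :=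
  sSup ((fun s => energy l (z s)) '' Set.Icc 0 t)

/-- The second order Taylor polynomial of `H(t, ·)` at `z_t`. -/
def quadraticHamiltonian (H : ℝ → Phase d → ℝ) (z : ℝ → Phase d) (t : ℝ) (ζ : Phase d) : ℝ :=
  H t (z t) + inner ℝ (gradient (H t) (z t)) (ζ - z t)
    + 1 / 2 * inner ℝ (hessianAlong H z t (ζ - z t)) (ζ - z t)

/-! ### Quantum objects -/

/-- The `ħ`-Weyl quantization
`(2πħ)^{-d} ∬ e^{i (x-y)·ξ/ħ} a((x+y)/2, ξ) ψ(y) dy dξ`, as an iterated integral (first in `y`,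
then in `ξ`). For a symbol `a` and a Schwartz function `ψ` both integrals converge absolutely. -/
def weylQuantization (ħ : ℝ) (a : Phase d → ℝ) (ψ : Conf d → ℂ) (x : Conf d) : ℂ :=
  (((2 * Real.pi * ħ) ^ d)⁻¹ : ℝ) *
    ∫ ξ : Conf d, ∫ y : Conf d,
      Complex.exp (Complex.I / ħ * (inner ℝ (x - y) ξ : ℝ)) *
        (a (phasePoint ((1 / 2 : ℝ) • (x + y)) ξ) : ℂ) * ψ y

/-- The Gaussian `φ₀(x) = (πħ)^{-d/4} e^{-|x|²/(2ħ)}`. -/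
def gaussian (d : ℕ) (ħ : ℝ) (x : Conf d) : ℂ :=
  (((Real.pi * ħ) ^ (-(d : ℝ) / 4) * Real.exp (-‖x‖ ^ 2 / (2 * ħ)) : ℝ) : ℂ)

/-- The Weyl operator `exp(-(i/ħ)(-p·x + q·ħD_x))` with `D_x = -i∂_x`, `z = (q, p)`, that is, the
time one flow of `iħ ∂_s ψ = (-p·x + q·ħD_x) ψ`. That flow is
`ψ_s(x) = e^{(i/ħ)(s p·x - s² p·q/2)} ψ(x - s q)`. -/
def weylOperator (ħ : ℝ) (z : Phase d) (ψ : Conf d → ℂ) (x : Conf d) : ℂ :=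
  Complex.exp (Complex.I / ħ * ((inner ℝ (mom z) x - inner ℝ (mom z) (pos z) / 2 : ℝ) : ℂ)) *
    ψ (x - pos z)

/-- The coherent state `φ_z` centred at `z`. -/
def coherentState (ħ : ℝ) (z : Phase d) : Conf d → ℂ :=
  weylOperator ħ z (gaussian d ħ)

/-- The Schwartz function `ψ` as an element of `L²(ℝ^d)`. -/
def toL2 (ψ : 𝓢(Conf d, ℂ)) : L2 d :=
  ψ.toLp 2 MeasureTheory.volume

/-- The curve of Schwartz functions `ψ` solves `iħ ∂_t ψ = h(t, x, ħD_x) ψ`, `ψ(0) = ψ₀`, on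
`[0, T]`, the time derivative being taken in `L²`. -/
def IsSchrodingerSolution (ħ T : ℝ) (h : ℝ → Phase d → ℝ) (ψ₀ : Conf d → ℂ)
    (ψ : ℝ → 𝓢(Conf d, ℂ)) : Prop :=
  (∀ x, ψ 0 x = ψ₀ x) ∧
    ∀ t ∈ Set.Icc 0 T, ∃ v : L2 d,
      (v =ᵐ[MeasureTheory.volume] weylQuantization ħ (h t) (ψ t)) ∧
      HasDerivWithinAt (fun s => toL2 (ψ s)) ((Complex.I * ħ)⁻¹ • v) (Set.Icc 0 T) t

/-- `U(t, s)` is a unitary propagator on `L²(ℝ^d)` generated by `h(t, x, ħD_x)` for times in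
`[0, T]`: unitarity (in the type), the group law, and the equation
`iħ ∂_t U(t, s) u = h(t, x, ħD_x) U(t, s) u`, tested against Schwartz functions. -/
structure IsUnitaryPropagator (ħ T : ℝ) (h : ℝ → Phase d → ℝ)
    (U : ℝ → ℝ → (L2 d ≃ₗᵢ[ℂ] L2 d)) : Prop where
  refl : ∀ t ∈ Set.Icc 0 T, ∀ u, U t t u = u
  comp : ∀ t ∈ Set.Icc 0 T, ∀ s ∈ Set.Icc 0 T, ∀ r ∈ Set.Icc 0 T, ∀ u,
    U t s (U s r u) = U t r u
  schrodinger : ∀ s ∈ Set.Icc 0 T, ∀ u : L2 d, ∀ χ : 𝓢(Conf d, ℂ), ∀ t ∈ Set.Icc 0 T,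
    HasDerivWithinAt (fun τ => inner ℂ (toL2 χ) (U τ s u))
      ((Complex.I * ħ)⁻¹ *
        ∫ x, starRingEnd ℂ (weylQuantization ħ (h t) χ x) * (U t s u : Conf d → ℂ) x)
      (Set.Icc 0 T) t

/-- `⟨Op(a) ψ, ψ⟩ = c`, with `Op(a) ψ` in `L²` and the `L²` scalar product. -/
def HasExpectation (ħ : ℝ) (a : Phase d → ℝ) (ψ : 𝓢(Conf d, ℂ)) (c : ℂ) : Prop :=
  ∃ v : L2 d, (v =ᵐ[MeasureTheory.volume] weylQuantization ħ a ψ) ∧ inner ℂ (toL2 ψ) v = c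

end

end Semiclassical

open Semiclassical

/-!
The remainder is explicit: with `π^{-d} e^{-|y|²} dy` the standard Gaussian measure of phase space,
`b(ħ, t) = ∫ (a(z_t + √ħ F_t y) - a(z_t)) π^{-d} e^{-|y|²} dy`.

*The evolved state.* A quadratic Hamiltonian maps Gaussians to Gaussians. The solution is
`c_t exp((i/ħ)(p_t·u + ½ u·Γ_t u))` with `u = x - q_t` and `Γ_t = P_t Q_t⁻¹`, where `Q_t`, `P_t` are
the two blocks of the images of the complex frame `e_α + i f_α` under the symplectic map `F_t`.
Symplecticity makes `Q_t` invertible, `Γ_t` symmetric and its imaginary part positive definite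
(`IsSymplectic.isUnit_det`, `IsSymplectic.isSymm_widthMatrix`, `IsSymplectic.imBoundedBelow`). The
linearized flow gives a Riccati equation for `Γ_t` (`hasDerivWithinAt_widthMatrix`), and with it the
Gaussian solves the Schrödinger equation pointwise (`hasDerivWithinAt_gaussFun`). Everything is
dominated uniformly on `[0, T]`, so the time derivative also exists in `L²`
(`hasDerivWithinAt_toL2`, `exists_gaussian_solution`).

Weyl operators are handled directly from their iterated integral: the rules for multiplying a
symbol by a position or a momentum (`weylQuantization_pos_mul`, `weylQuantization_mom_mul`) give the
action of quadratic polynomials on Gaussians and the rapid decay of `Op(a)ψ`.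

*Uniqueness.* For a unitary propagator `U` the overlap `⟨ψ(t), U(t, 0)ψ(0)⟩` has derivative zero; as
both vectors have the same norm, they agree (`IsUnitaryPropagator.apply_eq`).

*Expectation values.* By Fourier inversion `⟨Op(a)ψ, ψ⟩` is the integral of `a` against the Wigner
function of `ψ` (`integral_conj_mul_weylQuantization`). The Wigner function of the Gaussian above is
a multiple of the image of `e^{-|y|²}` under `y ↦ z_t + √ħ F_t y` (`wigner_gaussFun`); the constant
is found from `a = 1` and `‖ψ(t)‖ = 1`. This is the formula for `b`, smooth because Gaussian
averages depend smoothly on centre and covariance (`IsPolySymbol.contDiff_gaussAvg`) and because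
`z_t` and `F_t` are smooth in time.

*The estimate.* The mean value inequality bounds `|a(z_t + √ħ F_t y) - a(z_t)|` by `√ħ |F_t| |y|`
times the supremum of the gradient of `a` on a ball of radius `|y|`, since `√ħ |F_t| ≤ κ ≤ 1`. The
gradient is `O((1 + |x|^{2l} + |ξ|²)^σ)` with `σ = ((l+1)ρ - 1)/(2l)`. This weight changes at most by
a power of `1 + |y|` on that ball, whatever the sign of `σ` (`basicWeight_add_rpow_le`), and is
comparable to `1 + E`. Integration against the Gaussian gives the result
(`exists_gaussAvg_sub_le`).
-/

open scoped FourierTransform LineDeriv Matrix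
open MeasureTheory

namespace Semiclassical
noncomputable section
variable {d : ℕ}

section

/-! ### Phase space coordinates -/

lemma norm_phasePoint_sq (x ξ : Conf d) : ‖phasePoint x ξ‖ ^ 2 = ‖x‖ ^ 2 + ‖ξ‖ ^ 2 := by
  simp [EuclideanSpace.norm_sq_eq, phasePoint]

lemma norm_phasePoint_le (x ξ : Conf d) : ‖phasePoint x ξ‖ ≤ ‖x‖ + ‖ξ‖ := by
  refine abs_le_of_sq_le_sq' ?_ (by positivity) |>.2
  rw [norm_phasePoint_sq]
  nlinarith [norm_nonneg x, norm_nonneg ξ]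

lemma phasePoint_pos_mom (z : Phase d) : phasePoint (pos z) (mom z) = z := by
  ext i
  cases i <;> simp [phasePoint, pos, mom]

@[simp] lemma pos_phasePoint (x ξ : Conf d) : pos (phasePoint x ξ) = x := by
  ext i; simp [phasePoint, pos]

@[simp] lemma mom_phasePoint (x ξ : Conf d) : mom (phasePoint x ξ) = ξ := by
  ext i; simp [phasePoint, mom]

lemma norm_sq_pos_add_mom (z : Phase d) : ‖z‖ ^ 2 = ‖pos z‖ ^ 2 + ‖mom z‖ ^ 2 := by
  conv_lhs => rw [← phasePoint_pos_mom z]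
  exact norm_phasePoint_sq _ _

/-- The inclusion `x ↦ (x, 0)` of configuration space into phase space. -/
def posIncl (d : ℕ) : Conf d →L[ℝ] Phase d :=
  LinearMap.toContinuousLinearMap
    { toFun := fun x => phasePoint x 0
      map_add' := fun x y => by ext i; cases i <;> simp [phasePoint]
      map_smul' := fun c x => by ext i; cases i <;> simp [phasePoint] }

/-- The inclusion `ξ ↦ (0, ξ)` of momentum space into phase space. -/
def momIncl (d : ℕ) : Conf d →L[ℝ] Phase d :=
  LinearMap.toContinuousLinearMap
    { toFun := fun x => phasePoint 0 x
      map_add' := fun x y => by ext i; cases i <;> simp [phasePoint]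
      map_smul' := fun c x => by ext i; cases i <;> simp [phasePoint] }

lemma posIncl_apply (x : Conf d) : posIncl d x = phasePoint x 0 := rfl
lemma momIncl_apply (x : Conf d) : momIncl d x = phasePoint 0 x := rfl

lemma phasePoint_eq (x ξ : Conf d) : phasePoint x ξ = posIncl d x + momIncl d ξ := by
  rw [posIncl_apply, momIncl_apply]
  ext i; cases i <;> simp [phasePoint]

lemma norm_posIncl_le : ‖posIncl d‖ ≤ 1 :=
  ContinuousLinearMap.opNorm_le_bound _ zero_le_one fun x => by
    simpa [posIncl_apply] using norm_phasePoint_le x 0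

lemma continuous_phasePoint : Continuous fun p : Conf d × Conf d => phasePoint p.1 p.2 := by
  simp only [phasePoint_eq]
  fun_prop

/-! ### Integrability from polynomial decay -/

section Decay

variable {V E : Type*} [NormedAddCommGroup V] [NormedSpace ℝ V] [FiniteDimensional ℝ V]
  [MeasurableSpace V] [BorelSpace V] [NormedAddCommGroup E] {μ : Measure V} [μ.IsAddHaarMeasure]

lemma integrable_inv_one_add_norm_pow {K : ℕ} (hK : Module.finrank ℝ V < K) :
    Integrable (fun y : V => ((1 + ‖y‖) ^ K)⁻¹) μ := by
  have := integrable_one_add_norm (E := V) (μ := μ) (r := K) (by exact_mod_cast hK)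
  refine this.congr (ae_of_all _ fun y => ?_)
  simp only
  rw [Real.rpow_neg (by positivity), Real.rpow_natCast]

lemma integrable_of_decay {K : ℕ} (hK : Module.finrank ℝ V < K) {f : V → E}
    (hf : AEStronglyMeasurable f μ) {C : ℝ} (h : ∀ y, (1 + ‖y‖) ^ K * ‖f y‖ ≤ C) :
    Integrable f μ := by
  refine ((integrable_inv_one_add_norm_pow (μ := μ) hK).const_mul C).mono' hf
    (ae_of_all _ fun y => ?_)
  have : 0 < (1 + ‖y‖) ^ K := by positivity
  rw [← div_eq_mul_inv, le_div_iff₀ this, mul_comm]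
  exact h y

lemma integral_norm_le_of_decay {K : ℕ} (hK : Module.finrank ℝ V < K) {f : V → E}
    {C : ℝ} (h : ∀ y, (1 + ‖y‖) ^ K * ‖f y‖ ≤ C) :
    ∫ y, ‖f y‖ ∂μ ≤ C * ∫ y : V, ((1 + ‖y‖) ^ K)⁻¹ ∂μ := by
  rw [← integral_const_mul]
  refine integral_mono_of_nonneg (ae_of_all _ fun y => norm_nonneg _)
    ((integrable_inv_one_add_norm_pow hK).const_mul C) (ae_of_all _ fun y => ?_)
  have : 0 < (1 + ‖y‖) ^ K := by positivity
  simp only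
  rw [← div_eq_mul_inv, le_div_iff₀ this, mul_comm]
  exact h y

end Decay

lemma SchwartzMap.one_add_norm_pow_mul_le (ψ : 𝓢(Conf d, ℂ)) (K n : ℕ) :
    ∃ C, 0 ≤ C ∧ ∀ y, (1 + ‖y‖) ^ K * ‖iteratedFDeriv ℝ n ψ y‖ ≤ C := by
  refine ⟨_, by positivity, fun y => SchwartzMap.one_add_le_sup_seminorm_apply (𝕜 := ℝ)
    (m := (K, n)) le_rfl le_rfl ψ y⟩

/-! ### Symbols of polynomial order -/

/-- Smooth functions on phase space all of whose derivatives are `O((1 + |z|)^M)`, with the same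
power `M` for every order of differentiation. -/
def IsPolySymbol (M : ℕ) (a : Phase d → ℝ) : Prop :=
  ContDiff ℝ ∞ a ∧ ∀ n : ℕ, ∃ C : ℝ, ∀ z : Phase d, ‖iteratedFDeriv ℝ n a z‖ ≤ C * (1 + ‖z‖) ^ M

/-- The inner integral `∫ e^{i(x-y)·ξ/ħ} a((x+y)/2, ξ) ψ(y) dy` of the Weyl quantization. -/
def weylInner (ħ : ℝ) (a : Phase d → ℝ) (ψ : Conf d → ℂ) (x ξ : Conf d) : ℂ :=
  ∫ y : Conf d, Complex.exp (Complex.I / ħ * (inner ℝ (x - y) ξ : ℝ)) *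
        (a (phasePoint ((1 / 2 : ℝ) • (x + y)) ξ) : ℂ) * ψ y

lemma weylQuantization_eq (ħ : ℝ) (a : Phase d → ℝ) (ψ : Conf d → ℂ) (x : Conf d) :
    weylQuantization ħ a ψ x = (((2 * Real.pi * ħ) ^ d)⁻¹ : ℝ) * ∫ ξ, weylInner ħ a ψ x ξ := rfl

/-- The amplitude `y ↦ a((x+y)/2, ξ) ψ(y)`. -/
def amplitude (a : Phase d → ℝ) (ψ : Conf d → ℂ) (x ξ y : Conf d) : ℂ :=
  a (phasePoint ((1 / 2 : ℝ) • (x + y)) ξ) • ψ y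

lemma midpoint_eq (x ξ y : Conf d) : phasePoint ((1 / 2 : ℝ) • (x + y)) ξ =
    phasePoint ((1 / 2 : ℝ) • x) ξ + ((1 / 2 : ℝ) • posIncl d) y := by
  simp only [phasePoint_eq]
  simp [smul_add]
  abel

lemma one_add_norm_midpoint_le (x ξ y : Conf d) :
    1 + ‖phasePoint ((1 / 2 : ℝ) • (x + y)) ξ‖ ≤ (1 + ‖x‖) * (1 + ‖ξ‖) * (1 + ‖y‖) := by
  have h1 := norm_phasePoint_le ((1 / 2 : ℝ) • (x + y)) ξ
  have h2 : ‖(1 / 2 : ℝ) • (x + y)‖ ≤ ‖x‖ + ‖y‖ := by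
    rw [norm_smul]
    have := norm_add_le x y
    norm_num
    linarith [norm_nonneg x, norm_nonneg y]
  have hx := norm_nonneg x
  have hy := norm_nonneg y
  have hξ := norm_nonneg ξ
  nlinarith [mul_nonneg hx hy, mul_nonneg hx hξ, mul_nonneg hy hξ,
    mul_nonneg (mul_nonneg hx hξ) hy]

variable {M : ℕ} {a : Phase d → ℝ}

lemma IsPolySymbol.contDiff_amplitude (ha : IsPolySymbol M a) (ψ : 𝓢(Conf d, ℂ))
    (x ξ : Conf d) : ContDiff ℝ ∞ (amplitude a ψ x ξ) := by
  unfold amplitude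
  simp only [midpoint_eq]
  exact (ha.1.comp (contDiff_const.add (ContinuousLinearMap.contDiff _))).smul (ψ.smooth ⊤)

lemma IsPolySymbol.exists_bound (ha : IsPolySymbol M a) (n : ℕ) :
    ∃ C, 0 ≤ C ∧ ∀ z : Phase d, ‖iteratedFDeriv ℝ n a z‖ ≤ C * (1 + ‖z‖) ^ M := by
  obtain ⟨C, hC⟩ := ha.2 n
  refine ⟨|C|, abs_nonneg _, fun z => (hC z).trans ?_⟩
  gcongr
  exact le_abs_self C

lemma IsPolySymbol.iteratedFDeriv_midpoint_le (ha : IsPolySymbol M a) (n : ℕ) :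
    ∃ C, 0 ≤ C ∧ ∀ x ξ y : Conf d,
      ‖iteratedFDeriv ℝ n (fun y => a (phasePoint ((1 / 2 : ℝ) • (x + y)) ξ)) y‖ ≤
        C * ((1 + ‖x‖) * (1 + ‖ξ‖) * (1 + ‖y‖)) ^ M := by
  obtain ⟨C, hC0, hC⟩ := ha.exists_bound n
  refine ⟨C, hC0, fun x ξ y => ?_⟩
  set c := phasePoint ((1 / 2 : ℝ) • x) ξ
  set L : Conf d →L[ℝ] Phase d := (1 / 2 : ℝ) • posIncl d
  have hL : ‖L‖ ≤ 1 := by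
    rw [norm_smul]
    have := norm_posIncl_le (d := d)
    norm_num
    linarith
  have hfun : (fun y => a (phasePoint ((1 / 2 : ℝ) • (x + y)) ξ)) = (fun w => a (c + w)) ∘ L := by
    funext y
    simp only [Function.comp, midpoint_eq, c, L]
  have hsm : ContDiff ℝ ∞ (fun w => a (c + w)) := ha.1.comp (contDiff_const.add contDiff_id)
  rw [hfun, ContinuousLinearMap.iteratedFDeriv_comp_right L hsm y (i := n)
    (by exact_mod_cast le_top)]
  refine (ContinuousMultilinearMap.norm_compContinuousLinearMap_le _ _).trans ?_
  rw [iteratedFDeriv_comp_add_left]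
  have h1 : c + L y = phasePoint ((1 / 2 : ℝ) • (x + y)) ξ := by rw [midpoint_eq]
  rw [h1, Finset.prod_const]
  calc _ ≤ ‖iteratedFDeriv ℝ n a (phasePoint ((1 / 2 : ℝ) • (x + y)) ξ)‖ * 1 := by
        gcongr
        exact pow_le_one₀ (norm_nonneg _) hL
    _ ≤ C * (1 + ‖phasePoint ((1 / 2 : ℝ) • (x + y)) ξ‖) ^ M := by
        rw [mul_one]; exact hC _
    _ ≤ _ := by
        gcongr
        exact one_add_norm_midpoint_le x ξ y

lemma IsPolySymbol.amplitude_decay (ha : IsPolySymbol M a) (ψ : 𝓢(Conf d, ℂ)) (n K : ℕ) :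
    ∃ C, 0 ≤ C ∧ ∀ x ξ y : Conf d,
      (1 + ‖y‖) ^ K * ‖iteratedFDeriv ℝ n (amplitude a ψ x ξ) y‖ ≤
        C * ((1 + ‖x‖) * (1 + ‖ξ‖)) ^ M := by
  choose A hA0 hA using fun i => ha.iteratedFDeriv_midpoint_le i
  choose B hB0 hB using fun i => SchwartzMap.one_add_norm_pow_mul_le ψ (K + M) i
  refine ⟨∑ i ∈ Finset.range (n + 1), (n.choose i : ℝ) * A i * B (n - i),
    Finset.sum_nonneg fun i _ => by have := hA0 i; have := hB0 (n - i); positivity,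
    fun x ξ y => ?_⟩
  have hsm : ContDiff ℝ ∞ (fun y => a (phasePoint ((1 / 2 : ℝ) • (x + y)) ξ)) := by
    simp only [midpoint_eq]
    exact ha.1.comp (contDiff_const.add (ContinuousLinearMap.contDiff _))
  have h := norm_iteratedFDeriv_smul_le (𝕜 := ℝ) (𝕜' := ℝ) hsm (ψ.smooth ⊤) y (n := n)
    (by exact_mod_cast le_top)
  calc _ ≤ (1 + ‖y‖) ^ K * _ := by gcongr; exact h
    _ = ∑ i ∈ Finset.range (n + 1), (1 + ‖y‖) ^ K * ((n.choose i : ℝ) *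
          ‖iteratedFDeriv ℝ i (fun y => a (phasePoint ((1 / 2 : ℝ) • (x + y)) ξ)) y‖ *
          ‖iteratedFDeriv ℝ (n - i) ψ y‖) := Finset.mul_sum _ _ _
    _ ≤ ∑ i ∈ Finset.range (n + 1), ((n.choose i : ℝ) * A i * B (n - i)) *
          ((1 + ‖x‖) * (1 + ‖ξ‖)) ^ M := by
        refine Finset.sum_le_sum fun i _ => ?_
        have h1 := hA i x ξ y
        have h2 := hB (n - i) y
        have := hA0 i
        calc _ ≤ (1 + ‖y‖) ^ K * ((n.choose i : ℝ) *
              (A i * ((1 + ‖x‖) * (1 + ‖ξ‖) * (1 + ‖y‖)) ^ M) *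
              ‖iteratedFDeriv ℝ (n - i) ψ y‖) := by gcongr
          _ = (n.choose i : ℝ) * A i * ((1 + ‖x‖) * (1 + ‖ξ‖)) ^ M *
              ((1 + ‖y‖) ^ (K + M) * ‖iteratedFDeriv ℝ (n - i) ψ y‖) := by
            rw [mul_pow _ (1 + ‖y‖), pow_add]; ring
          _ ≤ (n.choose i : ℝ) * A i * ((1 + ‖x‖) * (1 + ‖ξ‖)) ^ M * B (n - i) := by gcongr
          _ = _ := by ring
    _ = _ := by rw [Finset.sum_mul]

lemma finrank_conf_lt : Module.finrank ℝ (Conf d) < d + 1 := by simp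

lemma IsPolySymbol.integrable_amplitude (ha : IsPolySymbol M a) (ψ : 𝓢(Conf d, ℂ)) (n : ℕ)
    (x ξ : Conf d) : Integrable (iteratedFDeriv ℝ n (amplitude a ψ x ξ)) := by
  obtain ⟨C, -, hC⟩ := ha.amplitude_decay ψ n (d + 1)
  exact integrable_of_decay finrank_conf_lt
    ((ha.contDiff_amplitude ψ x ξ).continuous_iteratedFDeriv (by exact_mod_cast le_top)
      |>.aestronglyMeasurable) (hC x ξ)

lemma IsPolySymbol.integral_amplitude_le (ha : IsPolySymbol M a) (ψ : 𝓢(Conf d, ℂ)) (n : ℕ) :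
    ∃ C, 0 ≤ C ∧ ∀ x ξ : Conf d,
      ∫ y, ‖iteratedFDeriv ℝ n (amplitude a ψ x ξ) y‖ ≤ C * ((1 + ‖x‖) * (1 + ‖ξ‖)) ^ M := by
  obtain ⟨C, hC0, hC⟩ := ha.amplitude_decay ψ n (d + 1)
  refine ⟨C * ∫ y : Conf d, ((1 + ‖y‖) ^ (d + 1))⁻¹,
    mul_nonneg hC0 (integral_nonneg fun y => by positivity), fun x ξ => ?_⟩
  exact (integral_norm_le_of_decay finrank_conf_lt (hC x ξ)).trans_eq (by ring)

lemma weylInner_eq_fourier {ħ : ℝ} (hħ : 0 < ħ) (a : Phase d → ℝ) (ψ : Conf d → ℂ)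
    (x ξ : Conf d) :
    weylInner ħ a ψ x ξ = Complex.exp (Complex.I / ħ * (inner ℝ x ξ : ℝ)) *
      𝓕 (amplitude a ψ x ξ) ((2 * Real.pi * ħ)⁻¹ • ξ) := by
  rw [weylInner, Real.fourier_eq', ← integral_const_mul]
  congr 1
  funext y
  rw [amplitude, Complex.real_smul, smul_eq_mul, ← mul_assoc, ← mul_assoc, ← Complex.exp_add,
    mul_assoc, mul_assoc]
  congr 2
  have hp : (Real.pi : ℂ) ≠ 0 := by exact_mod_cast Real.pi_ne_zero
  have hh : (ħ : ℂ) ≠ 0 := by exact_mod_cast hħ.ne'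
  rw [inner_sub_left, inner_smul_right]
  push_cast
  field_simp
  ring

/-- The inner integral is, after rescaling, the Fourier transform of a Schwartz-type amplitude in
`y`; hence it decays rapidly in `ξ`, which makes the outer integral absolutely convergent. -/
lemma IsPolySymbol.weylInner_decay (ha : IsPolySymbol M a) {ħ : ℝ} (hħ : 0 < ħ)
    (ψ : 𝓢(Conf d, ℂ)) (N : ℕ) :
    ∃ C, 0 ≤ C ∧ ∀ x ξ : Conf d, (1 + ‖ξ‖) ^ N * ‖weylInner ħ a ψ x ξ‖ ≤ C * (1 + ‖x‖) ^ M := by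
  choose B hB0 hB using fun i => ha.integral_amplitude_le ψ i
  have key : ∀ n : ℕ, ∀ x ξ : Conf d,
      ‖ξ‖ ^ n * ‖weylInner ħ a ψ x ξ‖ ≤ (2 * Real.pi * ħ) ^ n * (2 ^ n *
        ∑ i ∈ Finset.range (n + 1), B i) * ((1 + ‖x‖) * (1 + ‖ξ‖)) ^ M := by
    intro n x ξ
    set w : Conf d := (2 * Real.pi * ħ)⁻¹ • ξ
    have h2 : 0 < 2 * Real.pi * ħ := by positivity
    have hw : ‖ξ‖ = (2 * Real.pi * ħ) * ‖w‖ := by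
      rw [norm_smul, Real.norm_of_nonneg (by positivity)]
      field_simp
    have hn : ‖weylInner ħ a ψ x ξ‖ = ‖𝓕 (amplitude a ψ x ξ) w‖ := by
      rw [weylInner_eq_fourier hħ, norm_mul]
      have : Complex.I / ħ * (inner ℝ x ξ : ℝ) = ((inner ℝ x ξ / ħ : ℝ) : ℂ) * Complex.I := by
        push_cast; ring
      rw [this, Complex.norm_exp_ofReal_mul_I, one_mul]
    have h3 := Real.pow_mul_norm_iteratedFDeriv_fourier_le (f := amplitude a ψ x ξ) (K := 0)
      (N := ⊤) (ha.contDiff_amplitude ψ x ξ) (fun k n hk _ => by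
        have : k = 0 := by simpa using hk
        subst this
        simpa using (ha.integrable_amplitude ψ n x ξ).norm) (k := 0) (n := n) le_rfl le_top w
    simp only [norm_iteratedFDeriv_zero, pow_zero, one_mul, CharP.cast_eq_zero, mul_zero,
      zero_add, Finset.range_one, Finset.sum_product, Finset.sum_singleton] at h3
    have h5 : ‖w‖ ^ n * ‖𝓕 (amplitude a ψ x ξ) w‖ ≤
        2 ^ n * ∑ i ∈ Finset.range (n + 1), B i * ((1 + ‖x‖) * (1 + ‖ξ‖)) ^ M := by
      refine h3.trans ?_
      gcongr with i _
      exact hB i x ξ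
    calc ‖ξ‖ ^ n * ‖weylInner ħ a ψ x ξ‖
        = (2 * Real.pi * ħ) ^ n * (‖w‖ ^ n * ‖𝓕 (amplitude a ψ x ξ) w‖) := by
          rw [hn]; nth_rewrite 1 [hw]; ring
      _ ≤ (2 * Real.pi * ħ) ^ n * (2 ^ n * ∑ i ∈ Finset.range (n + 1),
            B i * ((1 + ‖x‖) * (1 + ‖ξ‖)) ^ M) := by gcongr
      _ = _ := by rw [← Finset.sum_mul]; ring
  set D : ℕ → ℝ := fun n => (2 * Real.pi * ħ) ^ n * (2 ^ n * ∑ i ∈ Finset.range (n + 1), B i)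
  have hD : ∀ n, 0 ≤ D n := fun n => by
    have : 0 ≤ ∑ i ∈ Finset.range (n + 1), B i := Finset.sum_nonneg fun i _ => hB0 i
    positivity
  refine ⟨2 ^ (N + M) * (D 0 + D (N + M)), by have := hD 0; have := hD (N + M); positivity,
    fun x ξ => ?_⟩
  have h0 := key 0 x ξ
  have h1 := key (N + M) x ξ
  have h4 : (1 + ‖ξ‖) ^ (N + M) ≤ 2 ^ (N + M) * (1 + ‖ξ‖ ^ (N + M)) := by
    have := add_pow_le (zero_le_one) (norm_nonneg ξ) (N + M)
    rw [one_pow] at this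
    refine this.trans ?_
    gcongr
    · norm_num
    · omega
  have hpos : 0 < (1 + ‖ξ‖) ^ M := by positivity
  refine le_of_mul_le_mul_right ?_ hpos
  calc (1 + ‖ξ‖) ^ N * ‖weylInner ħ a ψ x ξ‖ * (1 + ‖ξ‖) ^ M
      = (1 + ‖ξ‖) ^ (N + M) * ‖weylInner ħ a ψ x ξ‖ := by rw [pow_add]; ring
    _ ≤ 2 ^ (N + M) * (1 + ‖ξ‖ ^ (N + M)) * ‖weylInner ħ a ψ x ξ‖ := by gcongr
    _ = 2 ^ (N + M) * (‖ξ‖ ^ 0 * ‖weylInner ħ a ψ x ξ‖ +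
          ‖ξ‖ ^ (N + M) * ‖weylInner ħ a ψ x ξ‖) := by ring
    _ ≤ 2 ^ (N + M) * (D 0 * ((1 + ‖x‖) * (1 + ‖ξ‖)) ^ M +
          D (N + M) * ((1 + ‖x‖) * (1 + ‖ξ‖)) ^ M) := by gcongr
    _ = _ := by rw [mul_pow]; ring

end

section

variable {M : ℕ} {a : Phase d → ℝ}

/-! ### Algebra of polynomially bounded symbols -/

lemma IsPolySymbol.add {b : Phase d → ℝ} (ha : IsPolySymbol M a) (hb : IsPolySymbol M b) :
    IsPolySymbol M (fun z => a z + b z) := by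
  refine ⟨ha.1.add hb.1, fun n => ?_⟩
  obtain ⟨A, hA⟩ := ha.2 n
  obtain ⟨B, hB⟩ := hb.2 n
  refine ⟨A + B, fun z => ?_⟩
  have : iteratedFDeriv ℝ n (fun z => a z + b z) z =
      iteratedFDeriv ℝ n a z + iteratedFDeriv ℝ n b z :=
    iteratedFDeriv_add_apply (ha.1.contDiffAt.of_le (by exact_mod_cast le_top))
      (hb.1.contDiffAt.of_le (by exact_mod_cast le_top))
  rw [this, add_mul]
  exact (norm_add_le _ _).trans (add_le_add (hA z) (hB z))

lemma IsPolySymbol.mul {N : ℕ} {b : Phase d → ℝ} (ha : IsPolySymbol M a)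
    (hb : IsPolySymbol N b) : IsPolySymbol (M + N) (fun z => a z * b z) := by
  refine ⟨ha.1.mul hb.1, fun n => ?_⟩
  choose A hA0 hA using fun i => ha.exists_bound i
  choose B hB0 hB using fun i => hb.exists_bound i
  refine ⟨∑ i ∈ Finset.range (n + 1), (n.choose i : ℝ) * A i * B (n - i), fun z => ?_⟩
  refine (norm_iteratedFDeriv_mul_le ha.1 hb.1 z (n := n) (by exact_mod_cast le_top)).trans ?_
  rw [Finset.sum_mul]
  refine Finset.sum_le_sum fun i _ => ?_
  have h1 := hA i z
  have h2 := hB (n - i) z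
  have := hA0 i
  calc _ ≤ (n.choose i : ℝ) * (A i * (1 + ‖z‖) ^ M) * (B (n - i) * (1 + ‖z‖) ^ N) := by gcongr
    _ = _ := by rw [pow_add]; ring

lemma IsPolySymbol.mono {N : ℕ} (ha : IsPolySymbol M a) (h : M ≤ N) : IsPolySymbol N a := by
  refine ⟨ha.1, fun n => ?_⟩
  obtain ⟨C, hC0, hC⟩ := ha.exists_bound n
  refine ⟨C, fun z => (hC z).trans ?_⟩
  gcongr
  linarith [norm_nonneg z]

lemma isPolySymbol_const (c : ℝ) : IsPolySymbol 0 (fun _ : Phase d => c) := by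
  refine ⟨contDiff_const, fun n => ?_⟩
  rcases n with _ | n
  · exact ⟨|c|, fun z => by simp⟩
  · exact ⟨0, fun z => by simp [iteratedFDeriv_const_of_ne (Nat.succ_ne_zero n)]⟩

lemma IsPolySymbol.const_mul (ha : IsPolySymbol M a) (c : ℝ) :
    IsPolySymbol M (fun z => c * a z) := by
  simpa using (isPolySymbol_const c).mul ha

lemma IsPolySymbol.sum {ι : Type*} (s : Finset ι) {b : ι → Phase d → ℝ}
    (hb : ∀ i ∈ s, IsPolySymbol M (b i)) : IsPolySymbol M (fun z => ∑ i ∈ s, b i z) := by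
  classical
  induction s using Finset.induction_on with
  | empty => simpa using (isPolySymbol_const (d := d) 0).mono (Nat.zero_le M)
  | insert i s hi ih =>
    simp only [Finset.sum_insert hi]
    exact (hb i (by simp)).add (ih fun j hj => hb j (by simp [hj]))

lemma isPolySymbol_clm (L : Phase d →L[ℝ] ℝ) : IsPolySymbol 1 (fun z => L z) := by
  refine ⟨L.contDiff, fun n => ?_⟩
  rcases n with _ | n
  · refine ⟨‖L‖, fun z => ?_⟩
    rw [norm_iteratedFDeriv_zero, pow_one]
    refine (L.le_opNorm z).trans ?_
    gcongr
    linarith [norm_nonneg z]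
  · refine ⟨‖L‖, fun z => ?_⟩
    rw [← norm_iteratedFDeriv_fderiv]
    have : fderiv ℝ (fun z => L z) = fun _ => L := by ext1 z; exact L.fderiv
    rw [this]
    rcases n with _ | n
    · simp only [norm_iteratedFDeriv_zero, pow_one]
      nlinarith [norm_nonneg z, norm_nonneg L]
    · rw [iteratedFDeriv_const_of_ne (Nat.succ_ne_zero n)]
      simp; positivity

lemma IsPolySymbol.fderiv_apply (ha : IsPolySymbol M a) (v : Phase d) :
    IsPolySymbol M (fun z => fderiv ℝ a z v) := by
  have h1 : ContDiff ℝ ∞ (fderiv ℝ a) := ha.1.fderiv_right (by simp)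
  refine ⟨h1.clm_apply contDiff_const, fun n => ?_⟩
  obtain ⟨C, hC0, hC⟩ := ha.exists_bound (n + 1)
  refine ⟨‖v‖ * C, fun z => ?_⟩
  have := norm_iteratedFDeriv_clm_apply_const (𝕜 := ℝ) (c := v) (x := z) (n := n)
    (h1.contDiffAt (x := z)) (by exact_mod_cast le_top)
  refine this.trans ?_
  rw [norm_iteratedFDeriv_fderiv, mul_assoc]
  gcongr
  exact hC z

/-! ### Regularity and linearity of the inner integral -/

lemma norm_exp_I_div_mul (ħ s : ℝ) : ‖Complex.exp (Complex.I / ħ * (s : ℝ))‖ = 1 := by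
  have : Complex.I / ħ * (s : ℝ) = ((s / ħ : ℝ) : ℂ) * Complex.I := by
    push_cast; ring
  rw [this, Complex.norm_exp_ofReal_mul_I]

lemma weylInner_eq_amplitude (ħ : ℝ) (a : Phase d → ℝ) (ψ : Conf d → ℂ) (x ξ : Conf d) :
    weylInner ħ a ψ x ξ =
      ∫ y, Complex.exp (Complex.I / ħ * (inner ℝ (x - y) ξ : ℝ)) * amplitude a ψ x ξ y := by
  simp only [weylInner, amplitude, Complex.real_smul, mul_assoc]

lemma stronglyMeasurable_weylInner (ħ : ℝ) (ha : Continuous a) {ψ : Conf d → ℂ}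
    (hψ : Continuous ψ) :
    StronglyMeasurable (fun p : Conf d × Conf d => weylInner ħ a ψ p.1 p.2) := by
  unfold weylInner
  refine StronglyMeasurable.integral_prod_right (f := fun (p : Conf d × Conf d) (y : Conf d) =>
    Complex.exp (Complex.I / ħ * (inner ℝ (p.1 - y) p.2 : ℝ)) *
        (a (phasePoint ((1 / 2 : ℝ) • (p.1 + y)) p.2) : ℂ) * ψ y) ?_
  refine Continuous.stronglyMeasurable ?_
  simp only [Function.uncurry_def]
  refine ((Complex.continuous_exp.comp (continuous_const.mul (Complex.continuous_ofReal.comp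
    (by fun_prop)))).mul (Complex.continuous_ofReal.comp (ha.comp ?_))).mul
    (hψ.comp continuous_snd)
  exact continuous_phasePoint.comp (f := fun p : (Conf d × Conf d) × Conf d =>
    ((1 / 2 : ℝ) • (p.1.1 + p.2), p.1.2)) (by fun_prop)

lemma IsPolySymbol.integrable_integrand (ha : IsPolySymbol M a) (ħ : ℝ) (ψ : 𝓢(Conf d, ℂ))
    (x ξ : Conf d) : Integrable
      (fun y => Complex.exp (Complex.I / ħ * (inner ℝ (x - y) ξ : ℝ)) * amplitude a ψ x ξ y) := by
  have h0 := ha.integrable_amplitude ψ 0 x ξ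
  have h1 : Integrable (amplitude a ψ x ξ) :=
    (integrable_norm_iff (ha.contDiff_amplitude ψ x ξ).continuous.aestronglyMeasurable).1
      (by simpa using h0.norm)
  refine h1.bdd_mul (c := 1) ?_ (ae_of_all _ fun y => (norm_exp_I_div_mul _ _).le)
  exact Continuous.aestronglyMeasurable (Complex.continuous_exp.comp
    (continuous_const.mul (Complex.continuous_ofReal.comp (by fun_prop))))

lemma IsPolySymbol.integrable_weylInner (ha : IsPolySymbol M a) {ħ : ℝ} (hħ : 0 < ħ)
    (ψ : 𝓢(Conf d, ℂ)) (x : Conf d) : Integrable (weylInner ħ a ψ x) := by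
  obtain ⟨C, -, hC⟩ := ha.weylInner_decay hħ ψ (d + 1)
  exact integrable_of_decay finrank_conf_lt
    ((stronglyMeasurable_weylInner ħ ha.1.continuous ψ.continuous).comp_measurable
      (measurable_prodMk_left (x := x))).aestronglyMeasurable (hC x)

lemma IsPolySymbol.weylQuantization_le (ha : IsPolySymbol M a) {ħ : ℝ} (hħ : 0 < ħ)
    (ψ : 𝓢(Conf d, ℂ)) :
    ∃ C, 0 ≤ C ∧ ∀ x, ‖weylQuantization ħ a ψ x‖ ≤ C * (1 + ‖x‖) ^ M := by
  obtain ⟨C, hC0, hC⟩ := ha.weylInner_decay hħ ψ (d + 1)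
  set c : ℝ := ((2 * Real.pi * ħ) ^ d)⁻¹
  have hc : 0 ≤ c := by positivity
  refine ⟨c * (C * ∫ y : Conf d, ((1 + ‖y‖) ^ (d + 1))⁻¹),
    mul_nonneg hc (mul_nonneg hC0 (integral_nonneg fun y => by positivity)), fun x => ?_⟩
  rw [weylQuantization_eq, norm_mul, Complex.norm_real, Real.norm_of_nonneg hc, mul_assoc]
  gcongr
  refine (norm_integral_le_integral_norm _).trans ?_
  exact (integral_norm_le_of_decay finrank_conf_lt (hC x)).trans_eq (by ring)

lemma weylInner_add {b : Phase d → ℝ} {N : ℕ} (ha : IsPolySymbol M a) (hb : IsPolySymbol N b)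
    (ħ : ℝ) (ψ : 𝓢(Conf d, ℂ)) (x ξ : Conf d) :
    weylInner ħ (fun z => a z + b z) ψ x ξ = weylInner ħ a ψ x ξ + weylInner ħ b ψ x ξ := by
  simp only [weylInner_eq_amplitude]
  rw [← integral_add (ha.integrable_integrand ħ ψ x ξ) (hb.integrable_integrand ħ ψ x ξ)]
  congr 1; funext y
  simp only [amplitude, add_smul]; ring

lemma weylQuantization_add {b : Phase d → ℝ} {N : ℕ} (ha : IsPolySymbol M a)
    (hb : IsPolySymbol N b) {ħ : ℝ} (hħ : 0 < ħ) (ψ : 𝓢(Conf d, ℂ)) (x : Conf d) :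
    weylQuantization ħ (fun z => a z + b z) ψ x =
      weylQuantization ħ a ψ x + weylQuantization ħ b ψ x := by
  simp only [weylQuantization_eq, weylInner_add ha hb]
  rw [integral_add (ha.integrable_weylInner hħ ψ x) (hb.integrable_weylInner hħ ψ x)]
  ring

lemma weylQuantization_const_mul (ħ c : ℝ) (a : Phase d → ℝ) (ψ : Conf d → ℂ) (x : Conf d) :
    weylQuantization ħ (fun z => c * a z) ψ x = c * weylQuantization ħ a ψ x := by
  simp only [weylQuantization_eq, weylInner_eq_amplitude, amplitude, mul_smul, Complex.real_smul]
  rw [mul_left_comm (c : ℂ), ← integral_const_mul (c : ℂ)]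
  congr 2; funext ξ
  rw [← integral_const_mul]
  congr 1; funext y
  ring

lemma weylQuantization_sum {ι : Type*} (s : Finset ι) {b : ι → Phase d → ℝ}
    (hb : ∀ i ∈ s, IsPolySymbol M (b i)) {ħ : ℝ} (hħ : 0 < ħ) (ψ : 𝓢(Conf d, ℂ)) (x : Conf d) :
    weylQuantization ħ (fun z => ∑ i ∈ s, b i z) ψ x =
      ∑ i ∈ s, weylQuantization ħ (b i) ψ x := by
  classical
  induction s using Finset.induction_on with
  | empty => simp [weylQuantization]
  | insert i s hi ih =>
    simp only [Finset.sum_insert hi]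
    rw [weylQuantization_add (hb i (by simp)) (IsPolySymbol.sum s fun j hj => hb j (by simp [hj]))
      hħ, ih fun j hj => hb j (by simp [hj])]

/-! ### Commutation rules -/

/-- Multiplication of a symbol by a linear function of the position. -/
lemma weylQuantization_pos_mul (ha : IsPolySymbol M a) {ħ : ℝ} (hħ : 0 < ħ) (w : Conf d)
    {ψ ψ' : 𝓢(Conf d, ℂ)} (hψ' : ∀ y, ψ' y = (inner ℝ w y : ℝ) * ψ y) (x : Conf d) :
    weylQuantization ħ (fun z => inner ℝ w (pos z) * a z) ψ x =
      1 / 2 * ((inner ℝ w x : ℝ) * weylQuantization ħ a ψ x + weylQuantization ħ a ψ' x) := by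
  have h : ∀ ξ, weylInner ħ (fun z => inner ℝ w (pos z) * a z) ψ x ξ =
      1 / 2 * ((inner ℝ w x : ℝ) * weylInner ħ a ψ x ξ + weylInner ħ a ψ' x ξ) := by
    intro ξ
    simp only [weylInner_eq_amplitude]
    rw [← integral_const_mul, ← integral_add ((ha.integrable_integrand ħ ψ x ξ).const_mul _)
      (ha.integrable_integrand ħ ψ' x ξ), ← integral_const_mul]
    congr 1; funext y
    simp only [amplitude, Complex.real_smul, hψ', pos_phasePoint, inner_smul_right, inner_add_right]
    push_cast
    ring
  simp only [weylQuantization_eq, h]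
  rw [integral_const_mul, integral_add ((ha.integrable_weylInner hħ ψ x).const_mul _)
    (ha.integrable_weylInner hħ ψ' x), integral_const_mul]
  ring

lemma hasLineDerivAt_exp_phase (ħ : ℝ) (x ξ y w : Conf d) :
    HasLineDerivAt ℝ (fun y => Complex.exp (Complex.I / ħ * (inner ℝ (x - y) ξ : ℝ)))
      (-(Complex.I / ħ * (inner ℝ w ξ : ℝ)) *
        Complex.exp (Complex.I / ħ * (inner ℝ (x - y) ξ : ℝ))) y w := by
  unfold HasLineDerivAt
  have h1 : HasDerivAt (fun t : ℝ => ((inner ℝ (x - (y + t • w)) ξ : ℝ) : ℂ))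
      (-(inner ℝ w ξ : ℝ) : ℂ) 0 := by
    have : (fun t : ℝ => ((inner ℝ (x - (y + t • w)) ξ : ℝ) : ℂ)) =
        fun t : ℝ => ((inner ℝ (x - y) ξ - t * inner ℝ w ξ : ℝ) : ℂ) := by
      funext t
      rw [← sub_sub, inner_sub_left, inner_smul_left]; simp
    rw [this]
    have h2 := ((hasDerivAt_id (0 : ℝ)).mul_const (inner ℝ w ξ)).const_sub (inner ℝ (x - y) ξ)
    convert! h2.ofReal_comp using 1
    simp
  convert! (h1.const_mul (Complex.I / ħ)).cexp using 1
  simp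
  ring

/-- Multiplication of a symbol by a linear function of the momentum, obtained by integrating by
parts in the inner integral. -/
lemma weylQuantization_mom_mul (ha : IsPolySymbol M a) {ħ : ℝ} (hħ : 0 < ħ) (w : Conf d)
    {ψ ψ' : 𝓢(Conf d, ℂ)} (hψ' : ∀ y, ψ' y = -(Complex.I * ħ) * fderiv ℝ ψ y w) (x : Conf d) :
    weylQuantization ħ (fun z => inner ℝ w (mom z) * a z) ψ x =
      weylQuantization ħ a ψ' x - Complex.I * ħ / 2 *
        weylQuantization ħ (fun z => fderiv ℝ a z (posIncl d w)) ψ x := by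
  have hda := ha.fderiv_apply (posIncl d w)
  have hh : (ħ : ℂ) ≠ 0 := by exact_mod_cast hħ.ne'
  have h : ∀ ξ, weylInner ħ (fun z => inner ℝ w (mom z) * a z) ψ x ξ =
      weylInner ħ a ψ' x ξ - Complex.I * ħ / 2 *
        weylInner ħ (fun z => fderiv ℝ a z (posIncl d w)) ψ x ξ := by
    intro ξ
    simp only [weylInner_eq_amplitude]
    set e : Conf d → ℂ := fun y => Complex.exp (Complex.I / ħ * (inner ℝ (x - y) ξ : ℝ)) with he
    have hder : ∀ y, HasLineDerivAt ℝ (amplitude a ψ x ξ)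
        (amplitude (fun z => fderiv ℝ a z (posIncl d w)) ψ x ξ y / 2 +
          Complex.I / ħ * amplitude a ψ' x ξ y) y w := by
      intro y
      have h1 : HasFDerivAt (fun y => a (phasePoint ((1 / 2 : ℝ) • (x + y)) ξ))
          ((fderiv ℝ a (phasePoint ((1 / 2 : ℝ) • (x + y)) ξ)).comp
            ((1 / 2 : ℝ) • posIncl d)) y := by
        have h2 := (ha.1.differentiable (by simp) _).hasFDerivAt
          (x := phasePoint ((1 / 2 : ℝ) • (x + y)) ξ)
        refine h2.comp y ?_
        simp only [midpoint_eq]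
        exact (ContinuousLinearMap.hasFDerivAt _).const_add _
      have h3 := (h1.smul ψ.differentiableAt.hasFDerivAt).hasLineDerivAt w
      convert! h3 using 1
      simp only [amplitude, hψ', Complex.real_smul]
      simp
      field_simp
      rw [Complex.I_sq]
      ring
    have hint := integral_bilinear_hasLineDerivAt_right_eq_neg_left_of_integrable
      (μ := (volume : Measure (Conf d))) (B := ContinuousLinearMap.mul ℝ ℂ) (v := w)
      (f := e) (f' := fun y => -(Complex.I / ħ * (inner ℝ w ξ : ℝ)) * e y)
      (g := amplitude a ψ x ξ) (g' := fun y =>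
        amplitude (fun z => fderiv ℝ a z (posIncl d w)) ψ x ξ y / 2 +
          Complex.I / ħ * amplitude a ψ' x ξ y)
      (by
        have := (ha.integrable_integrand ħ ψ x ξ).const_mul (-(Complex.I / ħ * (inner ℝ w ξ : ℝ)))
        refine this.congr (ae_of_all _ fun y => ?_)
        simp [he, mul_assoc])
      (by
        have := ((hda.integrable_integrand ħ ψ x ξ).const_mul (1 / 2)).add
          ((ha.integrable_integrand ħ ψ' x ξ).const_mul (Complex.I / ħ))
        refine this.congr (ae_of_all _ fun y => ?_)
        simp [he]; ring)
      (by simpa [he] using ha.integrable_integrand ħ ψ x ξ)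
      (fun y _ => hasLineDerivAt_exp_phase ħ x ξ y w) (fun y _ => hder y)
    have e1 : ∫ y, (ContinuousLinearMap.mul ℝ ℂ) (e y)
        (amplitude (fun z => fderiv ℝ a z (posIncl d w)) ψ x ξ y / 2 +
          Complex.I / ħ * amplitude a ψ' x ξ y) =
        1 / 2 * (∫ y, e y * amplitude (fun z => fderiv ℝ a z (posIncl d w)) ψ x ξ y) +
          Complex.I / ħ * ∫ y, e y * amplitude a ψ' x ξ y := by
      rw [← integral_const_mul, ← integral_const_mul, ← integral_add
        ((hda.integrable_integrand ħ ψ x ξ).const_mul (1 / 2))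
        ((ha.integrable_integrand ħ ψ' x ξ).const_mul (Complex.I / ħ))]
      congr 1; funext y
      simp; ring
    have e2 : ∫ y, (ContinuousLinearMap.mul ℝ ℂ) (-(Complex.I / ħ * (inner ℝ w ξ : ℝ)) * e y)
        (amplitude a ψ x ξ y) =
        -(Complex.I / ħ) * ∫ y, e y * amplitude (fun z => inner ℝ w (mom z) * a z) ψ x ξ y := by
      rw [← integral_const_mul]
      congr 1; funext y
      simp [amplitude]; ring
    rw [e1, e2] at hint
    have h4 : ∀ A B C : ℂ, 1 / 2 * B + Complex.I / ħ * C = -(-(Complex.I / ħ) * A) →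
        A = C - Complex.I * ħ / 2 * B := by
      intro A B C h
      have h5 : -(Complex.I * ħ) * (1 / 2 * B + Complex.I / ħ * C) =
        -(Complex.I * ħ) * (-(-(Complex.I / ħ) * A)) := by rw [h]
      field_simp at h5
      linear_combination (-Complex.I / 2) * h5 - (C - A) * Complex.I_sq
    exact h4 _ _ _ hint
  simp only [weylQuantization_eq, h]
  rw [integral_sub (ha.integrable_weylInner hħ ψ' x)
    ((hda.integrable_weylInner hħ ψ x).const_mul _), integral_const_mul]
  ring

end

section

variable {M : ℕ} {a : Phase d → ℝ}

/-! ### Decay of `Op(a)ψ` -/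

lemma exists_schwartz_inner_mul (w : Conf d) (ψ : 𝓢(Conf d, ℂ)) :
    ∃ ψ' : 𝓢(Conf d, ℂ), ∀ y, ψ' y = (inner ℝ w y : ℝ) * ψ y :=
  ⟨SchwartzMap.smulLeftCLM ℂ (fun y => inner ℝ w y) ψ, fun y => by
    rw [SchwartzMap.smulLeftCLM_apply_apply (Function.hasTemperateGrowth_inner_right w)]
    simp⟩

lemma IsPolySymbol.amplitude_le (ha : IsPolySymbol M a) (ψ : 𝓢(Conf d, ℂ)) (K : ℕ) :
    ∃ C, 0 ≤ C ∧ ∀ x ξ y : Conf d,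
      ‖amplitude a ψ x ξ y‖ ≤ C * ((1 + ‖x‖) * (1 + ‖ξ‖)) ^ M * ((1 + ‖y‖) ^ K)⁻¹ := by
  obtain ⟨C, hC0, hC⟩ := ha.amplitude_decay ψ 0 K
  refine ⟨C, hC0, fun x ξ y => ?_⟩
  have := hC x ξ y
  rw [norm_iteratedFDeriv_zero] at this
  rw [← div_eq_mul_inv, le_div_iff₀ (by positivity), mul_comm]
  exact this

/-- Differentiation of the inner integral with respect to the momentum. -/
lemma hasLineDerivAt_weylInner (ha : IsPolySymbol M a) {ħ : ℝ} (hħ : 0 < ħ) (w : Conf d)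
    {ψ ψ' : 𝓢(Conf d, ℂ)} (hψ' : ∀ y, ψ' y = (inner ℝ w y : ℝ) * ψ y) (x ξ : Conf d) :
    HasLineDerivAt ℝ (weylInner ħ a ψ x)
      (Complex.I / ħ * ((inner ℝ w x : ℝ) * weylInner ħ a ψ x ξ - weylInner ħ a ψ' x ξ) +
        weylInner ħ (fun z => fderiv ℝ a z (momIncl d w)) ψ x ξ) ξ w := by
  have hda := ha.fderiv_apply (momIncl d w)
  obtain ⟨A, hA0, hA⟩ := ha.amplitude_le ψ (d + 1)
  obtain ⟨B, hB0, hB⟩ := ha.amplitude_le ψ' (d + 1)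
  obtain ⟨D, hD0, hD⟩ := hda.amplitude_le ψ (d + 1)
  set e : ℝ → Conf d → ℂ := fun t y =>
    Complex.exp (Complex.I / ħ * (inner ℝ (x - y) (ξ + t • w) : ℝ)) with he
  set F' : ℝ → Conf d → ℂ := fun t y =>
    Complex.I / ħ * ((inner ℝ w x : ℝ) * (e t y * amplitude a ψ x (ξ + t • w) y)
      - e t y * amplitude a ψ' x (ξ + t • w) y) +
    e t y * amplitude (fun z => fderiv ℝ a z (momIncl d w)) ψ x (ξ + t • w) y with hF'
  set X : ℝ := ((1 + ‖x‖) * (1 + (‖ξ‖ + ‖w‖))) ^ M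
  have hdiff : ∀ y t, HasDerivAt (fun t => e t y * amplitude a ψ x (ξ + t • w) y) (F' t y) t := by
    intro y t
    have h1 : HasDerivAt (fun t : ℝ => ξ + t • w) w t := by
      simpa using ((hasDerivAt_id t).smul_const w).const_add ξ
    have h2 : HasDerivAt (fun t => ((inner ℝ (x - y) (ξ + t • w) : ℝ) : ℂ))
        ((inner ℝ (x - y) w : ℝ) : ℂ) t := by
      have := ((hasDerivAt_const t (x - y)).inner ℝ h1).ofReal_comp
      simpa using this
    have h3 := (h2.const_mul (Complex.I / ħ)).cexp
    have h4 : HasDerivAt (fun t : ℝ => phasePoint ((1 / 2 : ℝ) • (x + y)) (ξ + t • w))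
        (momIncl d w) t := by
      simp only [phasePoint_eq]
      exact ((momIncl d).hasFDerivAt.comp_hasDerivAt t h1).const_add _
    have h5 := ((ha.1.differentiable (by simp) _).hasFDerivAt.comp_hasDerivAt t h4).smul_const (ψ y)
    convert! h3.mul h5 using 1
    simp only [hF', he, amplitude, hψ', Complex.real_smul, inner_sub_left, real_inner_comm x w,
      real_inner_comm y w, Function.comp]
    push_cast
    ring
  have hen : ∀ t y, ‖e t y‖ = 1 := fun t y => norm_exp_I_div_mul _ _
  have hmain := hasDerivAt_integral_of_dominated_loc_of_deriv_le (μ := (volume : Measure (Conf d)))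
    (F := fun t y => e t y * amplitude a ψ x (ξ + t • w) y) (F' := F') (x₀ := (0 : ℝ))
    (s := Metric.ball 0 1)
    (bound := fun y => (1 / ħ * (|inner ℝ w x| * A + B) + D) * X * ((1 + ‖y‖) ^ (d + 1))⁻¹)
    (Metric.ball_mem_nhds 0 one_pos)
    (Filter.Eventually.of_forall fun t =>
      (ha.integrable_integrand ħ ψ x (ξ + t • w)).aestronglyMeasurable)
    (ha.integrable_integrand ħ ψ x _)
    (((((ha.integrable_integrand ħ ψ x _).const_mul _).sub
      (ha.integrable_integrand ħ ψ' x _)).const_mul _).add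
      (hda.integrable_integrand ħ ψ x _)).aestronglyMeasurable
    (ae_of_all _ fun y t ht => by
      have hX : ((1 + ‖x‖) * (1 + ‖ξ + t • w‖)) ^ M ≤ X := by
        have hle : ‖ξ + t • w‖ ≤ ‖ξ‖ + ‖w‖ := by
          refine (norm_add_le _ _).trans ?_
          rw [norm_smul]
          have : ‖t‖ ≤ 1 := by simpa using (mem_ball_zero_iff.1 ht).le
          nlinarith [norm_nonneg w]
        simp only [X]
        gcongr
      have hY : 0 ≤ ((1 + ‖y‖) ^ (d + 1))⁻¹ := by positivity
      have b1 : ‖amplitude a ψ x (ξ + t • w) y‖ ≤ A * X * ((1 + ‖y‖) ^ (d + 1))⁻¹ :=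
        (hA x (ξ + t • w) y).trans (by gcongr)
      have b2 : ‖amplitude a ψ' x (ξ + t • w) y‖ ≤ B * X * ((1 + ‖y‖) ^ (d + 1))⁻¹ :=
        (hB x (ξ + t • w) y).trans (by gcongr)
      have b3 : ‖amplitude (fun z => fderiv ℝ a z (momIncl d w)) ψ x (ξ + t • w) y‖ ≤
          D * X * ((1 + ‖y‖) ^ (d + 1))⁻¹ := (hD x (ξ + t • w) y).trans (by gcongr)
      have hI : ‖Complex.I / ħ‖ = 1 / ħ := by
        rw [norm_div, Complex.norm_I, Complex.norm_real, Real.norm_of_nonneg hħ.le]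
      calc ‖F' t y‖ ≤ ‖Complex.I / ħ‖ * (‖((inner ℝ w x : ℝ) : ℂ)‖ *
              (‖e t y‖ * ‖amplitude a ψ x (ξ + t • w) y‖)
              + ‖e t y‖ * ‖amplitude a ψ' x (ξ + t • w) y‖) +
            ‖e t y‖ * ‖amplitude (fun z => fderiv ℝ a z (momIncl d w)) ψ x (ξ + t • w) y‖ := by
            refine (norm_add_le _ _).trans ?_
            rw [norm_mul, norm_mul (e t y)]
            gcongr
            refine (norm_sub_le _ _).trans ?_
            rw [norm_mul, norm_mul, norm_mul]
        _ ≤ 1 / ħ * (|inner ℝ w x| * (A * X * ((1 + ‖y‖) ^ (d + 1))⁻¹)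
              + B * X * ((1 + ‖y‖) ^ (d + 1))⁻¹) + D * X * ((1 + ‖y‖) ^ (d + 1))⁻¹ := by
            rw [hen, hI, Complex.norm_real, Real.norm_eq_abs, one_mul, one_mul, one_mul]
            gcongr
        _ = _ := by ring)
    ((integrable_inv_one_add_norm_pow finrank_conf_lt).const_mul _)
    (ae_of_all _ fun y t _ => hdiff y t)
  unfold HasLineDerivAt
  simp only [weylInner_eq_amplitude]
  convert! hmain.2 using 1
  simp only [hF', he, zero_smul, add_zero]
  rw [integral_add, integral_const_mul, integral_sub, integral_const_mul]
  · exact (ha.integrable_integrand ħ ψ x _).const_mul _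
  · exact (ha.integrable_integrand ħ ψ' x _)
  · exact (((ha.integrable_integrand ħ ψ x _).const_mul _).sub
      (ha.integrable_integrand ħ ψ' x _)).const_mul _
  · exact hda.integrable_integrand ħ ψ x _

lemma integral_eq_zero_of_hasLineDerivAt {V : Type*} [NormedAddCommGroup V] [NormedSpace ℝ V]
    [FiniteDimensional ℝ V] [MeasurableSpace V] [BorelSpace V] {μ : Measure V}
    [μ.IsAddHaarMeasure] {g g' : V → ℂ} {v : V} (hg : Integrable g μ)
    (hg' : Integrable g' μ) (h : ∀ x, HasLineDerivAt ℝ g (g' x) x v) : ∫ x, g' x ∂μ = 0 := by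
  have := integral_bilinear_hasLineDerivAt_right_eq_neg_left_of_integrable (μ := μ)
    (B := ContinuousLinearMap.mul ℝ ℂ) (f := fun _ => (1 : ℂ)) (f' := fun _ => 0) (v := v)
    (g := g) (g' := g') (by simp) (by simpa using hg') (by simpa using hg)
    (fun x _ => by simpa [HasLineDerivAt] using hasDerivAt_const (0 : ℝ) (1 : ℂ)) (fun x _ => h x)
  simpa using this

/-- The commutator of `Op(a)` with a linear function of the position is `iħ Op(∂_ξ a)`. -/
lemma inner_mul_weylQuantization (ha : IsPolySymbol M a) {ħ : ℝ} (hħ : 0 < ħ) (w : Conf d)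
    {ψ ψ' : 𝓢(Conf d, ℂ)} (hψ' : ∀ y, ψ' y = (inner ℝ w y : ℝ) * ψ y) (x : Conf d) :
    (inner ℝ w x : ℝ) * weylQuantization ħ a ψ x = weylQuantization ħ a ψ' x +
      Complex.I * ħ * weylQuantization ħ (fun z => fderiv ℝ a z (momIncl d w)) ψ x := by
  have hda := ha.fderiv_apply (momIncl d w)
  have i1 := ha.integrable_weylInner hħ ψ x
  have i2 := ha.integrable_weylInner hħ ψ' x
  have i3 := hda.integrable_weylInner hħ ψ x
  have i4 : Integrable fun ξ => Complex.I / ħ * ((inner ℝ w x : ℝ) * weylInner ħ a ψ x ξ -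
      weylInner ħ a ψ' x ξ) := ((i1.const_mul _).sub i2).const_mul _
  have h := integral_eq_zero_of_hasLineDerivAt i1 (i4.add i3)
    (fun ξ => hasLineDerivAt_weylInner ha hħ w hψ' x ξ)
  simp only [Pi.add_apply] at h
  rw [integral_add i4 i3, integral_const_mul,
    integral_sub (i1.const_mul _) i2, integral_const_mul] at h
  have hh : (ħ : ℂ) ≠ 0 := by exact_mod_cast hħ.ne'
  simp only [weylQuantization_eq]
  set c : ℂ := ((((2 * Real.pi * ħ) ^ d)⁻¹ : ℝ) : ℂ)
  field_simp at h
  linear_combination (-Complex.I * c) * h +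
    c * ((inner ℝ w x : ℝ) * (∫ ξ, weylInner ħ a ψ x ξ) - ∫ ξ, weylInner ħ a ψ' x ξ) *
      Complex.I_sq

lemma IsPolySymbol.abs_inner_pow_mul_le (w : Conf d) {ħ : ℝ} (hħ : 0 < ħ) (k : ℕ) :
    ∀ {a : Phase d → ℝ} (_ : IsPolySymbol M a) (ψ : 𝓢(Conf d, ℂ)),
      ∃ C, 0 ≤ C ∧ ∀ x, |inner ℝ w x| ^ k * ‖weylQuantization ħ a ψ x‖ ≤ C * (1 + ‖x‖) ^ M := by
  induction k with
  | zero => intro a ha ψ; simpa using ha.weylQuantization_le hħ ψ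
  | succ k ih =>
    intro a ha ψ
    obtain ⟨ψ', hψ'⟩ := exists_schwartz_inner_mul w ψ
    obtain ⟨A, hA0, hA⟩ := ih ha ψ'
    obtain ⟨B, hB0, hB⟩ := ih (ha.fderiv_apply (momIncl d w)) ψ
    refine ⟨A + ħ * B, by positivity, fun x => ?_⟩
    have h1 : |inner ℝ w x| * ‖weylQuantization ħ a ψ x‖ ≤ ‖weylQuantization ħ a ψ' x‖ +
        ħ * ‖weylQuantization ħ (fun z => fderiv ℝ a z (momIncl d w)) ψ x‖ := by
      have h := congrArg norm (inner_mul_weylQuantization ha hħ w hψ' x)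
      rw [norm_mul, Complex.norm_real, Real.norm_eq_abs] at h
      rw [h]
      refine (norm_add_le _ _).trans ?_
      rw [norm_mul, norm_mul, Complex.norm_I, Complex.norm_real, Real.norm_of_nonneg hħ.le, one_mul]
    calc _ = |inner ℝ w x| ^ k * (|inner ℝ w x| * ‖weylQuantization ħ a ψ x‖) := by ring
      _ ≤ |inner ℝ w x| ^ k * (‖weylQuantization ħ a ψ' x‖ +
        ħ * ‖weylQuantization ħ (fun z => fderiv ℝ a z (momIncl d w)) ψ x‖) := by gcongr
      _ = |inner ℝ w x| ^ k * ‖weylQuantization ħ a ψ' x‖ + ħ * (|inner ℝ w x| ^ k *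
        ‖weylQuantization ħ (fun z => fderiv ℝ a z (momIncl d w)) ψ x‖) := by ring
      _ ≤ A * (1 + ‖x‖) ^ M + ħ * (B * (1 + ‖x‖) ^ M) :=
        add_le_add (hA x) (mul_le_mul_of_nonneg_left (hB x) hħ.le)
      _ = _ := by ring

lemma norm_pow_le_sum (k : ℕ) (x : Conf d) :
    ‖x‖ ^ (k + 1) ≤ (d : ℝ) ^ k * ∑ j, |x j| ^ (k + 1) := by
  have h1 : ‖x‖ ≤ ∑ j, |x j| := by
    conv_lhs => rw [← (EuclideanSpace.basisFun (Fin d) ℝ).sum_repr x]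
    refine (norm_sum_le _ _).trans (Finset.sum_le_sum fun j _ => ?_)
    rw [norm_smul]; simp
  calc ‖x‖ ^ (k + 1) ≤ (∑ j, |x j|) ^ (k + 1) := by gcongr
    _ ≤ _ := by
      simpa using pow_sum_le_card_mul_sum_pow (s := Finset.univ) (f := fun j => |x j|)
        (fun j _ => abs_nonneg _) k

/-- `Op(a)ψ` decays faster than any polynomial. -/
lemma IsPolySymbol.weylQuantization_decay (ha : IsPolySymbol M a) {ħ : ℝ} (hħ : 0 < ħ)
    (ψ : 𝓢(Conf d, ℂ)) (K : ℕ) :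
    ∃ C, 0 ≤ C ∧ ∀ x, (1 + ‖x‖) ^ K * ‖weylQuantization ħ a ψ x‖ ≤ C := by
  obtain ⟨A, hA0, hA⟩ := ha.weylQuantization_le hħ ψ
  choose B hB0 hB using fun j : Fin d =>
    ha.abs_inner_pow_mul_le (EuclideanSpace.single j (1 : ℝ)) hħ (K + M + 1) ψ
  set S : ℝ := A + (d : ℝ) ^ (K + M) * ∑ j, B j
  have hS : 0 ≤ S := add_nonneg hA0 (mul_nonneg (by positivity) (Finset.sum_nonneg fun j _ => hB0 j))
  refine ⟨2 ^ (K + M + 1) * S, by positivity, fun x => ?_⟩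
  have h1 : ‖x‖ ^ (K + M + 1) * ‖weylQuantization ħ a ψ x‖ ≤
      (d : ℝ) ^ (K + M) * (∑ j, B j) * (1 + ‖x‖) ^ M := by
    calc _ ≤ ((d : ℝ) ^ (K + M) * ∑ j, |x j| ^ (K + M + 1)) * ‖weylQuantization ħ a ψ x‖ := by
          gcongr; exact norm_pow_le_sum _ x
      _ = (d : ℝ) ^ (K + M) * ∑ j, (|x j| ^ (K + M + 1) * ‖weylQuantization ħ a ψ x‖) := by
          rw [mul_assoc, Finset.sum_mul]
      _ ≤ (d : ℝ) ^ (K + M) * ∑ j, (B j * (1 + ‖x‖) ^ M) := by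
          refine mul_le_mul_of_nonneg_left (Finset.sum_le_sum fun j _ => ?_) (by positivity)
          simpa [EuclideanSpace.inner_single_left] using hB j x
      _ = _ := by rw [← Finset.sum_mul]; ring
  have h4 : (1 + ‖x‖) ^ (K + M + 1) ≤ 2 ^ (K + M + 1) * (1 + ‖x‖ ^ (K + M + 1)) := by
    have := add_pow_le (zero_le_one) (norm_nonneg x) (K + M + 1)
    rw [one_pow] at this
    refine this.trans ?_
    gcongr
    · norm_num
    · omega
  have hpos : 0 < (1 + ‖x‖) ^ M := by positivity
  have h6 : (1 + ‖x‖) ^ (K + M) ≤ (1 + ‖x‖) ^ (K + M + 1) :=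
    pow_le_pow_right₀ (by linarith [norm_nonneg x]) (by omega)
  refine le_of_mul_le_mul_right ?_ hpos
  calc (1 + ‖x‖) ^ K * ‖weylQuantization ħ a ψ x‖ * (1 + ‖x‖) ^ M
      = (1 + ‖x‖) ^ (K + M) * ‖weylQuantization ħ a ψ x‖ := by rw [pow_add]; ring
    _ ≤ (1 + ‖x‖) ^ (K + M + 1) * ‖weylQuantization ħ a ψ x‖ := by gcongr
    _ ≤ 2 ^ (K + M + 1) * (1 + ‖x‖ ^ (K + M + 1)) * ‖weylQuantization ħ a ψ x‖ := by gcongr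
    _ = 2 ^ (K + M + 1) * (‖weylQuantization ħ a ψ x‖ +
          ‖x‖ ^ (K + M + 1) * ‖weylQuantization ħ a ψ x‖) := by ring
    _ ≤ 2 ^ (K + M + 1) * (A * (1 + ‖x‖) ^ M +
          (d : ℝ) ^ (K + M) * (∑ j, B j) * (1 + ‖x‖) ^ M) := by
        gcongr
        exact hA x
    _ = _ := by ring

lemma stronglyMeasurable_weylQuantization (ħ : ℝ) (ha : Continuous a) {ψ : Conf d → ℂ}
    (hψ : Continuous ψ) : StronglyMeasurable (weylQuantization ħ a ψ) := by
  have := (stronglyMeasurable_weylInner ħ ha hψ).integral_prod_right (ν := (volume : Measure (Conf d)))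
    (f := fun x ξ => weylInner ħ a ψ x ξ)
  exact this.const_mul _

lemma memLp_two_of_decay {f : Conf d → ℂ} (hf : AEStronglyMeasurable f) {C : ℝ}
    (h : ∀ x, (1 + ‖x‖) ^ (d + 1) * ‖f x‖ ≤ C) : MemLp f 2 := by
  rw [memLp_two_iff_integrable_sq_norm hf]
  refine integrable_of_decay (K := d + 1) (C := C ^ 2) finrank_conf_lt (hf.norm.pow 2) fun x => ?_
  have h1 : (1 : ℝ) ≤ (1 + ‖x‖) ^ (d + 1) := one_le_pow₀ (by linarith [norm_nonneg x])
  have h2 := h x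
  rw [norm_pow, norm_norm]
  calc (1 + ‖x‖) ^ (d + 1) * ‖f x‖ ^ 2
      ≤ (1 + ‖x‖) ^ (d + 1) * ((1 + ‖x‖) ^ (d + 1) * ‖f x‖ ^ 2) :=
        le_mul_of_one_le_left (by positivity) h1
    _ = ((1 + ‖x‖) ^ (d + 1) * ‖f x‖) ^ 2 := by ring
    _ ≤ C ^ 2 := by gcongr

lemma IsPolySymbol.memLp_weylQuantization (ha : IsPolySymbol M a) {ħ : ℝ} (hħ : 0 < ħ)
    (ψ : 𝓢(Conf d, ℂ)) : MemLp (weylQuantization ħ a ψ) 2 := by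
  obtain ⟨C, -, hC⟩ := ha.weylQuantization_decay hħ ψ (d + 1)
  exact memLp_two_of_decay
    (stronglyMeasurable_weylQuantization ħ ha.1.continuous ψ.continuous).aestronglyMeasurable hC

end

section

variable {M : ℕ} {a : Phase d → ℝ}

/-! ### Fourier inversion and the Wigner function -/

/-- Fourier inversion: `Op(1)` is the identity. -/
lemma weylQuantization_one {ħ : ℝ} (hħ : 0 < ħ) (ψ : 𝓢(Conf d, ℂ)) (x : Conf d) :
    weylQuantization ħ (fun _ => 1) ψ x = ψ x := by
  have hk : (0 : ℝ) < 2 * Real.pi * ħ := by positivity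
  set G : Conf d → ℂ := fun η =>
    Complex.exp (((2 * Real.pi * inner ℝ η x : ℝ) : ℂ) * Complex.I) • 𝓕 (ψ : Conf d → ℂ) η with hG
  have h1 : ∀ ξ, weylInner ħ (fun _ => 1) ψ x ξ = G ((2 * Real.pi * ħ)⁻¹ • ξ) := by
    intro ξ
    simp only [hG]
    rw [weylInner_eq_fourier hħ]
    have : amplitude (fun _ => 1) ψ x ξ = ψ := by funext y; simp [amplitude]
    rw [this, smul_eq_mul, inner_smul_left, real_inner_comm]
    congr 2
    have hp : (Real.pi : ℂ) ≠ 0 := by exact_mod_cast Real.pi_ne_zero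
    have hh : (ħ : ℂ) ≠ 0 := by exact_mod_cast hħ.ne'
    simp
    field_simp
  rw [weylQuantization_eq]
  simp_rw [h1]
  rw [Measure.integral_comp_smul]
  have h2 := congrFun (ψ.continuous.fourierInv_fourier_eq ψ.integrable
    (by rw [← SchwartzMap.fourier_coe]; exact (𝓕 ψ).integrable)) x
  rw [Real.fourierInv_eq'] at h2
  rw [h2]
  simp only [finrank_euclideanSpace, Fintype.card_fin, inv_pow, inv_inv]
  rw [abs_of_pos (by positivity), Complex.real_smul, ← mul_assoc, ← Complex.ofReal_mul,
    inv_mul_cancel₀ (by positivity)]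
  simp

/-- The (unnormalized) Wigner function of `ψ`. -/
def wigner (ħ : ℝ) (ψ : Conf d → ℂ) (u ξ : Conf d) : ℂ :=
  ∫ v : Conf d, Complex.exp (Complex.I / ħ * (inner ℝ v ξ : ℝ)) *
    (starRingEnd ℂ (ψ (u + (1 / 2 : ℝ) • v)) * ψ (u - (1 / 2 : ℝ) • v))

/-- The change of variables `(u, v) ↦ (u + v/2, u - v/2)` preserves the volume. -/
lemma measurePreserving_midpoint :
    MeasurePreserving (fun p : Conf d × Conf d => (p.1 + (1 / 2 : ℝ) • p.2, p.1 - (1 / 2 : ℝ) • p.2))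
      (volume.prod volume) (volume.prod volume) := by
  have h1 : MeasurePreserving (fun p : Conf d × Conf d => (p.1, p.1 - p.2))
      (volume.prod volume) (volume.prod volume) :=
    (MeasurePreserving.id volume).skew_product (g := fun x v => x - v)
      (by fun_prop) (ae_of_all _ fun x => (Measure.measurePreserving_sub_left volume x).map_eq)
  have h2 : MeasurePreserving (fun p : Conf d × Conf d => (p.1, p.2 + (1 / 2 : ℝ) • p.1))
      (volume.prod volume) (volume.prod volume) :=
    (MeasurePreserving.id volume).skew_product (g := fun v u => u + (1 / 2 : ℝ) • v)
      (by fun_prop) (ae_of_all _ fun v => (measurePreserving_add_right volume _).map_eq)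
  have h3 := h1.comp (Measure.measurePreserving_swap.comp
    (h2.comp Measure.measurePreserving_swap))
  convert! h3 using 1
  funext p
  simp only [Function.comp, Prod.swap, Prod.mk.injEq, true_and]
  module

lemma integral_conj_mul_weylInner (ha : IsPolySymbol M a) (ħ : ℝ)
    (ψ : 𝓢(Conf d, ℂ)) (ξ : Conf d) :
    ∫ x, starRingEnd ℂ (ψ x) * weylInner ħ a ψ x ξ =
      ∫ u, (a (phasePoint u ξ) : ℂ) * wigner ħ ψ u ξ := by
  set Φ : Conf d × Conf d → ℂ := fun p => starRingEnd ℂ (ψ p.1) *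
    (Complex.exp (Complex.I / ħ * (inner ℝ (p.1 - p.2) ξ : ℝ)) * amplitude a ψ p.1 ξ p.2) with hΦ
  have hcont : Continuous Φ := by
    refine (Complex.continuous_conj.comp (ψ.continuous.comp continuous_fst)).mul
      ((Complex.continuous_exp.comp (continuous_const.mul (Complex.continuous_ofReal.comp
      (by fun_prop)))).mul ((ha.1.continuous.comp ?_).smul (ψ.continuous.comp continuous_snd)))
    exact continuous_phasePoint.comp (f := fun p : Conf d × Conf d =>
      ((1 / 2 : ℝ) • (p.1 + p.2), ξ)) (by fun_prop)
  obtain ⟨C, hC0, hC⟩ := ha.amplitude_le ψ (d + 1)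
  obtain ⟨B, hB0, hB⟩ := SchwartzMap.one_add_norm_pow_mul_le ψ (d + 1 + M) 0
  have hint : Integrable Φ (volume.prod volume) := by
    have := ((integrable_inv_one_add_norm_pow (V := Conf d) (μ := volume)
      finrank_conf_lt).const_mul (B * C * (1 + ‖ξ‖) ^ M)).mul_prod
      (integrable_inv_one_add_norm_pow (V := Conf d) (μ := volume) finrank_conf_lt)
    refine this.mono' hcont.aestronglyMeasurable (ae_of_all _ fun p => ?_)
    have h1 := hC p.1 ξ p.2
    have h2 := hB p.1
    rw [norm_iteratedFDeriv_zero, pow_add] at h2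
    rw [hΦ, norm_mul, norm_mul, norm_exp_I_div_mul, one_mul, RCLike.norm_conj]
    have h3 : ‖ψ p.1‖ * (1 + ‖p.1‖) ^ M ≤ B * ((1 + ‖p.1‖) ^ (d + 1))⁻¹ := by
      rw [← div_eq_mul_inv, le_div_iff₀ (by positivity)]
      linarith
    calc _ ≤ ‖ψ p.1‖ * (C * ((1 + ‖p.1‖) * (1 + ‖ξ‖)) ^ M * ((1 + ‖p.2‖) ^ (d + 1))⁻¹) := by gcongr
      _ = (C * (1 + ‖ξ‖) ^ M * ((1 + ‖p.2‖) ^ (d + 1))⁻¹) * (‖ψ p.1‖ * (1 + ‖p.1‖) ^ M) := by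
          rw [mul_pow]; ring
      _ ≤ (C * (1 + ‖ξ‖) ^ M * ((1 + ‖p.2‖) ^ (d + 1))⁻¹) * (B * ((1 + ‖p.1‖) ^ (d + 1))⁻¹) := by
          gcongr
      _ = _ := by ring
  have hT := measurePreserving_midpoint (d := d)
  have hintT : Integrable (fun p : Conf d × Conf d =>
      Φ (p.1 + (1 / 2 : ℝ) • p.2, p.1 - (1 / 2 : ℝ) • p.2)) (volume.prod volume) :=
    hT.integrable_comp_of_integrable hint
  calc ∫ x, starRingEnd ℂ (ψ x) * weylInner ħ a ψ x ξ = ∫ x, ∫ y, Φ (x, y) := by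
        congr 1; funext x
        rw [weylInner_eq_amplitude, ← integral_const_mul]
    _ = ∫ p, Φ p ∂(volume.prod volume) := (integral_prod _ hint).symm
    _ = ∫ p, Φ p ∂(Measure.map (fun p : Conf d × Conf d =>
          (p.1 + (1 / 2 : ℝ) • p.2, p.1 - (1 / 2 : ℝ) • p.2)) (volume.prod volume)) := by
        rw [hT.map_eq]
    _ = ∫ p : Conf d × Conf d, Φ (p.1 + (1 / 2 : ℝ) • p.2, p.1 - (1 / 2 : ℝ) • p.2)
          ∂(volume.prod volume) :=
        integral_map hT.measurable.aemeasurable hcont.aestronglyMeasurable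
    _ = ∫ u, ∫ v, Φ (u + (1 / 2 : ℝ) • v, u - (1 / 2 : ℝ) • v) := integral_prod _ hintT
    _ = _ := by
        congr 1; funext u
        rw [wigner, ← integral_const_mul]
        congr 1; funext v
        have e1 : (1 / 2 : ℝ) • (u + (1 / 2 : ℝ) • v + (u - (1 / 2 : ℝ) • v)) = u := by module
        have e2 : u + (1 / 2 : ℝ) • v - (u - (1 / 2 : ℝ) • v) = v := by module
        simp only [hΦ, amplitude, e1, e2, Complex.real_smul]
        ring

/-- The expectation of `Op(a)` in the state `ψ` as a phase space average of `a` against the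
Wigner function of `ψ`. -/
lemma integral_conj_mul_weylQuantization (ha : IsPolySymbol M a) {ħ : ℝ} (hħ : 0 < ħ)
    (ψ : 𝓢(Conf d, ℂ)) :
    ∫ x, starRingEnd ℂ (ψ x) * weylQuantization ħ a ψ x = (((2 * Real.pi * ħ) ^ d)⁻¹ : ℝ) *
      ∫ ξ, ∫ u, (a (phasePoint u ξ) : ℂ) * wigner ħ ψ u ξ := by
  obtain ⟨C, hC0, hC⟩ := ha.weylInner_decay hħ ψ (d + 1)
  obtain ⟨B, hB0, hB⟩ := SchwartzMap.one_add_norm_pow_mul_le ψ (d + 1 + M) 0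
  have hint : Integrable (fun p : Conf d × Conf d => starRingEnd ℂ (ψ p.1) *
      weylInner ħ a ψ p.1 p.2) (volume.prod volume) := by
    have := ((integrable_inv_one_add_norm_pow (V := Conf d) (μ := volume)
      finrank_conf_lt).const_mul (B * C)).mul_prod
      (integrable_inv_one_add_norm_pow (V := Conf d) (μ := volume) finrank_conf_lt)
    refine this.mono' ?_ (ae_of_all _ fun p => ?_)
    · exact ((Complex.continuous_conj.comp (ψ.continuous.comp
        continuous_fst)).aestronglyMeasurable).mul
        (stronglyMeasurable_weylInner ħ ha.1.continuous ψ.continuous).aestronglyMeasurable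
    have h1 := hC p.1 p.2
    have h2 := hB p.1
    rw [norm_iteratedFDeriv_zero, pow_add] at h2
    rw [norm_mul, RCLike.norm_conj]
    have h3 : ‖ψ p.1‖ * (1 + ‖p.1‖) ^ M ≤ B * ((1 + ‖p.1‖) ^ (d + 1))⁻¹ := by
      rw [← div_eq_mul_inv, le_div_iff₀ (by positivity)]
      linarith
    have h4 : ‖weylInner ħ a ψ p.1 p.2‖ ≤ C * (1 + ‖p.1‖) ^ M * ((1 + ‖p.2‖) ^ (d + 1))⁻¹ := by
      rw [← div_eq_mul_inv, le_div_iff₀ (by positivity)]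
      linarith
    calc _ ≤ ‖ψ p.1‖ * (C * (1 + ‖p.1‖) ^ M * ((1 + ‖p.2‖) ^ (d + 1))⁻¹) := by gcongr
      _ = (C * ((1 + ‖p.2‖) ^ (d + 1))⁻¹) * (‖ψ p.1‖ * (1 + ‖p.1‖) ^ M) := by ring
      _ ≤ (C * ((1 + ‖p.2‖) ^ (d + 1))⁻¹) * (B * ((1 + ‖p.1‖) ^ (d + 1))⁻¹) := by gcongr
      _ = _ := by ring
  simp only [weylQuantization_eq]
  simp_rw [mul_left_comm (starRingEnd ℂ _)]
  rw [integral_const_mul]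
  congr 1
  simp_rw [← integral_const_mul]
  rw [integral_integral_swap hint]
  simp_rw [integral_conj_mul_weylInner ha]

end

section

variable {M : ℕ} {a : Phase d → ℝ}

/-! ### Quantization of quadratic polynomials -/

/-- The coordinate `ζ_i - z_i` of phase space centred at `z`. -/
def coordFun (z : Phase d) (i : Fin d ⊕ Fin d) (ζ : Phase d) : ℝ := ζ i - z i

/-- The quantization of `coordFun z i`: multiplication by `x_j - q_j` for a position coordinate,
`-iħ∂_j - p_j` for a momentum coordinate. -/
def coordOp (ħ : ℝ) (z : Phase d) (i : Fin d ⊕ Fin d) (ψ : 𝓢(Conf d, ℂ)) : 𝓢(Conf d, ℂ) :=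
  Sum.elim
    (fun j => SchwartzMap.smulLeftCLM ℂ (fun y : Conf d => inner ℝ (EuclideanSpace.single j 1) y) ψ
      - ((z (Sum.inl j) : ℝ) : ℂ) • ψ)
    (fun j => (-(Complex.I * ħ)) • ∂_{(EuclideanSpace.single j (1 : ℝ) : Conf d)} ψ
      - ((z (Sum.inr j) : ℝ) : ℂ) • ψ) i

lemma coordOp_inl (ħ : ℝ) (z : Phase d) (j : Fin d) (ψ : 𝓢(Conf d, ℂ)) (y : Conf d) :
    coordOp ħ z (Sum.inl j) ψ y = ((y j - z (Sum.inl j) : ℝ) : ℂ) * ψ y := by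
  simp only [coordOp, Sum.elim_inl, sub_apply, smul_apply]
  rw [SchwartzMap.smulLeftCLM_apply_apply (Function.hasTemperateGrowth_inner_right _)]
  simp [EuclideanSpace.inner_single_left]
  ring

lemma coordOp_inr (ħ : ℝ) (z : Phase d) (j : Fin d) (ψ : 𝓢(Conf d, ℂ)) (y : Conf d) :
    coordOp ħ z (Sum.inr j) ψ y =
      -(Complex.I * ħ) * fderiv ℝ ψ y (EuclideanSpace.single j 1) - z (Sum.inr j) * ψ y := by
  simp only [coordOp, Sum.elim_inr, sub_apply, smul_apply, smul_eq_mul,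
    SchwartzMap.lineDerivOp_apply_eq_fderiv]

lemma isPolySymbol_coordFun (z : Phase d) (i : Fin d ⊕ Fin d) :
    IsPolySymbol 1 (coordFun z i) := by
  have h1 := isPolySymbol_clm (EuclideanSpace.proj i : Phase d →L[ℝ] ℝ)
  have h2 := (isPolySymbol_const (d := d) (-(z i))).mono (Nat.zero_le 1)
  have := h1.add h2
  simpa [coordFun, sub_eq_add_neg] using! this

lemma weylQuantization_coordFun_inl_mul (ha : IsPolySymbol M a) {ħ : ℝ} (hħ : 0 < ħ)
    (z : Phase d) (j : Fin d) (ψ : 𝓢(Conf d, ℂ)) (x : Conf d) :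
    weylQuantization ħ (fun ζ => coordFun z (Sum.inl j) ζ * a ζ) ψ x =
      1 / 2 * (((x j - z (Sum.inl j) : ℝ) : ℂ) * weylQuantization ħ a ψ x +
        weylQuantization ħ a (coordOp ħ z (Sum.inl j) ψ) x) := by
  obtain ⟨ψ', hψ'⟩ := exists_schwartz_inner_mul (EuclideanSpace.single j (1 : ℝ)) ψ
  have h1 := weylQuantization_pos_mul ha hħ (EuclideanSpace.single j (1 : ℝ)) hψ' x
  have hcs : IsPolySymbol (1 + M) (fun ζ : Phase d =>
      inner ℝ (EuclideanSpace.single j (1 : ℝ)) (pos ζ) * a ζ) := by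
    have := (isPolySymbol_clm (EuclideanSpace.proj (Sum.inl j) : Phase d →L[ℝ] ℝ)).mul ha
    simpa [EuclideanSpace.inner_single_left, pos] using! this
  have hsum : (fun ζ => coordFun z (Sum.inl j) ζ * a ζ) = fun ζ =>
      inner ℝ (EuclideanSpace.single j (1 : ℝ)) (pos ζ) * a ζ + (-(z (Sum.inl j))) * a ζ := by
    funext ζ
    simp [coordFun, EuclideanSpace.inner_single_left, pos]; ring
  have hlin : weylQuantization ħ a (coordOp ħ z (Sum.inl j) ψ) x =
      weylQuantization ħ a ψ' x - z (Sum.inl j) * weylQuantization ħ a ψ x := by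
    have e : ∀ ξ, weylInner ħ a (coordOp ħ z (Sum.inl j) ψ) x ξ =
        weylInner ħ a ψ' x ξ - z (Sum.inl j) * weylInner ħ a ψ x ξ := by
      intro ξ
      simp only [weylInner_eq_amplitude]
      rw [← integral_const_mul, ← integral_sub (ha.integrable_integrand ħ ψ' x ξ)
        ((ha.integrable_integrand ħ ψ x ξ).const_mul _)]
      congr 1; funext y
      simp only [amplitude, coordOp_inl, hψ', EuclideanSpace.inner_single_left, Complex.real_smul]
      simp
      ring
    simp only [weylQuantization_eq, e]
    rw [integral_sub (ha.integrable_weylInner hħ ψ' x)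
      ((ha.integrable_weylInner hħ ψ x).const_mul _), integral_const_mul]
    ring
  rw [hsum, weylQuantization_add hcs (ha.const_mul _) hħ, weylQuantization_const_mul, h1, hlin]
  simp [EuclideanSpace.inner_single_left]
  ring

lemma weylQuantization_coordFun_inr_mul (ha : IsPolySymbol M a) {ħ : ℝ} (hħ : 0 < ħ)
    (z : Phase d) (j : Fin d) (ψ : 𝓢(Conf d, ℂ)) (x : Conf d) :
    weylQuantization ħ (fun ζ => coordFun z (Sum.inr j) ζ * a ζ) ψ x =
      weylQuantization ħ a (coordOp ħ z (Sum.inr j) ψ) x - Complex.I * ħ / 2 *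
        weylQuantization ħ (fun ζ => fderiv ℝ a ζ (posIncl d (EuclideanSpace.single j 1))) ψ x := by
  set w : Conf d := EuclideanSpace.single j (1 : ℝ) with hw
  set ψ' : 𝓢(Conf d, ℂ) := (-(Complex.I * ħ)) • ∂_{w} ψ with hψ'
  have hψ'' : ∀ y, ψ' y = -(Complex.I * ħ) * fderiv ℝ ψ y w := fun y => by
    simp [hψ', SchwartzMap.lineDerivOp_apply_eq_fderiv]
  have h1 := weylQuantization_mom_mul ha hħ w hψ'' x
  have hcs : IsPolySymbol (1 + M) (fun ζ : Phase d => inner ℝ w (mom ζ) * a ζ) := by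
    have := (isPolySymbol_clm (EuclideanSpace.proj (Sum.inr j) : Phase d →L[ℝ] ℝ)).mul ha
    simpa [hw, EuclideanSpace.inner_single_left, mom] using! this
  have hsum : (fun ζ => coordFun z (Sum.inr j) ζ * a ζ) = fun ζ =>
      inner ℝ w (mom ζ) * a ζ + (-(z (Sum.inr j))) * a ζ := by
    funext ζ
    simp [coordFun, hw, EuclideanSpace.inner_single_left, mom]; ring
  have hlin : weylQuantization ħ a (coordOp ħ z (Sum.inr j) ψ) x =
      weylQuantization ħ a ψ' x - z (Sum.inr j) * weylQuantization ħ a ψ x := by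
    have e : ∀ ξ, weylInner ħ a (coordOp ħ z (Sum.inr j) ψ) x ξ =
        weylInner ħ a ψ' x ξ - z (Sum.inr j) * weylInner ħ a ψ x ξ := by
      intro ξ
      simp only [weylInner_eq_amplitude]
      rw [← integral_const_mul, ← integral_sub (ha.integrable_integrand ħ ψ' x ξ)
        ((ha.integrable_integrand ħ ψ x ξ).const_mul _)]
      congr 1; funext y
      simp only [amplitude, coordOp_inr, hψ'', Complex.real_smul]
      ring
    simp only [weylQuantization_eq, e]
    rw [integral_sub (ha.integrable_weylInner hħ ψ' x)
      ((ha.integrable_weylInner hħ ψ x).const_mul _), integral_const_mul]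
    ring
  rw [hsum, weylQuantization_add hcs (ha.const_mul _) hħ, weylQuantization_const_mul, h1, hlin]
  push_cast
  ring

lemma weylQuantization_const {ħ : ℝ} (hħ : 0 < ħ) (c : ℝ) (ψ : 𝓢(Conf d, ℂ)) (x : Conf d) :
    weylQuantization ħ (fun _ => c) ψ x = c * ψ x := by
  have := weylQuantization_const_mul ħ c (fun _ : Phase d => 1) ψ x
  rwa [weylQuantization_one hħ, show (fun _ : Phase d => c * 1) = fun _ => c by simp] at this

lemma weylQuantization_coordFun {ħ : ℝ} (hħ : 0 < ħ) (z : Phase d) (i : Fin d ⊕ Fin d)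
    (ψ : 𝓢(Conf d, ℂ)) (x : Conf d) :
    weylQuantization ħ (coordFun z i) ψ x = coordOp ħ z i ψ x := by
  rcases i with j | j
  · have := weylQuantization_coordFun_inl_mul (isPolySymbol_const 1) hħ z j ψ x
    simp only [mul_one, weylQuantization_one hħ, coordOp_inl] at this
    rw [coordOp_inl]
    refine Eq.trans this ?_
    ring
  · have := weylQuantization_coordFun_inr_mul (isPolySymbol_const 1) hħ z j ψ x
    simp only [mul_one, weylQuantization_one hħ] at this
    refine Eq.trans this ?_
    have h0 : (fun ζ : Phase d => fderiv ℝ (fun _ : Phase d => (1 : ℝ)) ζ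
        (posIncl d (EuclideanSpace.single j 1))) = fun _ => 0 := by funext ζ; simp
    rw [h0, weylQuantization_const hħ]
    simp

lemma fderiv_coordFun (z : Phase d) (i : Fin d ⊕ Fin d) (ζ v : Phase d) :
    fderiv ℝ (coordFun z i) ζ v = v i := by
  have h : HasFDerivAt (coordFun z i) (EuclideanSpace.proj i : Phase d →L[ℝ] ℝ) ζ :=
    (EuclideanSpace.proj i : Phase d →L[ℝ] ℝ).hasFDerivAt.sub_const (z i)
  rw [h.fderiv]; rfl

lemma weylQuantization_coordFun_mul_inl {ħ : ℝ} (hħ : 0 < ħ) (z : Phase d) (j : Fin d)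
    (i : Fin d ⊕ Fin d) (ψ : 𝓢(Conf d, ℂ)) (x : Conf d) :
    weylQuantization ħ (fun ζ => coordFun z (Sum.inl j) ζ * coordFun z i ζ) ψ x =
      1 / 2 * (((x j - z (Sum.inl j) : ℝ) : ℂ) * coordOp ħ z i ψ x +
        coordOp ħ z i (coordOp ħ z (Sum.inl j) ψ) x) := by
  rw [weylQuantization_coordFun_inl_mul (isPolySymbol_coordFun z i) hħ,
    weylQuantization_coordFun hħ, weylQuantization_coordFun hħ]

lemma weylQuantization_coordFun_mul_inr {ħ : ℝ} (hħ : 0 < ħ) (z : Phase d) (j : Fin d)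
    (i : Fin d ⊕ Fin d) (ψ : 𝓢(Conf d, ℂ)) (x : Conf d) :
    weylQuantization ħ (fun ζ => coordFun z (Sum.inr j) ζ * coordFun z i ζ) ψ x =
      coordOp ħ z i (coordOp ħ z (Sum.inr j) ψ) x -
        Complex.I * ħ / 2 * (if i = Sum.inl j then 1 else 0) * ψ x := by
  rw [weylQuantization_coordFun_inr_mul (isPolySymbol_coordFun z i) hħ,
    weylQuantization_coordFun hħ]
  simp only [fderiv_coordFun]
  rw [weylQuantization_const hħ, posIncl_apply]
  rcases i with i | i
  · by_cases h : i = j <;> simp [phasePoint, h]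
  · simp [phasePoint]

/-! ### Gaussian states -/

/-- The complex phase `p·u + ½ u·Γu`, `u = x - q`, of a Gaussian state centred at `z = (q, p)`. -/
def gaussPhase (z : Phase d) (Γ : Matrix (Fin d) (Fin d) ℂ) (x : Conf d) : ℂ :=
  ∑ j, ((z (Sum.inr j) * (x j - z (Sum.inl j)) : ℝ) : ℂ) +
    1 / 2 * ∑ j, ∑ k, Γ j k * ((x j - z (Sum.inl j) : ℝ) : ℂ) * ((x k - z (Sum.inl k) : ℝ) : ℂ)

/-- The Gaussian wave function `c e^{(i/ħ)(p·u + ½ u·Γu)}`, `u = x - q`. -/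
def gaussFun (ħ : ℝ) (c : ℂ) (z : Phase d) (Γ : Matrix (Fin d) (Fin d) ℂ) (x : Conf d) : ℂ :=
  c * Complex.exp (Complex.I / ħ * gaussPhase z Γ x)

/-- The imaginary part of `Γ` is bounded below by `δ`. -/
def ImBoundedBelow (δ : ℝ) (Γ : Matrix (Fin d) (Fin d) ℂ) : Prop :=
  ∀ u : Conf d, δ * ‖u‖ ^ 2 ≤ ∑ j, ∑ k, (Γ j k).im * u j * u k

lemma hasTemperateGrowth_coord (j : Fin d) (c : ℝ) :
    (fun x : Conf d => ((x j - c : ℝ) : ℂ)).HasTemperateGrowth := by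
  have h1 : (fun x : Conf d => x j - c).HasTemperateGrowth :=
    (EuclideanSpace.proj j : Conf d →L[ℝ] ℝ).hasTemperateGrowth.sub (.const c)
  exact Function.HasTemperateGrowth.comp Function.Complex.hasTemperateGrowth_ofReal h1

lemma hasTemperateGrowth_gaussPhase (z : Phase d) (Γ : Matrix (Fin d) (Fin d) ℂ) :
    (gaussPhase z Γ).HasTemperateGrowth := by
  unfold gaussPhase
  refine Function.HasTemperateGrowth.add (.sum fun j _ => ?_)
    (.mul (.const _) (.sum fun j _ => .sum fun k _ => ?_))
  · simp only [Complex.ofReal_mul]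
    exact .mul (.const _) (hasTemperateGrowth_coord j _)
  · exact .mul (.mul (.const _) (hasTemperateGrowth_coord j _)) (hasTemperateGrowth_coord k _)

/-- The derivatives of `exp` at `w` are those at `0` multiplied by `exp w`. -/
lemma norm_iteratedFDeriv_cexp (n : ℕ) (w : ℂ) :
    ‖iteratedFDeriv ℝ n Complex.exp w‖ = ‖Complex.exp w‖ * ‖iteratedFDeriv ℝ n Complex.exp 0‖ := by
  have h : Complex.exp = fun v => Complex.exp w • (fun s => Complex.exp (s - w)) v := by
    funext v
    rw [smul_eq_mul, ← Complex.exp_add]; ring_nf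
  have hsm : ContDiff ℝ n (fun s => Complex.exp (s - w)) := by fun_prop
  conv_lhs => rw [h]
  rw [show (fun v => Complex.exp w • (fun s => Complex.exp (s - w)) v) =
    Complex.exp w • (fun s => Complex.exp (s - w)) from rfl,
    iteratedFDeriv_const_smul_apply hsm.contDiffAt, norm_smul, iteratedFDeriv_comp_sub, sub_self]

/-- The exponential of a function of temperate growth is a Schwartz function as soon as it decays
rapidly: by the Faà di Bruno formula its derivatives are bounded by its modulus times powers. -/
lemma exists_schwartz_cexp {φ : Conf d → ℂ} (hφ : φ.HasTemperateGrowth)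
    (hdec : ∀ K : ℕ, ∃ C, ∀ x, (1 + ‖x‖) ^ K * ‖Complex.exp (φ x)‖ ≤ C) :
    ∃ ψ : 𝓢(Conf d, ℂ), ∀ x, ψ x = Complex.exp (φ x) := by
  refine ⟨⟨fun x => Complex.exp (φ x), Complex.contDiff_exp.comp hφ.1, fun k n => ?_⟩,
    fun x => rfl⟩
  obtain ⟨r, C, hC0, hC⟩ := hφ.norm_iteratedFDeriv_le_uniform n
  set A : ℝ := ∑ i ∈ Finset.range (n + 1), ‖iteratedFDeriv ℝ i Complex.exp (0 : ℂ)‖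
  obtain ⟨B, hB⟩ := hdec (k + r * n)
  refine ⟨n.factorial * A * (1 + C) ^ n * B, fun x => ?_⟩
  have h1 := norm_iteratedFDeriv_comp_le (𝕜 := ℝ) (g := Complex.exp) (f := φ) (n := n) (N := ∞)
    (C := ‖Complex.exp (φ x)‖ * A) (D := (1 + C) * (1 + ‖x‖) ^ r)
    Complex.contDiff_exp hφ.1 (by exact_mod_cast le_top) x
    (fun i hi => by
      rw [norm_iteratedFDeriv_cexp]
      gcongr
      exact Finset.single_le_sum (f := fun i => ‖iteratedFDeriv ℝ i Complex.exp (0 : ℂ)‖)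
        (fun i _ => norm_nonneg _) (Finset.mem_range.2 (by omega)))
    (fun i h1i hi => by
      refine (hC i hi x).trans ?_
      have h2 : 1 ≤ (1 + C) * (1 + ‖x‖) ^ r := by
        have : (1 : ℝ) ≤ (1 + ‖x‖) ^ r := one_le_pow₀ (by linarith [norm_nonneg x])
        nlinarith
      calc C * (1 + ‖x‖) ^ r ≤ (1 + C) * (1 + ‖x‖) ^ r := by gcongr; linarith
        _ ≤ _ := le_self_pow₀ h2 (by omega))
  have hx : ‖x‖ ^ k ≤ (1 + ‖x‖) ^ k := by gcongr; linarith
  calc ‖x‖ ^ k * ‖iteratedFDeriv ℝ n (fun x => Complex.exp (φ x)) x‖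
      ≤ (1 + ‖x‖) ^ k * (n.factorial * (‖Complex.exp (φ x)‖ * A) *
          ((1 + C) * (1 + ‖x‖) ^ r) ^ n) := by gcongr; exact h1
    _ = n.factorial * A * (1 + C) ^ n * ((1 + ‖x‖) ^ (k + r * n) * ‖Complex.exp (φ x)‖) := by
        rw [mul_pow, pow_add, pow_mul]; ring
    _ ≤ _ := by
        have : 0 ≤ A := Finset.sum_nonneg fun i _ => norm_nonneg _
        gcongr
        exact hB x

lemma one_add_pow_mul_exp_neg_sq_le {β : ℝ} (hβ : 0 < β) (K : ℕ) {r : ℝ} (hr : 0 ≤ r) :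
    (1 + r) ^ K * Real.exp (-β * r ^ 2) ≤ Real.exp ((K : ℝ) ^ 2 / (4 * β)) := by
  have h1 : (1 + r) ^ K ≤ Real.exp (K * r) := by
    rw [Real.exp_nat_mul]
    gcongr
    linarith [Real.add_one_le_exp r]
  calc _ ≤ Real.exp (K * r) * Real.exp (-β * r ^ 2) := by gcongr
    _ = Real.exp (K * r + -β * r ^ 2) := (Real.exp_add _ _).symm
    _ ≤ _ := by
      gcongr
      rw [le_div_iff₀ (by positivity)]
      nlinarith [sq_nonneg (2 * β * r - K)]

lemma norm_cexp_gaussPhase_le {ħ δ : ℝ} (hħ : 0 < ħ) {z : Phase d}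
    {Γ : Matrix (Fin d) (Fin d) ℂ} (hΓ : ImBoundedBelow δ Γ) (x : Conf d) :
    ‖Complex.exp (Complex.I / ħ * gaussPhase z Γ x)‖ ≤
      Real.exp (-(δ / (2 * ħ)) * ‖x - pos z‖ ^ 2) := by
  rw [Complex.norm_exp]
  gcongr
  have h1 := hΓ (x - pos z)
  have h2 : (Complex.I / ħ * gaussPhase z Γ x).re = -(gaussPhase z Γ x).im / ħ := by
    rw [div_mul_eq_mul_div, Complex.div_ofReal_re]
    simp
  have h3 : (gaussPhase z Γ x).im =
      1 / 2 * ∑ j, ∑ k, (Γ j k).im * (x - pos z) j * (x - pos z) k := by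
    simp only [gaussPhase, Complex.add_im, Complex.im_sum, Complex.ofReal_im,
      Finset.sum_const_zero, zero_add]
    have : (1 / 2 : ℂ) = ((1 / 2 : ℝ) : ℂ) := by norm_num
    rw [this, Complex.im_ofReal_mul, Complex.im_sum]
    congr 1
    refine Finset.sum_congr rfl fun j _ => ?_
    rw [Complex.im_sum]
    refine Finset.sum_congr rfl fun k _ => ?_
    rw [mul_assoc, ← Complex.ofReal_mul, Complex.im_mul_ofReal]
    simp [pos]
    ring
  rw [h2, h3, neg_div, neg_mul, neg_le_neg_iff, div_mul_eq_mul_div, div_le_div_iff₀ (by positivity)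
    hħ]
  nlinarith

lemma gaussFun_decay {ħ δ : ℝ} (hħ : 0 < ħ) (hδ : 0 < δ) {z : Phase d}
    {Γ : Matrix (Fin d) (Fin d) ℂ} (hΓ : ImBoundedBelow δ Γ) (K : ℕ) (x : Conf d) :
    (1 + ‖x‖) ^ K * ‖Complex.exp (Complex.I / ħ * gaussPhase z Γ x)‖ ≤
      (1 + ‖pos z‖) ^ K * Real.exp ((K : ℝ) ^ 2 / (4 * (δ / (2 * ħ)))) := by
  have h0 : 1 + ‖x‖ ≤ (1 + ‖pos z‖) * (1 + ‖x - pos z‖) := by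
    have := norm_add_le (pos z) (x - pos z)
    rw [add_sub_cancel] at this
    nlinarith [norm_nonneg (pos z), norm_nonneg (x - pos z)]
  calc _ ≤ ((1 + ‖pos z‖) * (1 + ‖x - pos z‖)) ^ K *
        Real.exp (-(δ / (2 * ħ)) * ‖x - pos z‖ ^ 2) := by
        gcongr
        exact norm_cexp_gaussPhase_le hħ hΓ x
    _ = (1 + ‖pos z‖) ^ K * ((1 + ‖x - pos z‖) ^ K *
        Real.exp (-(δ / (2 * ħ)) * ‖x - pos z‖ ^ 2)) := by rw [mul_pow]; ring
    _ ≤ _ := by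
        gcongr
        exact one_add_pow_mul_exp_neg_sq_le (by positivity) K (norm_nonneg _)

lemma exists_schwartz_gaussFun {ħ δ : ℝ} (hħ : 0 < ħ) (hδ : 0 < δ) (c : ℂ) (z : Phase d)
    {Γ : Matrix (Fin d) (Fin d) ℂ} (hΓ : ImBoundedBelow δ Γ) :
    ∃ ψ : 𝓢(Conf d, ℂ), ∀ x, ψ x = gaussFun ħ c z Γ x := by
  obtain ⟨ψ, hψ⟩ := exists_schwartz_cexp (φ := fun x => Complex.I / ħ * gaussPhase z Γ x)
    (.mul (.const _) (hasTemperateGrowth_gaussPhase z Γ))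
    (fun K => ⟨_, fun x => gaussFun_decay hħ hδ hΓ K x⟩)
  exact ⟨c • ψ, fun x => by simp [gaussFun, hψ]⟩

end

section

/-! ### Quadratic Hamiltonians acting on Gaussian states -/

/-- The complex phase space vector `(u, Γu)`, `u = x - q`: the eigenvalues with which the centred
position and momentum operators act on a Gaussian state. -/
def gaussVec (z : Phase d) (Γ : Matrix (Fin d) (Fin d) ℂ) (x : Conf d) : Fin d ⊕ Fin d → ℂ :=
  Sum.elim (fun j => ((x j - z (Sum.inl j) : ℝ) : ℂ))
    (fun j => ∑ k, Γ j k * ((x k - z (Sum.inl k) : ℝ) : ℂ))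

/-- The correction of order `ħ` in the action of products of two coordinate operators on a
Gaussian state. -/
def gaussCov (Γ : Matrix (Fin d) (Fin d) ℂ) : Fin d ⊕ Fin d → Fin d ⊕ Fin d → ℂ
  | Sum.inl _, Sum.inl _ => 0
  | Sum.inl j, Sum.inr k => if j = k then 1 / 2 else 0
  | Sum.inr j, Sum.inl k => if j = k then 1 / 2 else 0
  | Sum.inr j, Sum.inr k => Γ j k

lemma hasDerivWithinAt_gaussPhase {s : Set ℝ} {t : ℝ} {z : ℝ → Phase d}
    {Γ : ℝ → Matrix (Fin d) (Fin d) ℂ} {y : ℝ → Conf d} {z' : Phase d}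
    {Γ' : Matrix (Fin d) (Fin d) ℂ} {y' : Conf d}
    (hz : ∀ i, HasDerivWithinAt (fun t => z t i) (z' i) s t)
    (hΓ : ∀ j k, HasDerivWithinAt (fun t => Γ t j k) (Γ' j k) s t)
    (hy : ∀ j, HasDerivWithinAt (fun t => y t j) (y' j) s t) (hsymm : (Γ t).IsSymm) :
    HasDerivWithinAt (fun t => gaussPhase (z t) (Γ t) (y t))
      (∑ j, ((z' (Sum.inr j) * (y t j - z t (Sum.inl j)) +
          z t (Sum.inr j) * (y' j - z' (Sum.inl j)) : ℝ) : ℂ) +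
        1 / 2 * ∑ j, ∑ k, Γ' j k * ((y t j - z t (Sum.inl j) : ℝ) : ℂ) *
          ((y t k - z t (Sum.inl k) : ℝ) : ℂ) +
        ∑ j, ((y' j - z' (Sum.inl j) : ℝ) : ℂ) * gaussVec (z t) (Γ t) (y t) (Sum.inr j)) s t := by
  have hu : ∀ j, HasDerivWithinAt (fun t => ((y t j - z t (Sum.inl j) : ℝ) : ℂ))
      ((y' j - z' (Sum.inl j) : ℝ) : ℂ) s t := fun j =>
    ((hy j).sub (hz (Sum.inl j))).ofReal_comp
  have h1 : HasDerivWithinAt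
      (fun t => ∑ j, ((z t (Sum.inr j) * (y t j - z t (Sum.inl j)) : ℝ) : ℂ))
      (∑ j, ((z' (Sum.inr j) * (y t j - z t (Sum.inl j)) +
          z t (Sum.inr j) * (y' j - z' (Sum.inl j)) : ℝ) : ℂ)) s t :=
    HasDerivWithinAt.fun_sum fun j _ =>
      ((hz (Sum.inr j)).mul ((hy j).sub (hz (Sum.inl j)))).ofReal_comp
  have h2 := (HasDerivWithinAt.fun_sum (u := Finset.univ) fun j _ =>
    HasDerivWithinAt.fun_sum (u := Finset.univ) fun k _ =>
      ((hΓ j k).mul (hu j)).mul (hu k)).const_mul (1 / 2 : ℂ)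
  refine (h1.add h2).congr_deriv ?_
  rw [add_assoc]
  congr 1
  have hswap : ∑ j, ∑ k, Γ t j k * ((y t j - z t (Sum.inl j) : ℝ) : ℂ) *
      ((y' k - z' (Sum.inl k) : ℝ) : ℂ) =
      ∑ j, ∑ k, Γ t j k * ((y' j - z' (Sum.inl j) : ℝ) : ℂ) *
      ((y t k - z t (Sum.inl k) : ℝ) : ℂ) := by
    rw [Finset.sum_comm]
    refine Finset.sum_congr rfl fun j _ => Finset.sum_congr rfl fun k _ => ?_
    rw [hsymm.apply]; ring
  have hsplit : ∑ j, ∑ k, ((Γ' j k * ((y t j - z t (Sum.inl j) : ℝ) : ℂ) +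
        Γ t j k * ((y' j - z' (Sum.inl j) : ℝ) : ℂ)) * ((y t k - z t (Sum.inl k) : ℝ) : ℂ) +
        Γ t j k * ((y t j - z t (Sum.inl j) : ℝ) : ℂ) * ((y' k - z' (Sum.inl k) : ℝ) : ℂ)) =
      ∑ j, ∑ k, Γ' j k * ((y t j - z t (Sum.inl j) : ℝ) : ℂ) *
          ((y t k - z t (Sum.inl k) : ℝ) : ℂ) +
      2 * ∑ j, ∑ k, Γ t j k * ((y' j - z' (Sum.inl j) : ℝ) : ℂ) *
      ((y t k - z t (Sum.inl k) : ℝ) : ℂ) := by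
    rw [two_mul]
    nth_rewrite 2 [← hswap]
    simp only [← Finset.sum_add_distrib]
    refine Finset.sum_congr rfl fun j _ => Finset.sum_congr rfl fun k _ => ?_
    ring
  have hlast : ∑ j, ((y' j - z' (Sum.inl j) : ℝ) : ℂ) * gaussVec (z t) (Γ t) (y t) (Sum.inr j) =
      ∑ j, ∑ k, Γ t j k * ((y' j - z' (Sum.inl j) : ℝ) : ℂ) *
      ((y t k - z t (Sum.inl k) : ℝ) : ℂ) := by
    refine Finset.sum_congr rfl fun j _ => ?_
    simp only [gaussVec, Sum.elim_inr, Finset.mul_sum]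
    refine Finset.sum_congr rfl fun k _ => ?_
    ring
  rw [hlast]
  refine Eq.trans (congrArg _ hsplit) ?_
  ring

variable {ħ : ℝ} {c : ℂ} {z : Phase d} {Γ : Matrix (Fin d) (Fin d) ℂ} {ψ : 𝓢(Conf d, ℂ)}

lemma fderiv_eq_of_hasDerivAt {V : Type*} [NormedAddCommGroup V] [NormedSpace ℝ V] {f : V → ℂ}
    {x v : V} {f' : ℂ} (hf : DifferentiableAt ℝ f x)
    (h : HasDerivAt (fun t : ℝ => f (x + t • v)) f' 0) : fderiv ℝ f x v = f' :=
  (hf.hasFDerivAt.hasLineDerivAt v).lineDeriv.symm.trans (HasLineDerivAt.lineDeriv h)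

lemma fderiv_gaussFun (hsymm : Γ.IsSymm) (hψ : ∀ x, ψ x = gaussFun ħ c z Γ x) (x : Conf d)
    (j : Fin d) : fderiv ℝ ψ x (EuclideanSpace.single j 1) =
      Complex.I / ħ * (z (Sum.inr j) + gaussVec z Γ x (Sum.inr j)) * ψ x := by
  refine fderiv_eq_of_hasDerivAt ψ.differentiableAt ?_
  have h1 := hasDerivWithinAt_gaussPhase (s := Set.univ) (t := 0) (z := fun _ => z)
    (Γ := fun _ => Γ) (y := fun t : ℝ => x + t • EuclideanSpace.single j (1 : ℝ)) (z' := 0) (Γ' := 0)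
    (y' := EuclideanSpace.single j 1) (fun i => hasDerivWithinAt_const (0 : ℝ) _ (z i))
    (fun j k => hasDerivWithinAt_const (0 : ℝ) _ (Γ j k))
    (fun k => by
      have := ((hasDerivAt_id (0 : ℝ)).mul_const
        ((EuclideanSpace.single j (1 : ℝ) : Conf d) k)).const_add (x k)
      exact this.hasDerivWithinAt.congr_deriv (by simp)) hsymm
  rw [hasDerivWithinAt_univ] at h1
  have h2 := ((h1.const_mul (Complex.I / ħ)).cexp).const_mul c
  simp only [hψ, gaussFun]
  convert! h2 using 1
  simp only [zero_smul, add_zero]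
  simp [ite_mul, mul_ite, apply_ite Complex.ofReal]
  ring

lemma coordOp_gaussFun (hħ : 0 < ħ) (hsymm : Γ.IsSymm) (hψ : ∀ x, ψ x = gaussFun ħ c z Γ x)
    (i : Fin d ⊕ Fin d) (x : Conf d) : coordOp ħ z i ψ x = gaussVec z Γ x i * ψ x := by
  have hh : (ħ : ℂ) ≠ 0 := by exact_mod_cast hħ.ne'
  rcases i with j | j
  · rw [coordOp_inl]; rfl
  · rw [coordOp_inr, fderiv_gaussFun hsymm hψ]
    field_simp
    rw [Complex.I_sq]
    ring

lemma hasDerivAt_gaussVec (i : Fin d ⊕ Fin d) (x : Conf d) (k : Fin d) :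
    HasDerivAt (fun t : ℝ => gaussVec z Γ (x + t • EuclideanSpace.single k (1 : ℝ)) i)
      (Sum.elim (fun j => if j = k then (1 : ℂ) else 0) (fun j => Γ j k) i) 0 := by
  have hu : ∀ j, HasDerivAt (fun t : ℝ => (((x + t • EuclideanSpace.single k (1 : ℝ) : Conf d) j -
      z (Sum.inl j) : ℝ) : ℂ)) (if j = k then (1 : ℂ) else 0) 0 := by
    intro j
    have := ((((hasDerivAt_id (0 : ℝ)).mul_const
        ((EuclideanSpace.single k (1 : ℝ) : Conf d) j)).const_add (x j)).sub_const
          (z (Sum.inl j))).ofReal_comp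
    convert! this using 1
    simp [apply_ite Complex.ofReal]
  rcases i with j | j
  · exact hu j
  · have := HasDerivAt.fun_sum (u := Finset.univ) fun l _ => (hu l).const_mul (Γ j l)
    convert! this using 1
    simp

lemma coordOp_inr_coordOp_gaussFun (hħ : 0 < ħ) (hsymm : Γ.IsSymm)
    (hψ : ∀ x, ψ x = gaussFun ħ c z Γ x) (i : Fin d ⊕ Fin d) (k : Fin d) (x : Conf d) :
    coordOp ħ z (Sum.inr k) (coordOp ħ z i ψ) x =
      (gaussVec z Γ x i * gaussVec z Γ x (Sum.inr k) - Complex.I * ħ *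
        Sum.elim (fun j => if j = k then (1 : ℂ) else 0) (fun j => Γ j k) i) * ψ x := by
  have h1 : HasDerivAt (fun t : ℝ => ψ (x + t • EuclideanSpace.single k (1 : ℝ)))
      (fderiv ℝ ψ x (EuclideanSpace.single k 1)) 0 :=
    ψ.differentiableAt.hasFDerivAt.hasLineDerivAt (EuclideanSpace.single k (1 : ℝ))
  have h2 := (hasDerivAt_gaussVec (z := z) (Γ := Γ) i x k).mul h1
  have h3 : fderiv ℝ (coordOp ħ z i ψ) x (EuclideanSpace.single k 1) = _ :=
    fderiv_eq_of_hasDerivAt (coordOp ħ z i ψ).differentiableAt (by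
      simp only [coordOp_gaussFun hħ hsymm hψ]
      exact h2)
  have h4 := coordOp_gaussFun hħ hsymm hψ (Sum.inr k) x
  rw [coordOp_inr] at h4
  rw [coordOp_inr, h3, coordOp_gaussFun hħ hsymm hψ]
  simp only [zero_smul, add_zero]
  linear_combination (gaussVec z Γ x i) * h4

lemma weylQuantization_coordFun_mul_gaussFun (hħ : 0 < ħ) (hsymm : Γ.IsSymm)
    (hψ : ∀ x, ψ x = gaussFun ħ c z Γ x) (i j : Fin d ⊕ Fin d) (x : Conf d) :
    weylQuantization ħ (fun ζ => coordFun z i ζ * coordFun z j ζ) ψ x =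
      (gaussVec z Γ x i * gaussVec z Γ x j - Complex.I * ħ * gaussCov Γ i j) * ψ x := by
  rcases i with i | i
  · rw [weylQuantization_coordFun_mul_inl hħ, coordOp_gaussFun hħ hsymm hψ]
    have hx : ((x i - z (Sum.inl i) : ℝ) : ℂ) = gaussVec z Γ x (Sum.inl i) := rfl
    rcases j with j | j
    · rw [coordOp_inl, coordOp_gaussFun hħ hsymm hψ]
      have hxj : ((x j - z (Sum.inl j) : ℝ) : ℂ) = gaussVec z Γ x (Sum.inl j) := rfl
      rw [hx, hxj]
      simp only [gaussCov]
      ring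
    · rw [coordOp_inr_coordOp_gaussFun hħ hsymm hψ, hx]
      simp only [gaussCov, Sum.elim_inl]
      split_ifs <;> ring
  · rw [weylQuantization_coordFun_mul_inr hħ]
    rcases j with j | j
    · rw [coordOp_inl, coordOp_gaussFun hħ hsymm hψ]
      have hxj : ((x j - z (Sum.inl j) : ℝ) : ℂ) = gaussVec z Γ x (Sum.inl j) := rfl
      rw [hxj]
      simp only [gaussCov, Sum.inl.injEq, eq_comm (a := i)]
      split_ifs <;> ring
    · rw [coordOp_inr_coordOp_gaussFun hħ hsymm hψ]
      simp only [gaussCov, Sum.elim_inr, reduceCtorEq, if_false]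
      ring

/-- The matrix entries of a linear map of phase space. -/
def entry (A : Phase d →L[ℝ] Phase d) (i j : Fin d ⊕ Fin d) : ℝ :=
  A (EuclideanSpace.single j 1) i

lemma apply_eq_sum_entry (A : Phase d →L[ℝ] Phase d) (v : Phase d) (i : Fin d ⊕ Fin d) :
    A v i = ∑ j, entry A i j * v j := by
  conv_lhs => rw [← (EuclideanSpace.basisFun (Fin d ⊕ Fin d) ℝ).sum_repr v]
  simp [map_sum, entry, mul_comm]

/-- The quadratic polynomial with value `h₀`, gradient `g` and Hessian `A` at `z`. -/
def quadPoly (h₀ : ℝ) (g : Phase d) (A : Phase d →L[ℝ] Phase d) (z ζ : Phase d) : ℝ :=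
  h₀ + inner ℝ g (ζ - z) + 1 / 2 * inner ℝ (A (ζ - z)) (ζ - z)

lemma quadPoly_eq (h₀ : ℝ) (g : Phase d) (A : Phase d →L[ℝ] Phase d) (z : Phase d) :
    quadPoly h₀ g A z = fun ζ => (h₀ + ∑ i, g i * coordFun z i ζ) +
      1 / 2 * ∑ i, ∑ j, entry A i j * (coordFun z i ζ * coordFun z j ζ) := by
  funext ζ
  simp only [quadPoly, coordFun]
  congr 2
  · simp [PiLp.inner_apply, mul_comm]
  · simp only [PiLp.inner_apply, apply_eq_sum_entry A]
    refine Finset.sum_congr rfl fun i _ => ?_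
    simp only [RCLike.inner_apply, conj_trivial, Finset.mul_sum]
    refine Finset.sum_congr rfl fun j _ => ?_
    simp
    ring

lemma isPolySymbol_quadPoly (h₀ : ℝ) (g : Phase d) (A : Phase d →L[ℝ] Phase d) (z : Phase d) :
    IsPolySymbol 2 (quadPoly h₀ g A z) := by
  rw [quadPoly_eq]
  refine IsPolySymbol.add (IsPolySymbol.add ((isPolySymbol_const _).mono (by omega)) ?_) ?_
  · exact IsPolySymbol.sum _ fun i _ => ((isPolySymbol_coordFun z i).const_mul _).mono (by omega)
  · exact (IsPolySymbol.sum _ fun i _ => IsPolySymbol.sum _ fun j _ =>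
      (((isPolySymbol_coordFun z i).mul (isPolySymbol_coordFun z j)).const_mul _)).const_mul _

/-- A quadratic Hamiltonian acts on a Gaussian state by multiplication with a quadratic
polynomial. -/
lemma weylQuantization_quadPoly_gaussFun (hħ : 0 < ħ) (hsymm : Γ.IsSymm)
    (hψ : ∀ x, ψ x = gaussFun ħ c z Γ x) (h₀ : ℝ) (g : Phase d) (A : Phase d →L[ℝ] Phase d)
    (x : Conf d) :
    weylQuantization ħ (quadPoly h₀ g A z) ψ x =
      (h₀ + ∑ i, g i * gaussVec z Γ x i +
        1 / 2 * ∑ i, ∑ j, entry A i j * (gaussVec z Γ x i * gaussVec z Γ x j) -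
        Complex.I * ħ / 2 * ∑ i, ∑ j, entry A i j * gaussCov Γ i j) * ψ x := by
  have p1 : ∀ i, IsPolySymbol 1 (fun ζ : Phase d => g i * coordFun z i ζ) := fun i =>
    (isPolySymbol_coordFun z i).const_mul _
  have p2 : ∀ i j, IsPolySymbol 2 (fun ζ : Phase d =>
      entry A i j * (coordFun z i ζ * coordFun z j ζ)) := fun i j =>
    ((isPolySymbol_coordFun z i).mul (isPolySymbol_coordFun z j)).const_mul _
  have p3 : ∀ i, IsPolySymbol 2 (fun ζ : Phase d =>
      ∑ j, entry A i j * (coordFun z i ζ * coordFun z j ζ)) := fun i =>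
    IsPolySymbol.sum _ fun j _ => p2 i j
  have p4 : IsPolySymbol 1 (fun ζ : Phase d => ∑ i, g i * coordFun z i ζ) :=
    IsPolySymbol.sum _ fun i _ => p1 i
  have p0 : IsPolySymbol 1 (fun _ : Phase d => h₀) := (isPolySymbol_const _).mono (by omega)
  rw [quadPoly_eq, weylQuantization_add (p0.add p4)
    ((IsPolySymbol.sum _ fun i _ => p3 i).const_mul _) hħ, weylQuantization_add p0 p4 hħ,
    weylQuantization_const hħ, weylQuantization_const_mul,
    weylQuantization_sum _ (fun i _ => p1 i) hħ, weylQuantization_sum _ (fun i _ => p3 i) hħ]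
  have e1 : ∀ i, weylQuantization ħ (fun ζ => g i * coordFun z i ζ) ψ x =
      g i * gaussVec z Γ x i * ψ x := fun i => by
    rw [weylQuantization_const_mul, weylQuantization_coordFun hħ, coordOp_gaussFun hħ hsymm hψ,
      mul_assoc]
  have e2 : ∀ i, weylQuantization ħ (fun ζ => ∑ j, entry A i j * (coordFun z i ζ * coordFun z j ζ))
      ψ x = (∑ j, entry A i j * (gaussVec z Γ x i * gaussVec z Γ x j) -
        Complex.I * ħ * ∑ j, entry A i j * gaussCov Γ i j) * ψ x := fun i => by
    rw [weylQuantization_sum _ (fun j _ => p2 i j) hħ, Finset.mul_sum, ← Finset.sum_sub_distrib,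
      Finset.sum_mul]
    refine Finset.sum_congr rfl fun j _ => ?_
    rw [weylQuantization_const_mul, weylQuantization_coordFun_mul_gaussFun hħ hsymm hψ]
    ring
  simp only [e1, e2]
  rw [← Finset.sum_mul, ← Finset.sum_mul, Finset.sum_sub_distrib, ← Finset.mul_sum]
  push_cast
  ring

/-- A Gaussian state whose centre follows the Hamilton equations of a quadratic Hamiltonian,
whose width follows the Riccati equation and whose amplitude `c` compensates both, solves the
Schrödinger equation pointwise. -/
lemma hasDerivWithinAt_gaussFun {s : Set ℝ} {t : ℝ} {z : ℝ → Phase d}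
    {Γ : ℝ → Matrix (Fin d) (Fin d) ℂ} {c : ℝ → ℂ} {Γ' : Matrix (Fin d) (Fin d) ℂ}
    (hħ : 0 < ħ) {ψ : 𝓢(Conf d, ℂ)} (hψ : ∀ x, ψ x = gaussFun ħ (c t) (z t) (Γ t) x)
    (hsymm : (Γ t).IsSymm) (h₀ : ℝ) (g : Phase d) (A : Phase d →L[ℝ] Phase d)
    (hz : ∀ i, HasDerivWithinAt (fun t => z t i) (poisson d g i) s t)
    (hΓ : ∀ j k, HasDerivWithinAt (fun t => Γ t j k) (Γ' j k) s t)
    (hric : ∀ x : Conf d, ∑ j, ∑ k, Γ' j k * ((x j - z t (Sum.inl j) : ℝ) : ℂ) *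
          ((x k - z t (Sum.inl k) : ℝ) : ℂ) =
      -∑ i, ∑ j, entry A i j * (gaussVec (z t) (Γ t) x i * gaussVec (z t) (Γ t) x j))
    (hc : HasDerivWithinAt c ((Complex.I / ħ *
        ((∑ j, z t (Sum.inr j) * g (Sum.inr j) - h₀ : ℝ) : ℂ) -
        1 / 2 * ∑ i, ∑ j, entry A i j * gaussCov (Γ t) i j) * c t) s t) (x : Conf d) :
    HasDerivWithinAt (fun t => gaussFun ħ (c t) (z t) (Γ t) x)
      ((Complex.I * ħ)⁻¹ * weylQuantization ħ (quadPoly h₀ g A (z t)) ψ x) s t := by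
  have h1 := hasDerivWithinAt_gaussPhase (y := fun _ => x) (y' := 0) hz hΓ
    (fun j => by simpa using hasDerivWithinAt_const _ _ _) hsymm
  have h2 := hc.mul (h1.const_mul (Complex.I / ħ)).cexp
  refine h2.congr_deriv ?_
  rw [weylQuantization_quadPoly_gaussFun hħ hsymm hψ, hψ x, hric x]
  simp only [gaussFun]
  have hpi : ∀ j, poisson d g (Sum.inl j) = g (Sum.inr j) := fun j => by
    simp [poisson, phasePoint, mom]
  have hpr : ∀ j, poisson d g (Sum.inr j) = -g (Sum.inl j) := fun j => by
    simp [poisson, phasePoint, pos]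
  have hh : (ħ : ℂ) ≠ 0 := by exact_mod_cast hħ.ne'
  have hinv : (Complex.I * ħ)⁻¹ = -(Complex.I / ħ) := by
    rw [mul_inv, Complex.inv_I]; ring
  rw [hinv]
  have hs1 : ∑ i, (g i : ℂ) * gaussVec (z t) (Γ t) x i =
      ∑ j, (g (Sum.inl j) : ℂ) * ((x j - z t (Sum.inl j) : ℝ) : ℂ) +
      ∑ j, (g (Sum.inr j) : ℂ) * gaussVec (z t) (Γ t) x (Sum.inr j) := by
    rw [Fintype.sum_sum_type]; rfl
  have hs2 : ∑ j, ((poisson d g (Sum.inr j) * (x j - z t (Sum.inl j)) +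
          z t (Sum.inr j) * ((0 : Conf d) j - poisson d g (Sum.inl j)) : ℝ) : ℂ) =
      -∑ j, (g (Sum.inl j) : ℂ) * ((x j - z t (Sum.inl j) : ℝ) : ℂ) -
      ((∑ j, z t (Sum.inr j) * g (Sum.inr j) : ℝ) : ℂ) := by
    push_cast
    rw [← Finset.sum_neg_distrib, ← Finset.sum_sub_distrib]
    refine Finset.sum_congr rfl fun j _ => ?_
    rw [hpi, hpr]
    simp
    ring
  have hs3 : ∑ j, (((0 : Conf d) j - poisson d g (Sum.inl j) : ℝ) : ℂ) *
      gaussVec (z t) (Γ t) x (Sum.inr j) =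
      -∑ j, (g (Sum.inr j) : ℂ) * gaussVec (z t) (Γ t) x (Sum.inr j) := by
    rw [← Finset.sum_neg_distrib]
    refine Finset.sum_congr rfl fun j _ => ?_
    rw [hpi]; simp
  rw [hs1, hs2, hs3]
  rw [Complex.ofReal_sub]
  generalize (((∑ j, z t (Sum.inr j) * g (Sum.inr j) : ℝ)) : ℂ) = σ
  generalize ∑ j, (g (Sum.inl j) : ℂ) * ((x j - z t (Sum.inl j) : ℝ) : ℂ) = σ₁
  generalize ∑ j, (g (Sum.inr j) : ℂ) * gaussVec (z t) (Γ t) x (Sum.inr j) = σ₂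
  generalize ∑ i, ∑ j, (entry A i j : ℂ) * gaussCov (Γ t) i j = σ₃
  generalize ∑ i, ∑ j, (entry A i j : ℂ) *
    (gaussVec (z t) (Γ t) x i * gaussVec (z t) (Γ t) x j) = σ₄
  generalize Complex.exp (Complex.I / ħ * gaussPhase (z t) (Γ t) x) = E
  field_simp
  linear_combination (-(ħ : ℂ) * σ₃ * c t * E) * Complex.I_sq

end

section

/-! ### Symplectic linear algebra -/

/-- `F` preserves the symplectic form `⟨v, Jw⟩`. -/
def IsSymplectic (F : Phase d →L[ℝ] Phase d) : Prop :=
  ∀ v w, inner ℝ (F v) (poisson d (F w)) = inner ℝ v (poisson d w)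

lemma inner_poisson (v w : Phase d) : inner ℝ v (poisson d w) =
    ∑ j, (v (Sum.inl j) * w (Sum.inr j) - v (Sum.inr j) * w (Sum.inl j)) := by
  simp [PiLp.inner_apply, poisson, phasePoint, pos, mom, Finset.sum_sub_distrib, mul_comm]
  ring

/-- The position block of `F` applied to the complex frame `e_α + i f_α`. -/
def posFrame (F : Phase d →L[ℝ] Phase d) : Matrix (Fin d) (Fin d) ℂ :=
  Matrix.of fun j α => (entry F (Sum.inl j) (Sum.inl α) : ℂ) +
    Complex.I * entry F (Sum.inl j) (Sum.inr α)

/-- The momentum block of `F` applied to the complex frame `e_α + i f_α`. -/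
def momFrame (F : Phase d →L[ℝ] Phase d) : Matrix (Fin d) (Fin d) ℂ :=
  Matrix.of fun j α => (entry F (Sum.inr j) (Sum.inl α) : ℂ) +
    Complex.I * entry F (Sum.inr j) (Sum.inr α)

/-- The matrix `Γ = P Q⁻¹` of the Gaussian state obtained by transporting the ground state
with `F`. -/
def widthMatrix (F : Phase d →L[ℝ] Phase d) : Matrix (Fin d) (Fin d) ℂ :=
  momFrame F * (posFrame F)⁻¹

variable {F : Phase d →L[ℝ] Phase d}

lemma IsSymplectic.sum_frame (hF : IsSymplectic F) (Y : Phase d) (α : Fin d) :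
    ∑ j, (((F Y (Sum.inl j) : ℝ) : ℂ) * momFrame F j α -
      ((F Y (Sum.inr j) : ℝ) : ℂ) * posFrame F j α) =
      -((Y (Sum.inr α) : ℝ) : ℂ) + Complex.I * ((Y (Sum.inl α) : ℝ) : ℂ) := by
  have h1 := hF Y (EuclideanSpace.single (Sum.inl α) 1)
  have h2 := hF Y (EuclideanSpace.single (Sum.inr α) 1)
  rw [inner_poisson, inner_poisson] at h1 h2
  have r1 : ∑ j, (Y (Sum.inl j) * (EuclideanSpace.single (Sum.inl α) (1 : ℝ) : Phase d) (Sum.inr j) -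
      Y (Sum.inr j) * (EuclideanSpace.single (Sum.inl α) (1 : ℝ) : Phase d) (Sum.inl j)) =
      -Y (Sum.inr α) := by
    simp
  have r2 : ∑ j, (Y (Sum.inl j) * (EuclideanSpace.single (Sum.inr α) (1 : ℝ) : Phase d) (Sum.inr j) -
      Y (Sum.inr j) * (EuclideanSpace.single (Sum.inr α) (1 : ℝ) : Phase d) (Sum.inl j)) =
      Y (Sum.inl α) := by
    simp
  rw [r1] at h1
  rw [r2] at h2
  rw [← Complex.ofReal_neg, ← h1, ← h2]
  push_cast
  rw [Finset.mul_sum, ← Finset.sum_add_distrib]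
  refine Finset.sum_congr rfl fun j _ => ?_
  simp only [momFrame, posFrame, Matrix.of_apply, entry]
  ring

/-- With `Q`, `P` the two blocks of the frame, `Qᵀ P` is symmetric; this makes `P Q⁻¹`
symmetric. -/
lemma IsSymplectic.transpose_mul (hF : IsSymplectic F) :
    (posFrame F)ᵀ * momFrame F = (momFrame F)ᵀ * posFrame F := by
  ext α β
  rw [← sub_eq_zero]
  have h1 := hF.sum_frame (EuclideanSpace.single (Sum.inl α) 1) β
  have h2 := hF.sum_frame (EuclideanSpace.single (Sum.inr α) 1) β
  have e : ((posFrame F)ᵀ * momFrame F) α β - ((momFrame F)ᵀ * posFrame F) α β =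
      ∑ j, (((F (EuclideanSpace.single (Sum.inl α) 1) (Sum.inl j) : ℝ) : ℂ) * momFrame F j β -
      ((F (EuclideanSpace.single (Sum.inl α) 1) (Sum.inr j) : ℝ) : ℂ) * posFrame F j β) +
      Complex.I *
      ∑ j, (((F (EuclideanSpace.single (Sum.inr α) 1) (Sum.inl j) : ℝ) : ℂ) * momFrame F j β -
      ((F (EuclideanSpace.single (Sum.inr α) 1) (Sum.inr j) : ℝ) : ℂ) * posFrame F j β) := by
    simp only [Matrix.mul_apply, Matrix.transpose_apply]
    rw [Finset.mul_sum, ← Finset.sum_add_distrib, ← Finset.sum_sub_distrib]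
    refine Finset.sum_congr rfl fun j _ => ?_
    simp only [momFrame, posFrame, Matrix.of_apply, entry]
    ring
  rw [e, h1, h2]
  by_cases hαβ : β = α <;> simp [hαβ]

/-- The relation `Q* P - P* Q = 2i`, from which `Q` is invertible and `Im (P Q⁻¹)` is positive
definite. -/
lemma IsSymplectic.conjTranspose_mul (hF : IsSymplectic F) :
    (posFrame F)ᴴ * momFrame F - (momFrame F)ᴴ * posFrame F = (2 * Complex.I) • 1 := by
  ext α β
  have h1 := hF.sum_frame (EuclideanSpace.single (Sum.inl α) 1) β
  have h2 := hF.sum_frame (EuclideanSpace.single (Sum.inr α) 1) β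
  have e : ((posFrame F)ᴴ * momFrame F) α β - ((momFrame F)ᴴ * posFrame F) α β =
      ∑ j, (((F (EuclideanSpace.single (Sum.inl α) 1) (Sum.inl j) : ℝ) : ℂ) * momFrame F j β -
      ((F (EuclideanSpace.single (Sum.inl α) 1) (Sum.inr j) : ℝ) : ℂ) * posFrame F j β) -
      Complex.I *
      ∑ j, (((F (EuclideanSpace.single (Sum.inr α) 1) (Sum.inl j) : ℝ) : ℂ) * momFrame F j β -
      ((F (EuclideanSpace.single (Sum.inr α) 1) (Sum.inr j) : ℝ) : ℂ) * posFrame F j β) := by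
    simp only [Matrix.mul_apply, Matrix.conjTranspose_apply]
    rw [Finset.mul_sum, ← Finset.sum_sub_distrib, ← Finset.sum_sub_distrib]
    refine Finset.sum_congr rfl fun j _ => ?_
    simp only [momFrame, posFrame, Matrix.of_apply, entry, RCLike.star_def, map_add, map_mul,
      Complex.conj_I, Complex.conj_ofReal]
    ring
  rw [Matrix.sub_apply, e, h1, h2]
  by_cases hαβ : β = α
  · simp [hαβ]
    ring
  · simp [hαβ, eq_comm (a := α)]

open scoped ComplexOrder in
lemma IsSymplectic.isUnit_det (hF : IsSymplectic F) : IsUnit (posFrame F).det := by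
  rw [isUnit_iff_ne_zero]
  intro h0
  obtain ⟨v, hv, hQ⟩ := Matrix.exists_mulVec_eq_zero_iff.2 h0
  have h := congrArg (fun A : Matrix (Fin d) (Fin d) ℂ => star v ⬝ᵥ (A *ᵥ v)) hF.conjTranspose_mul
  simp only [Matrix.sub_mulVec, ← Matrix.mulVec_mulVec, hQ, Matrix.mulVec_zero, sub_zero,
    Matrix.smul_mulVec, Matrix.one_mulVec, dotProduct_smul] at h
  rw [Matrix.dotProduct_mulVec, ← Matrix.star_mulVec, hQ] at h
  rw [star_zero, zero_dotProduct, eq_comm, smul_eq_zero] at h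
  rcases h with h | h
  · simp at h
  · exact hv (dotProduct_star_self_eq_zero.1 h)

lemma IsSymplectic.widthMatrix_mul (hF : IsSymplectic F) :
    widthMatrix F * posFrame F = momFrame F := by
  rw [widthMatrix, Matrix.mul_assoc, Matrix.nonsing_inv_mul _ hF.isUnit_det, Matrix.mul_one]

lemma IsSymplectic.isSymm_widthMatrix (hF : IsSymplectic F) : (widthMatrix F).IsSymm := by
  have hu := hF.isUnit_det
  have hut : IsUnit (posFrame F)ᵀ.det := by rwa [Matrix.det_transpose]
  have h : (posFrame F)ᵀ * (widthMatrix F)ᵀ * posFrame F =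
      (posFrame F)ᵀ * widthMatrix F * posFrame F := by
    rw [← Matrix.transpose_mul, hF.widthMatrix_mul, Matrix.mul_assoc, hF.widthMatrix_mul,
      hF.transpose_mul]
  have h1 := (Matrix.isUnit_iff_isUnit_det _).2 hu |>.mul_right_cancel h
  exact (Matrix.isUnit_iff_isUnit_det _).2 hut |>.mul_left_cancel h1

/-- The imaginary part of the width matrix. -/
def imWidth (F : Phase d →L[ℝ] Phase d) : Matrix (Fin d) (Fin d) ℝ :=
  (widthMatrix F).map Complex.im

lemma IsSymplectic.imWidth_eq (hF : IsSymplectic F) :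
    (2 * Complex.I) • (imWidth F).map Complex.ofReal = widthMatrix F - (widthMatrix F)ᴴ := by
  ext j k
  have := congrFun (congrFun hF.isSymm_widthMatrix k) j
  rw [Matrix.transpose_apply] at this
  simp only [imWidth, Matrix.smul_apply, Matrix.map_apply, Matrix.sub_apply,
    Matrix.conjTranspose_apply, smul_eq_mul, ← this, RCLike.star_def]
  rw [Complex.sub_conj]
  push_cast
  ring

/-- In the complex frame the imaginary part of the width matrix is the identity. -/
lemma IsSymplectic.frame_imWidth (hF : IsSymplectic F) :
    (posFrame F)ᴴ * (imWidth F).map Complex.ofReal * posFrame F = 1 := by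
  have h2 : (2 * Complex.I : ℂ) ≠ 0 := by simp
  have h : (2 * Complex.I) • ((posFrame F)ᴴ * (imWidth F).map Complex.ofReal * posFrame F) =
      (2 * Complex.I : ℂ) • (1 : Matrix (Fin d) (Fin d) ℂ) := by
    rw [← Matrix.smul_mul, ← Matrix.mul_smul, hF.imWidth_eq, Matrix.mul_sub, Matrix.sub_mul,
      Matrix.mul_assoc, hF.widthMatrix_mul, ← Matrix.conjTranspose_mul, hF.widthMatrix_mul,
      hF.conjTranspose_mul]
  exact smul_right_injective _ h2 h

lemma ofReal_mulVec (B : Matrix (Fin d) (Fin d) ℝ) (v : Fin d → ℝ) :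
    (B.map Complex.ofReal) *ᵥ (fun j => (v j : ℂ)) = fun j => (((B *ᵥ v) j : ℝ) : ℂ) := by
  funext j
  simp [Matrix.mulVec, dotProduct]

lemma star_dotProduct_self (v : Fin d → ℂ) : star v ⬝ᵥ v = ((∑ j, ‖v j‖ ^ 2 : ℝ) : ℂ) := by
  simp only [dotProduct, Pi.star_apply, RCLike.star_def, Complex.conj_mul']
  push_cast
  rfl

/-- The quadratic form of the imaginary part of the width matrix is `|Q⁻¹u|²`. -/
lemma IsSymplectic.dotProduct_imWidth (hF : IsSymplectic F) {u : Fin d → ℝ} {w : Fin d → ℂ}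
    (hw : posFrame F *ᵥ w = fun j => (u j : ℂ)) :
    u ⬝ᵥ (imWidth F *ᵥ u) = ∑ α, ‖w α‖ ^ 2 := by
  have h : ((u ⬝ᵥ (imWidth F *ᵥ u) : ℝ) : ℂ) = ((∑ α, ‖w α‖ ^ 2 : ℝ) : ℂ) := by
    rw [← star_dotProduct_self]
    have e : ((u ⬝ᵥ (imWidth F *ᵥ u) : ℝ) : ℂ) = star (posFrame F *ᵥ w) ⬝ᵥ
        ((imWidth F).map Complex.ofReal *ᵥ (posFrame F *ᵥ w)) := by
      rw [hw, ofReal_mulVec]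
      simp [dotProduct]
    rw [e, Matrix.star_mulVec, ← Matrix.dotProduct_mulVec, Matrix.mulVec_mulVec,
      Matrix.mulVec_mulVec, hF.frame_imWidth, Matrix.one_mulVec]
  exact_mod_cast h

/-- If `|Q|² ≤ R` in Hilbert-Schmidt norm, then `Im Γ ≥ 1/R`. -/
lemma IsSymplectic.imBoundedBelow (hF : IsSymplectic F) {R : ℝ} (hR : 0 < R)
    (hQ : ∑ j, ∑ α, ‖posFrame F j α‖ ^ 2 ≤ R) : ImBoundedBelow R⁻¹ (widthMatrix F) := by
  intro u
  set w := (posFrame F)⁻¹ *ᵥ (fun j => ((u j : ℝ) : ℂ)) with hw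
  have hQw : posFrame F *ᵥ w = fun j => ((u j : ℝ) : ℂ) := by
    rw [hw, Matrix.mulVec_mulVec, Matrix.mul_nonsing_inv _ hF.isUnit_det, Matrix.one_mulVec]
  have h1 := hF.dotProduct_imWidth (u := fun j => u j) hQw
  have h2 : (fun j => u j) ⬝ᵥ (imWidth F *ᵥ (fun j => u j)) =
      ∑ j, ∑ k, (widthMatrix F j k).im * u j * u k := by
    simp only [dotProduct, Matrix.mulVec, imWidth, Matrix.map_apply, Finset.mul_sum]
    refine Finset.sum_congr rfl fun j _ => Finset.sum_congr rfl fun k _ => ?_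
    ring
  rw [← h2, h1, inv_mul_le_iff₀ hR, EuclideanSpace.norm_sq_eq]
  calc ∑ j, ‖u j‖ ^ 2 = ∑ j, ‖(posFrame F *ᵥ w) j‖ ^ 2 := by
        refine Finset.sum_congr rfl fun j _ => ?_
        rw [hQw]; simp
    _ ≤ ∑ j, (∑ α, ‖posFrame F j α‖ ^ 2) * ∑ α, ‖w α‖ ^ 2 := by
        refine Finset.sum_le_sum fun j _ => ?_
        refine le_trans ?_ (Finset.sum_mul_sq_le_sq_mul_sq _ _ _)
        gcongr
        simp only [Matrix.mulVec, dotProduct]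
        refine (norm_sum_le _ _).trans (Finset.sum_le_sum fun α _ => ?_)
        rw [norm_mul]
    _ = (∑ j, ∑ α, ‖posFrame F j α‖ ^ 2) * ∑ α, ‖w α‖ ^ 2 := by rw [Finset.sum_mul]
    _ ≤ _ := by gcongr

open scoped MatrixOrder in
/-- A real square root `B` of the imaginary part of the width matrix. -/
lemma IsSymplectic.exists_sqrt_imWidth (hF : IsSymplectic F) :
    ∃ B : Matrix (Fin d) (Fin d) ℝ, imWidth F = Bᵀ * B ∧ IsUnit B.det := by
  have hsymm : (imWidth F)ᵀ = imWidth F := by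
    ext j k
    have := congrFun (congrFun hF.isSymm_widthMatrix j) k
    rw [Matrix.transpose_apply] at this
    simp [imWidth, this]
  have hex : ∀ u : Fin d → ℝ, ∃ w : Fin d → ℂ, posFrame F *ᵥ w = fun j => (u j : ℂ) := fun u =>
    ⟨(posFrame F)⁻¹ *ᵥ (fun j => ((u j : ℝ) : ℂ)), by
      rw [Matrix.mulVec_mulVec, Matrix.mul_nonsing_inv _ hF.isUnit_det, Matrix.one_mulVec]⟩
  have hps : (imWidth F).PosSemidef := by
    refine Matrix.PosSemidef.of_dotProduct_mulVec_nonneg ?_ fun u => ?_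
    · simpa [Matrix.IsHermitian, Matrix.conjTranspose_eq_transpose_of_trivial] using hsymm
    · obtain ⟨w, hw⟩ := hex u
      simp only [star_trivial]
      rw [hF.dotProduct_imWidth hw]
      positivity
  obtain ⟨B, hB⟩ := CStarAlgebra.nonneg_iff_eq_star_mul_self.1 hps.nonneg
  rw [Matrix.star_eq_conjTranspose, Matrix.conjTranspose_eq_transpose_of_trivial] at hB
  refine ⟨B, hB, ?_⟩
  rw [isUnit_iff_ne_zero]
  intro h0
  obtain ⟨v, hv, hBv⟩ := Matrix.exists_mulVec_eq_zero_iff.2 h0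
  obtain ⟨w, hw⟩ := hex v
  have h1 := hF.dotProduct_imWidth hw
  rw [hB, ← Matrix.mulVec_mulVec, hBv, Matrix.mulVec_zero, dotProduct_zero] at h1
  have hw0 : w = 0 := by
    funext α
    have := (Finset.sum_eq_zero_iff_of_nonneg (fun α _ => by positivity)).1 h1.symm α
      (Finset.mem_univ α)
    simpa using this
  apply hv
  funext j
  have := congrFun hw j
  rw [hw0, Matrix.mulVec_zero] at this
  simpa using this.symm

/-- With `(y, ζ) = FY` and `Γ = R + iS`, `S = BᵀB`, `Bᵀw = ζ - Ry`, one has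
`|Y|² = |By|² + |w|²`: this identifies the exponent of the Wigner function. -/
lemma IsSymplectic.norm_sq_eq (hF : IsSymplectic F) {B : Matrix (Fin d) (Fin d) ℝ}
    (hB : imWidth F = Bᵀ * B) (Y : Phase d) {w : Fin d → ℝ}
    (hw : Bᵀ *ᵥ w = fun j => F Y (Sum.inr j) - ∑ k, (widthMatrix F j k).re * F Y (Sum.inl k)) :
    ‖Y‖ ^ 2 = ∑ j, ((B *ᵥ fun k => F Y (Sum.inl k)) j) ^ 2 + ∑ j, w j ^ 2 := by
  set y : Fin d → ℝ := fun k => F Y (Sum.inl k) with hy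
  set ζ : Fin d → ℝ := fun k => F Y (Sum.inr k) with hζ
  set Q := posFrame F
  set Bc := B.map Complex.ofReal with hBc
  set v : Fin d → ℂ := fun j => Complex.I * (((B *ᵥ y) j : ℝ) : ℂ) - (w j : ℂ) with hv
  -- `Γy - ζ = Bᵀ(iBy - w)`
  have h1 : widthMatrix F *ᵥ (fun j => (y j : ℂ)) - (fun j => (ζ j : ℂ)) = Bcᵀ *ᵥ v := by
    have hS : Bᵀ *ᵥ (B *ᵥ y) = imWidth F *ᵥ y := by rw [Matrix.mulVec_mulVec, hB]
    have e1 : Bcᵀ *ᵥ v = Complex.I • (fun j => (((Bᵀ *ᵥ (B *ᵥ y)) j : ℝ) : ℂ)) -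
        fun j => (((Bᵀ *ᵥ w) j : ℝ) : ℂ) := by
      have : v = Complex.I • (fun j => (((B *ᵥ y) j : ℝ) : ℂ)) - fun j => (w j : ℂ) := by
        funext j; simp [hv]
      rw [this, Matrix.mulVec_sub, Matrix.mulVec_smul, hBc, ← Matrix.transpose_map, ofReal_mulVec,
        ofReal_mulVec]
    rw [e1, hS, hw]
    funext j
    simp only [Pi.sub_apply, Pi.smul_apply, smul_eq_mul, Matrix.mulVec, dotProduct, imWidth,
      Matrix.map_apply]
    push_cast
    rw [Finset.mul_sum]
    have : ∑ k, widthMatrix F j k * (y k : ℂ) = ∑ k, ((widthMatrix F j k).re * (y k : ℂ)) +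
        ∑ k, Complex.I * ((widthMatrix F j k).im * (y k : ℂ)) := by
      rw [← Finset.sum_add_distrib]
      refine Finset.sum_congr rfl fun k _ => ?_
      conv_lhs => rw [← Complex.re_add_im (widthMatrix F j k)]
      ring
    rw [this]
    ring
  set N := Bc * Q with hN
  have hNN : Nᴴ * N = 1 := by
    have h2 : (Bᵀ * B).map Complex.ofReal = Bcᴴ * Bc := by
      ext j k
      simp [Matrix.mul_apply, hBc]
    rw [← hF.frame_imWidth, hB, hN, Matrix.conjTranspose_mul, h2]
    simp only [Matrix.mul_assoc, Q]
  have hNv : Nᵀ *ᵥ v = fun α => -((Y (Sum.inr α) : ℝ) : ℂ) + Complex.I * ((Y (Sum.inl α) : ℝ) : ℂ) := by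
    rw [hN, Matrix.transpose_mul, ← Matrix.mulVec_mulVec, ← h1, Matrix.mulVec_sub,
      Matrix.mulVec_mulVec]
    have h3 : Qᵀ * widthMatrix F = (momFrame F)ᵀ := by
      rw [← hF.widthMatrix_mul, Matrix.transpose_mul, hF.isSymm_widthMatrix.eq]
    rw [h3]
    funext α
    rw [← hF.sum_frame Y α, Finset.sum_sub_distrib]
    simp only [Pi.sub_apply, Matrix.mulVec, dotProduct, Matrix.transpose_apply, hy, hζ, Q]
    congr 1 <;> refine Finset.sum_congr rfl fun j _ => mul_comm _ _
  have hiso : star (Nᵀ *ᵥ v) ⬝ᵥ (Nᵀ *ᵥ v) = star v ⬝ᵥ v := by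
    have h4 : (Nᵀ)ᴴ * Nᵀ = 1 := by
      have h5 : N * Nᴴ = 1 := mul_eq_one_comm.1 hNN
      have h6 : (Nᵀ)ᴴ = (Nᴴ)ᵀ := rfl
      rw [h6, ← Matrix.transpose_mul, h5, Matrix.transpose_one]
    rw [Matrix.star_mulVec, ← Matrix.dotProduct_mulVec, Matrix.mulVec_mulVec, h4,
      Matrix.one_mulVec]
  rw [star_dotProduct_self, star_dotProduct_self, hNv] at hiso
  have hiso' := Complex.ofReal_injective hiso
  have n1 : ∀ a b : ℝ, ‖-(a : ℂ) + Complex.I * b‖ ^ 2 = a ^ 2 + b ^ 2 := fun a b => by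
    rw [← Complex.normSq_eq_norm_sq, Complex.normSq_apply]; simp; ring
  have n2 : ∀ a b : ℝ, ‖Complex.I * (a : ℂ) - b‖ ^ 2 = a ^ 2 + b ^ 2 := fun a b => by
    rw [← Complex.normSq_eq_norm_sq, Complex.normSq_apply]; simp; ring
  simp only [hv, n1, n2] at hiso'
  rw [EuclideanSpace.norm_sq_eq, Fintype.sum_sum_type, ← Finset.sum_add_distrib,
    ← Finset.sum_add_distrib, ← hiso']
  refine Finset.sum_congr rfl fun j _ => ?_
  simp [add_comm]

end

section

/-! ### Expectation values in Gaussian states -/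

lemma exists_integral_comp_continuousLinearEquiv {V : Type*} [NormedAddCommGroup V]
    [NormedSpace ℝ V] [FiniteDimensional ℝ V] [MeasurableSpace V] [BorelSpace V]
    (μ : Measure V) [μ.IsAddHaarMeasure] (L : V ≃L[ℝ] V) :
    ∃ k : ℝ, ∀ g : V → ℂ, ∫ v, g (L v) ∂μ = k * ∫ v, g v ∂μ := by
  have hdet : LinearMap.det (L : V →ₗ[ℝ] V) ≠ 0 := (LinearEquiv.isUnit_det' L.toLinearEquiv).ne_zero
  refine ⟨|(LinearMap.det (L : V →ₗ[ℝ] V))⁻¹|, fun g => ?_⟩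
  have h := Measure.map_linearMap_addHaar_eq_smul_addHaar μ hdet
  have h2 : ∫ v, g v ∂(Measure.map (L : V →ₗ[ℝ] V) μ) = ∫ v, g (L v) ∂μ :=
    L.toHomeomorph.measurableEmbedding.integral_map g
  rw [← h2, h, integral_smul_measure, ENNReal.toReal_ofReal (abs_nonneg _), Complex.real_smul]

/-- The linear map of configuration space with matrix `B`. -/
def matrixMap (B : Matrix (Fin d) (Fin d) ℝ) : Conf d →ₗ[ℝ] Conf d where
  toFun v := WithLp.toLp 2 (B *ᵥ v.ofLp)
  map_add' v w := by ext j; simp [Matrix.mulVec_add]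
  map_smul' c v := by ext j; simp [Matrix.mulVec_smul]

lemma exists_matrixMap_equiv {B : Matrix (Fin d) (Fin d) ℝ} (hB : IsUnit B.det) :
    ∃ L : Conf d ≃L[ℝ] Conf d, ∀ v j, L v j = (B *ᵥ v.ofLp) j := by
  have hinj : Function.Injective (matrixMap B) := by
    intro v w h
    have h1 : B *ᵥ v.ofLp = B *ᵥ w.ofLp := congrArg WithLp.ofLp h
    have h2 := congrArg (fun u => B⁻¹ *ᵥ u) h1
    simp only [Matrix.mulVec_mulVec, Matrix.nonsing_inv_mul _ hB, Matrix.one_mulVec] at h2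
    ext j
    exact congrFun h2 j
  exact ⟨(LinearEquiv.ofInjectiveEndo (matrixMap B) hinj).toContinuousLinearEquiv, fun v j => rfl⟩

variable {ħ : ℝ} {c : ℂ} {z : Phase d} {F : Phase d →L[ℝ] Phase d}

/-- The exponent of the Wigner integrand of a Gaussian state. -/
lemma gaussPhase_sub_conj {Γ : Matrix (Fin d) (Fin d) ℂ} (hΓ : Γ.IsSymm) (u v : Conf d) :
    gaussPhase z Γ (u - (1 / 2 : ℝ) • v) - starRingEnd ℂ (gaussPhase z Γ (u + (1 / 2 : ℝ) • v)) =
      -((∑ j, v j * (z (Sum.inr j) + ∑ k, (Γ j k).re * (u k - z (Sum.inl k))) : ℝ) : ℂ) +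
      Complex.I * ((∑ j, ∑ k, (Γ j k).im * (u j - z (Sum.inl j)) * (u k - z (Sum.inl k)) +
        1 / 4 * ∑ j, ∑ k, (Γ j k).im * v j * v k : ℝ) : ℂ) := by
  have hre : ∀ j k, (Γ j k).re = (Γ k j).re := fun j k => by rw [hΓ.apply]
  have hcross : ∑ j, ∑ k, (Γ j k).re * (u j - z (Sum.inl j)) * v k =
      ∑ j, ∑ k, (Γ j k).re * v j * (u k - z (Sum.inl k)) := by
    rw [Finset.sum_comm]
    refine Finset.sum_congr rfl fun j _ => Finset.sum_congr rfl fun k _ => ?_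
    rw [hre]; ring
  have hterm : ∀ j k, Γ j k * (((u - (1 / 2 : ℝ) • v) j - z (Sum.inl j) : ℝ) : ℂ) *
        (((u - (1 / 2 : ℝ) • v) k - z (Sum.inl k) : ℝ) : ℂ) -
      starRingEnd ℂ (Γ j k * (((u + (1 / 2 : ℝ) • v) j - z (Sum.inl j) : ℝ) : ℂ) *
        (((u + (1 / 2 : ℝ) • v) k - z (Sum.inl k) : ℝ) : ℂ)) =
      2 * Complex.I * ((((Γ j k).im * (u j - z (Sum.inl j)) * (u k - z (Sum.inl k)) : ℝ) : ℂ) +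
        1 / 4 * (((Γ j k).im * v j * v k : ℝ) : ℂ)) -
      ((((Γ j k).re * (u j - z (Sum.inl j)) * v k : ℝ) : ℂ) +
        (((Γ j k).re * v j * (u k - z (Sum.inl k)) : ℝ) : ℂ)) := by
    intro j k
    obtain ⟨r, s, hrs⟩ : ∃ r s : ℝ, Γ j k = r + s * Complex.I := ⟨_, _, (Complex.re_add_im _).symm⟩
    have h1 : (Γ j k).re = r := by rw [hrs]; simp
    have h2 : (Γ j k).im = s := by rw [hrs]; simp
    rw [h1, h2, hrs, map_mul, map_mul, Complex.conj_ofReal, Complex.conj_ofReal, map_add, map_mul,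
      Complex.conj_ofReal, Complex.conj_ofReal, Complex.conj_I]
    simp
    ring
  have hquad : ∑ j, ∑ k, Γ j k * (((u - (1 / 2 : ℝ) • v) j - z (Sum.inl j) : ℝ) : ℂ) *
        (((u - (1 / 2 : ℝ) • v) k - z (Sum.inl k) : ℝ) : ℂ) -
      starRingEnd ℂ (∑ j, ∑ k, Γ j k * (((u + (1 / 2 : ℝ) • v) j - z (Sum.inl j) : ℝ) : ℂ) *
        (((u + (1 / 2 : ℝ) • v) k - z (Sum.inl k) : ℝ) : ℂ)) =
      2 * Complex.I * (((∑ j, ∑ k, (Γ j k).im * (u j - z (Sum.inl j)) * (u k - z (Sum.inl k)) : ℝ) : ℂ) +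
        1 / 4 * ((∑ j, ∑ k, (Γ j k).im * v j * v k : ℝ) : ℂ)) -
      (((∑ j, ∑ k, (Γ j k).re * (u j - z (Sum.inl j)) * v k : ℝ) : ℂ) +
        ((∑ j, ∑ k, (Γ j k).re * v j * (u k - z (Sum.inl k)) : ℝ) : ℂ)) := by
    simp only [map_sum]
    simp only [Complex.ofReal_sum, Finset.mul_sum, ← Finset.sum_sub_distrib,
      ← Finset.sum_add_distrib]
    refine Finset.sum_congr rfl fun j _ => Finset.sum_congr rfl fun k _ => ?_
    rw [← hterm]
  have hlin : ∑ j, ((z (Sum.inr j) * ((u - (1 / 2 : ℝ) • v) j - z (Sum.inl j)) : ℝ) : ℂ) -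
      starRingEnd ℂ (∑ j, ((z (Sum.inr j) * ((u + (1 / 2 : ℝ) • v) j - z (Sum.inl j)) : ℝ) : ℂ)) =
      -((∑ j, v j * z (Sum.inr j) : ℝ) : ℂ) := by
    rw [map_sum, ← Finset.sum_sub_distrib, Complex.ofReal_sum, ← Finset.sum_neg_distrib]
    refine Finset.sum_congr rfl fun j _ => ?_
    rw [Complex.conj_ofReal]
    simp
    ring
  have hlast : ∑ j, v j * (z (Sum.inr j) + ∑ k, (Γ j k).re * (u k - z (Sum.inl k))) =
      ∑ j, v j * z (Sum.inr j) + ∑ j, ∑ k, (Γ j k).re * v j * (u k - z (Sum.inl k)) := by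
    rw [← Finset.sum_add_distrib]
    refine Finset.sum_congr rfl fun j _ => ?_
    rw [mul_add, Finset.mul_sum]
    congr 1
    refine Finset.sum_congr rfl fun k _ => by ring
  rw [hcross] at hquad
  rw [hlast]
  simp only [gaussPhase]
  rw [map_add, map_mul, show starRingEnd ℂ (1 / 2 : ℂ) = 1 / 2 by
    simp [Complex.conj_ofNat]]
  push_cast at hquad hlin ⊢
  linear_combination hlin + 1 / 2 * hquad

/-- The Wigner function of a Gaussian state with width matrix `P Q⁻¹` is, up to normalization,
the image under `y ↦ z + √ħ F y` of the Gaussian `e^{-|y|²}`. -/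
lemma wigner_gaussFun (hħ : 0 < ħ) (hF : IsSymplectic F) {ψ : Conf d → ℂ}
    (hψ : ∀ x, ψ x = gaussFun ħ c z (widthMatrix F) x) :
    ∃ K : ℂ, ∀ y : Phase d, wigner ħ ψ (pos (z + √ħ • F y)) (mom (z + √ħ • F y)) =
      K * (Real.exp (-‖y‖ ^ 2) : ℝ) := by
  obtain ⟨B, hB, hBdet⟩ := hF.exists_sqrt_imWidth
  obtain ⟨L, hL⟩ := exists_matrixMap_equiv hBdet
  obtain ⟨k, hk⟩ := exists_integral_comp_continuousLinearEquiv (volume : Measure (Conf d)) L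
  set b : ℂ := ((1 / (4 * ħ) : ℝ) : ℂ) with hb
  have hb0 : 0 < b.re := by rw [hb, Complex.ofReal_re]; positivity
  have hh : (ħ : ℂ) ≠ 0 := by exact_mod_cast hħ.ne'
  refine ⟨(‖c‖ ^ 2 : ℝ) * (k * (Real.pi / b) ^ (Module.finrank ℝ (Conf d) / 2 : ℂ)), fun y => ?_⟩
  set ζ := z + √ħ • F y with hζ
  set Y := √ħ • y with hY
  have hFY : F Y = √ħ • F y := by rw [hY, map_smul]
  have hY2 : ‖Y‖ ^ 2 = ħ * ‖y‖ ^ 2 := by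
    rw [hY, norm_smul, mul_pow, Real.norm_of_nonneg (Real.sqrt_nonneg _), Real.sq_sqrt hħ.le]
  set u := pos ζ with hu
  set ξ := mom ζ with hξ
  have huj : ∀ j, u j - z (Sum.inl j) = F Y (Sum.inl j) := fun j => by
    rw [hFY]; simp [hu, hζ, pos]
  have hξj : ∀ j, ξ j = z (Sum.inr j) + F Y (Sum.inr j) := fun j => by
    rw [hFY]; simp [hξ, hζ, mom]
  set η : Fin d → ℝ := fun j => F Y (Sum.inr j) - ∑ k, (widthMatrix F j k).re * F Y (Sum.inl k)
    with hη
  set w : Conf d := WithLp.toLp 2 ((Bᵀ)⁻¹ *ᵥ η) with hw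
  have hBw : Bᵀ *ᵥ w.ofLp = η := by
    rw [hw, Matrix.mulVec_mulVec, Matrix.mul_nonsing_inv _ (by rwa [Matrix.det_transpose]),
      Matrix.one_mulVec]
  have hnorm := hF.norm_sq_eq hB Y hBw
  have hquad : ∀ v : Fin d → ℝ, ∑ j, ∑ k, (widthMatrix F j k).im * v j * v k =
      ∑ j, ((B *ᵥ v) j) ^ 2 := fun v => by
    have h1 : v ⬝ᵥ (imWidth F *ᵥ v) = (B *ᵥ v) ⬝ᵥ (B *ᵥ v) := by
      rw [hB, ← Matrix.mulVec_mulVec, Matrix.dotProduct_mulVec, Matrix.vecMul_transpose]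
    have h2 : v ⬝ᵥ (imWidth F *ᵥ v) = ∑ j, ∑ k, (widthMatrix F j k).im * v j * v k := by
      simp only [dotProduct, Matrix.mulVec, imWidth, Matrix.map_apply, Finset.mul_sum]
      refine Finset.sum_congr rfl fun j _ => Finset.sum_congr rfl fun k _ => by ring
    rw [← h2, h1]
    simp only [dotProduct, sq]
  have hLn : ∀ v, ‖L v‖ ^ 2 = ∑ j, ((B *ᵥ v.ofLp) j) ^ 2 := fun v => by
    rw [EuclideanSpace.norm_sq_eq]
    simp [hL]
  have hLw : ∀ v : Conf d, inner ℝ w (L v) = ∑ j, v j * η j := fun v => by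
    have h1 : w.ofLp ⬝ᵥ (B *ᵥ v.ofLp) = v.ofLp ⬝ᵥ (Bᵀ *ᵥ w.ofLp) := by
      rw [Matrix.dotProduct_mulVec, ← Matrix.mulVec_transpose, dotProduct_comm]
    rw [hBw] at h1
    simp only [PiLp.inner_apply, hL]
    simpa [dotProduct, mul_comm] using h1
  have hwn : ‖w‖ ^ 2 = ∑ j, w j ^ 2 := by
    rw [EuclideanSpace.norm_sq_eq]; simp
  set S : ℝ := ∑ j, ((B *ᵥ fun k => F Y (Sum.inl k)) j) ^ 2 with hS
  have hint : ∀ v : Conf d, Complex.exp (Complex.I / ħ * (inner ℝ v ξ : ℝ)) *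
      (starRingEnd ℂ (ψ (u + (1 / 2 : ℝ) • v)) * ψ (u - (1 / 2 : ℝ) • v)) =
      ((‖c‖ ^ 2 : ℝ) * (Real.exp (-S / ħ) : ℝ)) *
        Complex.exp (-b * ‖L v‖ ^ 2 + Complex.I / ħ * (inner ℝ w (L v) : ℝ)) := by
    intro v
    have hphase := gaussPhase_sub_conj (z := z) hF.isSymm_widthMatrix u v
    rw [hψ, hψ, gaussFun, gaussFun, map_mul, ← Complex.exp_conj, map_mul, map_div₀,
      Complex.conj_I, Complex.conj_ofReal]
    have hcc : starRingEnd ℂ c * c = ((‖c‖ ^ 2 : ℝ) : ℂ) := by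
      rw [mul_comm, Complex.mul_conj, Complex.normSq_eq_norm_sq]
    calc _ = (starRingEnd ℂ c * c) * (Complex.exp (Complex.I / ħ * (inner ℝ v ξ : ℝ)) *
          (Complex.exp (-Complex.I / ħ * starRingEnd ℂ
            (gaussPhase z (widthMatrix F) (u + (1 / 2 : ℝ) • v))) *
          Complex.exp (Complex.I / ħ * gaussPhase z (widthMatrix F) (u - (1 / 2 : ℝ) • v)))) := by
          ring
      _ = _ := by
        rw [hcc, mul_assoc, Complex.ofReal_exp, ← Complex.exp_add, ← Complex.exp_add,
          ← Complex.exp_add]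
        congr 2
        have hS' : ∑ j, ∑ k, (widthMatrix F j k).im * (u j - z (Sum.inl j)) *
            (u k - z (Sum.inl k)) = S := by
          simp only [huj]
          exact hquad fun k => F Y (Sum.inl k)
        rw [hS', hquad v.ofLp, ← hLn v] at hphase
        have hlin : inner ℝ v ξ - ∑ j, v j * (z (Sum.inr j) +
            ∑ k, (widthMatrix F j k).re * (u k - z (Sum.inl k))) = inner ℝ w (L v) := by
          rw [hLw]
          simp only [PiLp.inner_apply, huj, hξj, hη]
          rw [← Finset.sum_sub_distrib]
          refine Finset.sum_congr rfl fun j _ => ?_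
          simp
          ring
        have hlin' := congrArg Complex.ofReal hlin
        rw [Complex.ofReal_sub] at hlin'
        rw [← hlin', hb]
        push_cast at hphase ⊢
        field_simp
        linear_combination (4 * Complex.I) * hphase + (4 * S + ‖L v‖ ^ 2) * Complex.I_sq
  rw [wigner]
  simp_rw [hint]
  rw [integral_const_mul, hk (fun v => Complex.exp (-b * ‖v‖ ^ 2 + Complex.I / ħ *
    (inner ℝ w v : ℝ))), GaussianFourier.integral_cexp_neg_mul_sq_norm_add hb0]
  have hfin : (Real.exp (-‖y‖ ^ 2) : ℝ) = Real.exp (-S / ħ) * Real.exp (-‖w‖ ^ 2 / ħ) := by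
    rw [← Real.exp_add]
    congr 1
    rw [hY2] at hnorm
    rw [hwn]
    field_simp
    linarith
  rw [hfin]
  have hexp : Complex.exp ((Complex.I / ħ) ^ 2 * ‖w‖ ^ 2 / (4 * b)) =
      ((Real.exp (-‖w‖ ^ 2 / ħ) : ℝ) : ℂ) := by
    rw [Complex.ofReal_exp]
    congr 1
    rw [hb, div_pow, Complex.I_sq]
    push_cast
    field_simp
  rw [hexp]
  push_cast
  ring

end

section

/-! ### Expectation values in Gaussian states as averages over phase space -/

/-- The map `(u, ξ) ↦ phasePoint u ξ` identifies `ℝ^d × ℝ^d` and `ℝ^{2d}` as measure spaces. -/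
lemma measurePreserving_phasePoint :
    MeasurePreserving (fun p : Conf d × Conf d => phasePoint p.1 p.2) := by
  have h1 : MeasurePreserving (Prod.map (@WithLp.ofLp 2 (Fin d → ℝ)) (@WithLp.ofLp 2 (Fin d → ℝ)))
      (volume.prod volume) (volume.prod volume) :=
    (PiLp.volume_preserving_ofLp (Fin d)).prod (PiLp.volume_preserving_ofLp (Fin d))
  have h2 := measurePreserving_sumPiEquivProdPi_symm
    (fun _ : Fin d ⊕ Fin d => (volume : Measure ℝ))
  have h3 := PiLp.volume_preserving_toLp (Fin d ⊕ Fin d)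
  have h := h3.comp (h2.comp h1)
  convert! h using 1

lemma measurableEmbedding_phasePoint :
    MeasurableEmbedding (fun p : Conf d × Conf d => phasePoint p.1 p.2) := by
  refine (continuous_phasePoint).measurableEmbedding ?_
  rintro ⟨u, ξ⟩ ⟨u', ξ'⟩ h
  have h1 := congrArg pos h
  have h2 := congrArg mom h
  simp only [pos_phasePoint, mom_phasePoint] at h1 h2
  rw [h1, h2]

lemma integral_integral_phasePoint {G : Phase d → ℂ} (hG : Integrable G) :
    ∫ ξ, ∫ u, G (phasePoint u ξ) = ∫ ζ, G ζ := by
  rw [← measurePreserving_phasePoint.integral_comp measurableEmbedding_phasePoint]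
  exact (integral_prod_symm (fun p : Conf d × Conf d => G (phasePoint p.1 p.2))
    ((measurePreserving_phasePoint.integrable_comp_emb measurableEmbedding_phasePoint).2 hG)).symm

lemma IsSymplectic.exists_equiv {F : Phase d →L[ℝ] Phase d} (hF : IsSymplectic F) :
    ∃ L : Phase d ≃L[ℝ] Phase d, ∀ y, L y = F y := by
  have hinj : Function.Injective (F : Phase d →ₗ[ℝ] Phase d) := by
    rw [← LinearMap.ker_eq_bot, LinearMap.ker_eq_bot']
    intro v hv
    have hv' : F v = 0 := hv
    have h : ∀ w, inner ℝ v (poisson d w) = 0 := fun w => by rw [← hF v w, hv', inner_zero_left]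
    have h2 : poisson d (-poisson d v) = v := by
      ext i
      cases i <;> simp [poisson, phasePoint, pos, mom]
    rw [← inner_self_eq_zero (𝕜 := ℝ)]
    nth_rewrite 2 [← h2]
    exact h _
  exact ⟨(LinearEquiv.ofInjectiveEndo _ hinj).toContinuousLinearEquiv, fun y => rfl⟩

lemma integrable_exp_neg_sq_smul {E : Type*} [NormedAddCommGroup E] [NormedSpace ℝ E]
    {g : Phase d → E} (hg : AEStronglyMeasurable g) {C : ℝ} {M : ℕ}
    (h : ∀ y, ‖g y‖ ≤ C * (1 + ‖y‖) ^ M) :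
    Integrable (fun y : Phase d => Real.exp (-‖y‖ ^ 2) • g y) := by
  have hC : 0 ≤ C := by simpa using (norm_nonneg _).trans (h 0)
  refine integrable_of_decay (K := 2 * d + 1) (by simp; omega)
    (Continuous.aestronglyMeasurable (by fun_prop) |>.smul hg)
    (C := C * Real.exp (((2 * d + 1 + M : ℕ) : ℝ) ^ 2 / (4 * 1))) fun y => ?_
  rw [norm_smul, Real.norm_of_nonneg (Real.exp_nonneg _)]
  calc (1 + ‖y‖) ^ (2 * d + 1) * (Real.exp (-‖y‖ ^ 2) * ‖g y‖)
      ≤ (1 + ‖y‖) ^ (2 * d + 1) * (Real.exp (-‖y‖ ^ 2) * (C * (1 + ‖y‖) ^ M)) := by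
        gcongr; exact h y
    _ = C * ((1 + ‖y‖) ^ (2 * d + 1 + M) * Real.exp (-1 * ‖y‖ ^ 2)) := by
        rw [pow_add]; ring_nf
    _ ≤ _ := by
        gcongr
        exact one_add_pow_mul_exp_neg_sq_le one_pos _ (norm_nonneg y)

lemma one_add_norm_affine_le (z : Phase d) (A : Phase d →L[ℝ] Phase d) (y : Phase d) :
    1 + ‖z + A y‖ ≤ (1 + ‖z‖) * (1 + ‖A‖) * (1 + ‖y‖) := by
  have h1 := norm_add_le z (A y)
  have h2 := A.le_opNorm y
  have : 0 ≤ ‖z‖ * ‖A‖ * ‖y‖ := by positivity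
  nlinarith [norm_nonneg z, norm_nonneg A, norm_nonneg y, mul_nonneg (norm_nonneg z) (norm_nonneg A),
    mul_nonneg (norm_nonneg z) (norm_nonneg y)]

/-- The average of `a(z + A y)` with respect to the Gaussian probability measure
`π^{-d} e^{-|y|²} dy` of phase space. -/
def gaussAvg (a : Phase d → ℝ) (z : Phase d) (A : Phase d →L[ℝ] Phase d) : ℝ :=
  (Real.pi ^ d)⁻¹ * ∫ y : Phase d, Real.exp (-‖y‖ ^ 2) * a (z + A y)

lemma integral_exp_neg_sq : ∫ y : Phase d, Real.exp (-‖y‖ ^ 2) = Real.pi ^ d := by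
  have h := GaussianFourier.integral_rexp_neg_mul_sq_norm (V := Phase d) one_pos
  simp only [neg_mul, one_mul, div_one] at h
  rw [h, ← Real.rpow_natCast]
  congr 1
  simp

lemma gaussAvg_const (r : ℝ) (z : Phase d) (A : Phase d →L[ℝ] Phase d) :
    gaussAvg (fun _ => r) z A = r := by
  rw [gaussAvg, integral_mul_const, integral_exp_neg_sq, inv_mul_cancel_left₀ (by positivity)]

lemma IsPolySymbol.integrable_exp_mul {M : ℕ} {a : Phase d → ℝ} (ha : IsPolySymbol M a)
    (z : Phase d) (A : Phase d →L[ℝ] Phase d) :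
    Integrable (fun y : Phase d => Real.exp (-‖y‖ ^ 2) * a (z + A y)) := by
  obtain ⟨C, hC, h⟩ := ha.exists_bound 0
  have hc := ha.1.continuous
  refine integrable_exp_neg_sq_smul (C := C * ((1 + ‖z‖) * (1 + ‖A‖)) ^ M) (M := M)
    (Continuous.aestronglyMeasurable (by fun_prop)) fun y => ?_
  have h1 := h (z + A y)
  rw [norm_iteratedFDeriv_zero] at h1
  refine h1.trans ?_
  rw [mul_assoc, ← mul_pow]
  gcongr
  exact one_add_norm_affine_le z A y

/-- An affine change of variables. The Jacobian `k` need not be computed: it cancels in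
`integral_conj_mul_weylQuantization_gaussFun` after comparison with the symbol `1`. -/
lemma integral_comp_affine_equiv (L : Phase d ≃L[ℝ] Phase d) (z : Phase d) {r : ℝ} (hr : 0 < r) :
    ∃ k : ℝ, ∀ G : Phase d → ℂ, Integrable (fun y => G (z + r • L y)) →
      Integrable G ∧ ∫ ζ, G ζ = k * ∫ y, G (z + r • L y) := by
  set e : Phase d ≃L[ℝ] Phase d := L.trans (ContinuousLinearEquiv.smulLeft (Units.mk0 r hr.ne'))
    with he
  have hey : ∀ y, e y = r • L y := fun y => rfl
  obtain ⟨k, hk⟩ := exists_integral_comp_continuousLinearEquiv (volume : Measure (Phase d)) e.symm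
  refine ⟨k, fun G hG => ⟨?_, ?_⟩⟩
  · have h1 : Integrable (fun y => G (z + y)) := by
      have hdet : LinearMap.det (e.symm : Phase d →ₗ[ℝ] Phase d) ≠ 0 :=
        (LinearEquiv.isUnit_det' e.symm.toLinearEquiv).ne_zero
      have hmap := Measure.map_linearMap_addHaar_eq_smul_addHaar (volume : Measure (Phase d)) hdet
      have h2 : Integrable (fun y => G (z + r • L y))
          (Measure.map (e.symm : Phase d →ₗ[ℝ] Phase d) volume) := by
        rw [hmap]
        exact hG.smul_measure ENNReal.ofReal_ne_top
      have h3 := (e.symm.toHomeomorph.measurableEmbedding.integrable_map_iff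
        (μ := (volume : Measure (Phase d)))).1 h2
      refine h3.congr (Filter.Eventually.of_forall fun y => ?_)
      show G (z + r • L (e.symm y)) = G (z + y)
      rw [← hey, e.apply_symm_apply]
    have h4 := h1.comp_add_left (-z)
    simpa using h4
  · have h1 := hk (fun y => G (z + r • L y))
    rw [← h1, ← integral_add_left_eq_self G z]
    refine integral_congr_ae (Filter.Eventually.of_forall fun y => ?_)
    show G (z + y) = G (z + r • L (e.symm y))
    rw [← hey, e.apply_symm_apply]

lemma integral_conj_mul_self {f : Conf d → ℂ} :
    ∫ x, starRingEnd ℂ (f x) * f x = ((∫ x, ‖f x‖ ^ 2 : ℝ) : ℂ) := by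
  rw [← integral_complex_ofReal]
  refine integral_congr_ae (Filter.Eventually.of_forall fun x => ?_)
  simp [Complex.conj_mul']

variable {ħ : ℝ} {c : ℂ} {z : Phase d} {F : Phase d →L[ℝ] Phase d}

/-- Expectation values of Weyl operators in a Gaussian state are Gaussian averages of the
symbol. -/
lemma integral_conj_mul_weylQuantization_gaussFun (hħ : 0 < ħ) (hF : IsSymplectic F)
    {ψ : 𝓢(Conf d, ℂ)} (hψ : ∀ x, ψ x = gaussFun ħ c z (widthMatrix F) x) {M : ℕ}
    {a : Phase d → ℝ} (ha : IsPolySymbol M a) :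
    ∫ x, starRingEnd ℂ (ψ x) * weylQuantization ħ a ψ x =
      ((∫ x, ‖ψ x‖ ^ 2 : ℝ) : ℂ) * (gaussAvg a z (√ħ • F) : ℝ) := by
  obtain ⟨K, hK⟩ := wigner_gaussFun hħ hF hψ
  obtain ⟨L, hL⟩ := hF.exists_equiv
  obtain ⟨k, hk⟩ := integral_comp_affine_equiv L z (Real.sqrt_pos.2 hħ)
  have key : ∀ {M : ℕ} {a : Phase d → ℝ}, IsPolySymbol M a →
      ∫ x, starRingEnd ℂ (ψ x) * weylQuantization ħ a ψ x =
        ((((2 * Real.pi * ħ) ^ d)⁻¹ : ℝ) * (k * K * (Real.pi ^ d : ℝ))) *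
          (gaussAvg a z (√ħ • F) : ℝ) := by
    intro M a ha
    rw [integral_conj_mul_weylQuantization ha hħ]
    set G : Phase d → ℂ := fun ζ => (a ζ : ℂ) * wigner ħ ψ (pos ζ) (mom ζ) with hG
    have hGy : (fun y => G (z + √ħ • L y)) = fun y =>
        K * ((Real.exp (-‖y‖ ^ 2) * a (z + (√ħ • F) y) : ℝ) : ℂ) := by
      funext y
      simp only [hG, hL]
      rw [hK, _root_.smul_apply]
      push_cast
      ring
    have hint : Integrable (fun y => G (z + √ħ • L y)) := by
      rw [hGy]
      exact (ha.integrable_exp_mul z (√ħ • F)).ofReal.const_mul K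
    obtain ⟨h1, h2⟩ := hk G hint
    have h3 : ∫ ξ, ∫ u, (a (phasePoint u ξ) : ℂ) * wigner ħ ψ u ξ = ∫ ζ, G ζ := by
      rw [← integral_integral_phasePoint h1]
      simp [hG]
    rw [h3, h2, hGy, integral_const_mul, integral_complex_ofReal, gaussAvg]
    push_cast
    have : (Real.pi : ℂ) ≠ 0 := by exact_mod_cast Real.pi_ne_zero
    field_simp
  have hone := key (isPolySymbol_const (d := d) 1)
  rw [gaussAvg_const] at hone
  simp only [weylQuantization_one hħ] at hone
  rw [key ha, ← integral_conj_mul_self, hone]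
  simp

lemma inner_toL2_eq {ψ : 𝓢(Conf d, ℂ)} {f : Conf d → ℂ} {v : L2 d} (hv : v =ᵐ[volume] f) :
    inner ℂ (toL2 ψ) v = ∫ x, starRingEnd ℂ (ψ x) * f x := by
  rw [L2.inner_def]
  refine integral_congr_ae ?_
  filter_upwards [hv, ψ.coeFn_toLp 2 volume] with x h1 h2
  rw [toL2, h2, h1, RCLike.inner_apply, mul_comm]

lemma norm_toL2_sq (ψ : 𝓢(Conf d, ℂ)) : ‖toL2 ψ‖ ^ 2 = ∫ x, ‖ψ x‖ ^ 2 := by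
  have h := inner_toL2_eq (ψ := ψ) (v := toL2 ψ) (ψ.coeFn_toLp 2 volume)
  rw [inner_self_eq_norm_sq_to_K, integral_conj_mul_self] at h
  exact Complex.ofReal_injective (by push_cast at h ⊢; exact h)

lemma IsPolySymbol.exists_L2 {M : ℕ} {a : Phase d → ℝ} (ha : IsPolySymbol M a) (hħ : 0 < ħ)
    (ψ : 𝓢(Conf d, ℂ)) : ∃ v : L2 d, v =ᵐ[volume] weylQuantization ħ a ψ :=
  ⟨(ha.memLp_weylQuantization hħ ψ).toLp _, (ha.memLp_weylQuantization hħ ψ).coeFn_toLp⟩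

lemma inner_weylQuantization_gaussFun (hħ : 0 < ħ) (hF : IsSymplectic F)
    {ψ : 𝓢(Conf d, ℂ)} (hψ : ∀ x, ψ x = gaussFun ħ c z (widthMatrix F) x) {M : ℕ}
    {a : Phase d → ℝ} (ha : IsPolySymbol M a) {v : L2 d}
    (hv : v =ᵐ[volume] weylQuantization ħ a ψ) :
    inner ℂ (toL2 ψ) v = ((‖toL2 ψ‖ ^ 2 * gaussAvg a z (√ħ • F) : ℝ) : ℂ) := by
  rw [inner_toL2_eq hv, integral_conj_mul_weylQuantization_gaussFun hħ hF hψ ha, norm_toL2_sq]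
  push_cast
  rfl

end

section

/-! ### The Schrödinger equation in `L²` and uniqueness of the propagated state -/

lemma norm_L2_sq (f : L2 d) : ‖f‖ ^ 2 = ∫ x, ‖f x‖ ^ 2 := by
  have h : inner ℂ f f = ((∫ x, ‖f x‖ ^ 2 : ℝ) : ℂ) := by
    rw [L2.inner_def, ← integral_complex_ofReal]
    refine integral_congr_ae (Filter.Eventually.of_forall fun x => ?_)
    simp [inner_self_eq_norm_sq_to_K]
  rw [inner_self_eq_norm_sq_to_K] at h
  exact Complex.ofReal_injective (by push_cast at h ⊢; exact h)

/-- A pointwise time derivative which is dominated, uniformly in time, by an integrable power of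
`1 + |x|` is a derivative in `L²`. -/
lemma hasDerivWithinAt_toL2 {T : ℝ} {ψ : ℝ → 𝓢(Conf d, ℂ)} {D : ℝ → Conf d → ℂ} {C : ℝ}
    (hD : ∀ s ∈ Set.Icc 0 T, ∀ x, HasDerivWithinAt (fun s => ψ s x) (D s x) (Set.Icc 0 T) s)
    (hC : ∀ s ∈ Set.Icc 0 T, ∀ x, (1 + ‖x‖) ^ (d + 1) * ‖D s x‖ ≤ C) {t : ℝ}
    (ht : t ∈ Set.Icc 0 T) {v : L2 d} (hv : v =ᵐ[volume] D t) :
    HasDerivWithinAt (fun s => toL2 (ψ s)) v (Set.Icc 0 T) t := by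
  have hC0 : 0 ≤ C := (by positivity : (0 : ℝ) ≤ (1 + ‖(0 : Conf d)‖) ^ (d + 1) * ‖D t 0‖).trans
    (hC t ht 0)
  have hDb : ∀ s ∈ Set.Icc 0 T, ∀ x, ‖D s x‖ ≤ C * ((1 + ‖x‖) ^ (d + 1))⁻¹ := fun s hs x => by
    rw [← div_eq_mul_inv, le_div_iff₀ (by positivity), mul_comm]
    exact hC s hs x
  rw [hasDerivWithinAt_iff_tendsto_slope, tendsto_iff_norm_sub_tendsto_zero]
  have hsq : Filter.Tendsto (fun s => ‖slope (fun s => toL2 (ψ s)) t s - v‖ ^ 2)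
      (nhdsWithin t (Set.Icc 0 T \ {t})) (nhds 0) := by
    have heq : ∀ s, ‖slope (fun s => toL2 (ψ s)) t s - v‖ ^ 2 =
        ∫ x, ‖slope (fun s => ψ s x) t s - D t x‖ ^ 2 := fun s => by
      rw [norm_L2_sq]
      refine integral_congr_ae ?_
      rw [slope_def_module]
      filter_upwards [hv, (ψ s).coeFn_toLp 2 volume, (ψ t).coeFn_toLp 2 volume,
        Lp.coeFn_sub ((s - t)⁻¹ • (toL2 (ψ s) - toL2 (ψ t))) v,
        Lp.coeFn_smul (s - t)⁻¹ (toL2 (ψ s) - toL2 (ψ t)),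
        Lp.coeFn_sub (toL2 (ψ s)) (toL2 (ψ t))] with x h1 h2 h3 h4 h5 h6
      rw [h4, Pi.sub_apply, h5, Pi.smul_apply, h6, Pi.sub_apply, toL2, toL2, h1, h2, h3,
        slope_def_module]
    simp_rw [heq]
    have hz : ∫ _ : Conf d, (0 : ℝ) = 0 := by simp
    suffices hlim : Filter.Tendsto
        (fun s => ∫ x, ‖slope (fun s => ψ s x) t s - D t x‖ ^ 2)
        (nhdsWithin t (Set.Icc 0 T \ {t})) (nhds (∫ _ : Conf d, (0 : ℝ))) by rwa [hz] at hlim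
    refine tendsto_integral_filter_of_dominated_convergence
      (fun x : Conf d => (2 * C) ^ 2 * ((1 + ‖x‖) ^ (2 * (d + 1)))⁻¹) ?_ ?_ ?_ ?_
    · refine Filter.Eventually.of_forall fun s => ?_
      have h1 : AEStronglyMeasurable (fun x => slope (fun s => ψ s x) t s) volume := by
        simp only [slope_def_module]
        exact Continuous.aestronglyMeasurable
          (((ψ s).continuous.sub (ψ t).continuous).const_smul _)
      have h2 : AEStronglyMeasurable (D t) volume := (Lp.aestronglyMeasurable v).congr hv
      exact (h1.sub h2).norm.pow 2
    · filter_upwards [self_mem_nhdsWithin] with s hs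
      refine Filter.Eventually.of_forall fun x => ?_
      rw [Real.norm_of_nonneg (by positivity)]
      have hmv := (convex_Icc 0 T).norm_image_sub_le_of_norm_hasDerivWithin_le
        (fun r hr => hD r hr x) (fun r hr => hDb r hr x) ht hs.1
      have hst : 0 < ‖s - t‖ := norm_pos_iff.2 (sub_ne_zero.2 hs.2)
      have h1 : ‖slope (fun s => ψ s x) t s‖ ≤ C * ((1 + ‖x‖) ^ (d + 1))⁻¹ := by
        rw [slope_def_module, norm_smul, norm_inv, inv_mul_le_iff₀ hst, mul_comm]
        exact hmv
      calc _ ≤ (‖slope (fun s => ψ s x) t s‖ + ‖D t x‖) ^ 2 := by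
            gcongr
            exact norm_sub_le _ _
        _ ≤ (C * ((1 + ‖x‖) ^ (d + 1))⁻¹ + C * ((1 + ‖x‖) ^ (d + 1))⁻¹) ^ 2 := by
            gcongr
            exact hDb t ht x
        _ = _ := by
            rw [mul_comm 2 (d + 1), pow_mul, ← two_mul, ← mul_assoc, mul_pow, inv_pow]
    · exact (integrable_inv_one_add_norm_pow (by simp; omega)).const_mul _
    · refine Filter.Eventually.of_forall fun x => ?_
      have h1 := hasDerivWithinAt_iff_tendsto_slope.1 (hD t ht x)
      have h2 := (tendsto_iff_norm_sub_tendsto_zero.1 h1).pow 2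
      simpa using h2
  have h3 := hsq.sqrt
  simpa [Real.sqrt_sq] using h3

lemma eqOn_of_hasDerivWithinAt_zero {E : Type*} [NormedAddCommGroup E] [NormedSpace ℝ E] {T : ℝ}
    {f : ℝ → E} (hf : ∀ t ∈ Set.Icc 0 T, HasDerivWithinAt f 0 (Set.Icc 0 T) t) {t : ℝ}
    (ht : t ∈ Set.Icc 0 T) : f t = f 0 := by
  have h := (convex_Icc 0 T).norm_image_sub_le_of_norm_hasDerivWithin_le (C := 0) hf
    (fun r _ => by simp) (Set.left_mem_Icc.2 (ht.1.trans ht.2)) ht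
  rw [zero_mul] at h
  exact sub_eq_zero.1 (norm_le_zero_iff.1 h)

lemma conj_inv_I_mul (ħ : ℝ) : starRingEnd ℂ ((Complex.I * ħ)⁻¹) = -(Complex.I * ħ)⁻¹ := by
  rw [map_inv₀, map_mul, Complex.conj_I, Complex.conj_ofReal, neg_mul, inv_neg]

/-- The norm of a solution of the Schrödinger equation is conserved if the expectation values of
the Hamiltonian are real. -/
lemma norm_sq_eq_of_schrodinger {ħ T : ℝ} {f v : ℝ → L2 d}
    (hf : ∀ t ∈ Set.Icc 0 T, HasDerivWithinAt f ((Complex.I * ħ)⁻¹ • v t) (Set.Icc 0 T) t)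
    (hv : ∀ t ∈ Set.Icc 0 T, ∃ r : ℝ, inner ℂ (f t) (v t) = r) {t : ℝ} (ht : t ∈ Set.Icc 0 T) :
    ‖f t‖ ^ 2 = ‖f 0‖ ^ 2 := by
  have h : inner ℂ (f t) (f t) = inner ℂ (f 0) (f 0) := by
    refine eqOn_of_hasDerivWithinAt_zero (f := fun t => inner ℂ (f t) (f t)) (fun s hs => ?_) ht
    have h1 := (hf s hs).inner ℂ (hf s hs)
    obtain ⟨r, hr⟩ := hv s hs
    have hr' : inner ℂ (v s) (f s) = (r : ℂ) := by
      rw [← inner_conj_symm, hr, Complex.conj_ofReal]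
    refine h1.congr_deriv ?_
    rw [inner_smul_left, inner_smul_right, hr, hr', conj_inv_I_mul]
    ring
  rw [inner_self_eq_norm_sq_to_K, inner_self_eq_norm_sq_to_K] at h
  exact_mod_cast h

lemma exists_toL2_near (w : L2 d) {ε : ℝ} (hε : 0 < ε) : ∃ χ : 𝓢(Conf d, ℂ), ‖w - toL2 χ‖ < ε := by
  have h := SchwartzMap.denseRange_toLpCLM (E := Conf d) (F := ℂ) (p := 2)
    (μ := (volume : Measure (Conf d))) ENNReal.ofNat_ne_top
  obtain ⟨χ, hχ⟩ := h.exists_dist_lt w hε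
  exact ⟨χ, by rw [← dist_eq_norm]; exact hχ⟩

/-- Propagated states depend on time in a weakly continuous way. -/
lemma IsUnitaryPropagator.continuousWithinAt_inner {ħ T : ℝ} {h : ℝ → Phase d → ℝ}
    {U : ℝ → ℝ → (L2 d ≃ₗᵢ[ℂ] L2 d)} (hU : IsUnitaryPropagator ħ T h U) {s t : ℝ}
    (hs : s ∈ Set.Icc 0 T) (ht : t ∈ Set.Icc 0 T) (u w : L2 d) :
    ContinuousWithinAt (fun τ => inner ℂ w (U τ s u)) (Set.Icc 0 T) t := by
  rw [Metric.continuousWithinAt_iff]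
  intro ε hε
  obtain ⟨χ, hχ⟩ := exists_toL2_near w (ε := ε / (3 * (‖u‖ + 1))) (by positivity)
  have hsmall : ∀ τ, ‖inner ℂ (w - toL2 χ) (U τ s u)‖ ≤ ε / 3 := fun τ => by
    refine (norm_inner_le_norm _ _).trans ?_
    rw [LinearIsometryEquiv.norm_map]
    calc _ ≤ ε / (3 * (‖u‖ + 1)) * (‖u‖ + 1) := by gcongr; linarith
      _ = ε / 3 := by field_simp
  obtain ⟨δ, hδ, hcont⟩ := Metric.continuousWithinAt_iff.1
    (hU.schrodinger s hs u χ t ht).continuousWithinAt (ε / 3) (by positivity)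
  refine ⟨δ, hδ, fun τ hτ hd => ?_⟩
  have h1 := hcont hτ hd
  rw [dist_eq_norm] at h1 ⊢
  have heq : inner ℂ w (U τ s u) - inner ℂ w (U t s u) =
      inner ℂ (w - toL2 χ) (U τ s u) - inner ℂ (w - toL2 χ) (U t s u) +
        (inner ℂ (toL2 χ) (U τ s u) - inner ℂ (toL2 χ) (U t s u)) := by
    rw [inner_sub_left, inner_sub_left]
    ring
  rw [heq]
  have h2 := norm_add_le (inner ℂ (w - toL2 χ) (U τ s u) - inner ℂ (w - toL2 χ) (U t s u))
    (inner ℂ (toL2 χ) (U τ s u) - inner ℂ (toL2 χ) (U t s u))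
  have h3 := norm_sub_le (inner ℂ (w - toL2 χ) (U τ s u)) (inner ℂ (w - toL2 χ) (U t s u))
  linarith [hsmall τ, hsmall t]

/-- A norm preserving Schwartz solution of the Schrödinger equation is propagated by every unitary
propagator: the overlap of the two states has zero time derivative. -/
lemma IsUnitaryPropagator.apply_eq {ħ T : ℝ} {h : ℝ → Phase d → ℝ}
    {U : ℝ → ℝ → (L2 d ≃ₗᵢ[ℂ] L2 d)} (hU : IsUnitaryPropagator ħ T h U) {ψ₀ : Conf d → ℂ}
    {ψ : ℝ → 𝓢(Conf d, ℂ)} (hψ : IsSchrodingerSolution ħ T h ψ₀ ψ)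
    (hnorm : ∀ t ∈ Set.Icc 0 T, ‖toL2 (ψ t)‖ ^ 2 = ‖toL2 (ψ 0)‖ ^ 2) {t : ℝ}
    (ht : t ∈ Set.Icc 0 T) : U t 0 (toL2 (ψ 0)) = toL2 (ψ t) := by
  have h0 : (0 : ℝ) ∈ Set.Icc 0 T := Set.left_mem_Icc.2 (ht.1.trans ht.2)
  set u := toL2 (ψ 0) with hu
  have hN : ∀ s ∈ Set.Icc 0 T, HasDerivWithinAt (fun τ => inner ℂ (toL2 (ψ τ)) (U τ 0 u)) 0
      (Set.Icc 0 T) s := by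
    intro s hs
    obtain ⟨v, hv, hd⟩ := hψ.2 s hs
    have h2 := hU.schrodinger 0 h0 u (ψ s) s hs
    have hint : ∫ x, starRingEnd ℂ (weylQuantization ħ (h s) (ψ s) x) * (U s 0 u : Conf d → ℂ) x =
        inner ℂ v (U s 0 u) := by
      rw [L2.inner_def]
      refine integral_congr_ae ?_
      filter_upwards [hv] with x hx
      rw [hx, RCLike.inner_apply, mul_comm]
    rw [hint] at h2
    rw [hasDerivWithinAt_iff_tendsto_slope] at hd h2 ⊢
    set f := fun τ => toL2 (ψ τ) with hf
    have hsplit : ∀ τ, slope (fun τ => inner ℂ (toL2 (ψ τ)) (U τ 0 u)) s τ =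
        inner ℂ (slope f s τ - (Complex.I * ħ)⁻¹ • v) (U τ 0 u) +
          inner ℂ ((Complex.I * ħ)⁻¹ • v) (U τ 0 u) +
          slope (fun τ => inner ℂ (toL2 (ψ s)) (U τ 0 u)) s τ := fun τ => by
      have hr : ∀ (r : ℝ) (a b : L2 d), inner ℂ (r • a) b = (r : ℂ) * inner ℂ a b :=
        fun r a b => by
          rw [inner_smul_left_eq_star_smul]; simp
      simp only [slope_def_module, hf, inner_sub_left, hr, Complex.real_smul]
      ring
    have hA : Filter.Tendsto (fun τ => inner ℂ (slope f s τ - (Complex.I * ħ)⁻¹ • v) (U τ 0 u))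
        (nhdsWithin s (Set.Icc 0 T \ {s})) (nhds 0) := by
      have h3 := (tendsto_iff_norm_sub_tendsto_zero.1 hd).mul_const ‖u‖
      rw [zero_mul] at h3
      refine squeeze_zero_norm (fun τ => ?_) h3
      refine (norm_inner_le_norm _ _).trans ?_
      rw [LinearIsometryEquiv.norm_map]
    have hB : Filter.Tendsto (fun τ => inner ℂ ((Complex.I * ħ)⁻¹ • v) (U τ 0 u))
        (nhdsWithin s (Set.Icc 0 T \ {s})) (nhds (inner ℂ ((Complex.I * ħ)⁻¹ • v) (U s 0 u))) :=
      (hU.continuousWithinAt_inner h0 hs u _).mono_left (nhdsWithin_mono _ Set.sdiff_subset)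
    have h4 := (hA.add hB).add h2
    have hzero : 0 + inner ℂ ((Complex.I * ħ)⁻¹ • v) (U s 0 u) +
        (Complex.I * ħ)⁻¹ * inner ℂ v (U s 0 u) = 0 := by
      rw [inner_smul_left, conj_inv_I_mul]
      ring
    rw [hzero] at h4
    exact h4.congr fun τ => (hsplit τ).symm
  have h1 := eqOn_of_hasDerivWithinAt_zero hN ht
  simp only [hU.refl 0 h0, ← hu] at h1
  have h2 : ‖toL2 (ψ t) - U t 0 u‖ ^ 2 = 0 := by
    rw [@norm_sub_sq ℂ, h1, inner_self_eq_norm_sq_to_K, LinearIsometryEquiv.norm_map, hnorm t ht]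
    have : RCLike.re ((‖u‖ : ℂ) ^ 2) = ‖u‖ ^ 2 := by
      rw [← Complex.ofReal_pow]
      exact Complex.ofReal_re _
    simp only [RCLike.ofReal_eq_complex_ofReal] at this ⊢
    rw [this]
    ring
  exact (sub_eq_zero.1 (norm_eq_zero.1 (pow_eq_zero_iff two_ne_zero |>.1 h2))).symm

end

section

/-! ### Regularity of the classical flow and of its linearization -/

section Regularity
variable {V W : Type*} [NormedAddCommGroup V] [NormedSpace ℝ V] [NormedAddCommGroup W]
  [NormedSpace ℝ W] {T : ℝ}

/-- Smoothness up to the boundary of the time interval passes to derivatives in the space variable,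
because these are the restrictions of the derivative within `[0,T] × V`. -/
lemma contDiffOn_fderiv_snd (hT : 0 < T) {G : ℝ × V → W}
    (hG : ContDiffOn ℝ ∞ G (Set.Icc 0 T ×ˢ Set.univ)) :
    ContDiffOn ℝ ∞ (fun p : ℝ × V => fderiv ℝ (fun ζ => G (p.1, ζ)) p.2)
      (Set.Icc 0 T ×ˢ Set.univ) := by
  have hu : UniqueDiffOn ℝ (Set.Icc 0 T ×ˢ (Set.univ : Set V)) :=
    (uniqueDiffOn_Icc hT).prod uniqueDiffOn_univ
  have h1 : ContDiffOn ℝ ∞ (fderivWithin ℝ G (Set.Icc 0 T ×ˢ Set.univ))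
      (Set.Icc 0 T ×ˢ Set.univ) := hG.fderivWithin hu (by simp)
  have h2 : ContDiffOn ℝ ∞ (fun p : ℝ × V =>
      (fderivWithin ℝ G (Set.Icc 0 T ×ˢ Set.univ) p).comp (ContinuousLinearMap.inr ℝ ℝ V))
      (Set.Icc 0 T ×ˢ Set.univ) := h1.clm_comp contDiffOn_const
  refine h2.congr fun p hp => ?_
  have hd : HasFDerivWithinAt G (fderivWithin ℝ G (Set.Icc 0 T ×ˢ Set.univ) p)
      (Set.Icc 0 T ×ˢ Set.univ) (p.1, p.2) :=
    (hG.differentiableOn (by simp) p hp).hasFDerivWithinAt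
  have hi : HasFDerivWithinAt (fun ζ : V => (p.1, ζ)) (ContinuousLinearMap.inr ℝ ℝ V) Set.univ p.2 :=
    (hasFDerivAt_prodMk_right p.1 p.2).hasFDerivWithinAt
  have hc := hd.comp p.2 hi (fun ζ _ => ⟨hp.1, trivial⟩)
  exact (hasFDerivWithinAt_univ.1 hc).fderiv

/-- Solutions of a smooth differential equation are smooth: each derivative gained by the solution
gives the right-hand side, hence the solution, another one. -/
lemma contDiffOn_of_hasDerivWithinAt (hT : 0 < T) {f : ℝ × V → V}
    (hf : ContDiffOn ℝ ∞ f (Set.Icc 0 T ×ˢ Set.univ)) {z : ℝ → V}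
    (hz : ∀ t ∈ Set.Icc 0 T, HasDerivWithinAt z (f (t, z t)) (Set.Icc 0 T) t) :
    ContDiffOn ℝ ∞ z (Set.Icc 0 T) := by
  rw [contDiffOn_infty]
  intro n
  induction n with
  | zero =>
    exact contDiffOn_zero.2 fun t ht => (hz t ht).continuousWithinAt
  | succ n ih =>
    have hu := uniqueDiffOn_Icc hT
    push_cast
    rw [contDiffOn_succ_iff_derivWithin hu]
    refine ⟨fun t ht => (hz t ht).differentiableWithinAt, by simp, ?_⟩
    have h1 : ContDiffOn ℝ n (fun t => f (t, z t)) (Set.Icc 0 T) :=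
      (hf.of_le (by exact_mod_cast le_top)).comp (contDiffOn_id.prodMk ih)
        fun t ht => ⟨ht, trivial⟩
    exact h1.congr fun t ht => (hz t ht).derivWithin (hu t ht)

end Regularity

variable {H : ℝ → Phase d → ℝ} {T : ℝ} {z : ℝ → Phase d} {F : ℝ → Phase d →L[ℝ] Phase d} {l : ℕ}

lemma ClassicalAssumption.contDiffOn_gradient (hT : 0 < T) (hH : ClassicalAssumption l H T) :
    ContDiffOn ℝ ∞ (fun p : ℝ × Phase d => gradient (H p.1) p.2) (Set.Icc 0 T ×ˢ Set.univ) :=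
  (InnerProductSpace.toDual ℝ (Phase d)).symm.contDiff.comp_contDiffOn
    (contDiffOn_fderiv_snd hT hH.smooth)

lemma ClassicalAssumption.contDiffOn_hessian (hT : 0 < T) (hH : ClassicalAssumption l H T) :
    ContDiffOn ℝ ∞ (fun p : ℝ × Phase d => fderiv ℝ (gradient (H p.1)) p.2)
      (Set.Icc 0 T ×ˢ Set.univ) :=
  contDiffOn_fderiv_snd hT (hH.contDiffOn_gradient hT)

lemma IsHamiltonSolution.contDiffOn (hT : 0 < T) (hH : ClassicalAssumption l H T)
    (hz : IsHamiltonSolution H T z) : ContDiffOn ℝ ∞ z (Set.Icc 0 T) :=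
  contDiffOn_of_hasDerivWithinAt hT
    ((poisson d).contDiff.comp_contDiffOn (hH.contDiffOn_gradient hT)) hz

lemma IsHamiltonSolution.contDiffOn_gradient (hT : 0 < T) (hH : ClassicalAssumption l H T)
    (hz : IsHamiltonSolution H T z) :
    ContDiffOn ℝ ∞ (fun t => gradient (H t) (z t)) (Set.Icc 0 T) :=
  (hH.contDiffOn_gradient hT).comp (contDiffOn_id.prodMk (hz.contDiffOn hT hH))
    fun _ ht => ⟨ht, trivial⟩

lemma IsHamiltonSolution.contDiffOn_value (hT : 0 < T) (hH : ClassicalAssumption l H T)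
    (hz : IsHamiltonSolution H T z) : ContDiffOn ℝ ∞ (fun t => H t (z t)) (Set.Icc 0 T) :=
  hH.smooth.comp (contDiffOn_id.prodMk (hz.contDiffOn hT hH)) fun _ ht => ⟨ht, trivial⟩

lemma IsHamiltonSolution.contDiffOn_hessianAlong (hT : 0 < T) (hH : ClassicalAssumption l H T)
    (hz : IsHamiltonSolution H T z) : ContDiffOn ℝ ∞ (hessianAlong H z) (Set.Icc 0 T) :=
  (hH.contDiffOn_hessian hT).comp (contDiffOn_id.prodMk (hz.contDiffOn hT hH))
    fun _ ht => ⟨ht, trivial⟩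

lemma IsLinearizedFlow.contDiffOn (hT : 0 < T) (hH : ClassicalAssumption l H T)
    (hz : IsHamiltonSolution H T z) (hF : IsLinearizedFlow H z T F) :
    ContDiffOn ℝ ∞ F (Set.Icc 0 T) := by
  refine contDiffOn_of_hasDerivWithinAt hT
    (f := fun p : ℝ × (Phase d →L[ℝ] Phase d) => (poisson d ∘L hessianAlong H z p.1) ∘L p.2) ?_ hF.2
  exact ((contDiffOn_const.clm_comp ((hz.contDiffOn_hessianAlong hT hH).comp contDiffOn_fst
    fun p hp => hp.1))).clm_comp contDiffOn_snd

lemma ClassicalAssumption.contDiff (hH : ClassicalAssumption l H T) {t : ℝ}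
    (ht : t ∈ Set.Icc 0 T) : ContDiff ℝ ∞ (H t) := by
  obtain ⟨m, -, hm⟩ := hH.symbol
  exact (hm t ht).1

lemma inner_fderiv_gradient_comm {f : Phase d → ℝ} (hf : ContDiff ℝ ∞ f) (ζ v w : Phase d) :
    inner ℝ (fderiv ℝ (gradient f) ζ v) w = inner ℝ (fderiv ℝ (gradient f) ζ w) v := by
  have hd : ContDiff ℝ ∞ (fderiv ℝ f) := hf.fderiv_right (by simp)
  have hg : ContDiff ℝ ∞ (gradient f) := (InnerProductSpace.toDual ℝ (Phase d)).symm.contDiff.comp hd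
  have h : ∀ v w, inner ℝ (fderiv ℝ (gradient f) ζ v) w = fderiv ℝ (fderiv ℝ f) ζ v w := by
    intro v w
    have h1 := ((hg.differentiable (by simp)) ζ).hasFDerivAt.inner ℝ (hasFDerivAt_const w ζ)
    have h2 := ((hd.differentiable (by simp)) ζ).hasFDerivAt.clm_apply (hasFDerivAt_const w ζ)
    have h3 : (fun y => inner ℝ (gradient f y) w) = fun y => fderiv ℝ f y w := by
      funext y
      exact InnerProductSpace.toDual_symm_apply
    rw [h3] at h1
    have h4 := congrArg (fun L => L v) (h1.unique h2)
    simpa using h4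
  rw [h, h]
  refine (hf.contDiffAt.isSymmSndFDerivAt ?_) v w
  rw [minSmoothness_of_isRCLikeNormedField]
  exact WithTop.coe_le_coe.2 le_top

lemma poisson_poisson (v : Phase d) : poisson d (poisson d v) = -v := by
  ext i
  cases i <;> simp [poisson, phasePoint, pos, mom]

lemma inner_poisson_swap (v w : Phase d) :
    inner ℝ (poisson d v) w = -inner ℝ v (poisson d w) := by
  rw [real_inner_comm, inner_poisson, inner_poisson, ← Finset.sum_neg_distrib]
  exact Finset.sum_congr rfl fun j _ => by ring

/-- The linearized flow preserves the symplectic form since the Hessian is symmetric. -/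
lemma IsLinearizedFlow.isSymplectic (hH : ClassicalAssumption l H T)
    (hF : IsLinearizedFlow H z T F) {t : ℝ} (ht : t ∈ Set.Icc 0 T) : IsSymplectic (F t) := by
  intro v w
  have h : ∀ s ∈ Set.Icc 0 T, HasDerivWithinAt (fun s => inner ℝ (F s v) (poisson d (F s w))) 0
      (Set.Icc 0 T) s := by
    intro s hs
    have h1 := fun u => (hF.2 s hs).clm_apply (hasDerivWithinAt_const s (Set.Icc 0 T) u)
    have h2 := (h1 v).inner ℝ ((poisson d).hasFDerivAt.comp_hasDerivWithinAt s (h1 w))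
    refine h2.congr_deriv ?_
    simp only [map_zero, add_zero, ContinuousLinearMap.comp_apply, poisson_poisson,
      inner_poisson_swap, inner_neg_right, Function.comp_apply, neg_neg]
    rw [hessianAlong, inner_fderiv_gradient_comm (hH.contDiff hs), real_inner_comm]
    ring
  have h2 := eqOn_of_hasDerivWithinAt_zero h ht
  simpa [hF.1] using h2

end

section

/-! ### The Riccati equation for the width matrix -/

/-- The images under `F` of the complex frame `e_α + i f_α`; its two blocks are `posFrame F` and
`momFrame F`. -/
def frame (F : Phase d →L[ℝ] Phase d) : Matrix (Fin d ⊕ Fin d) (Fin d) ℂ :=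
  Matrix.of fun i α => (entry F i (Sum.inl α) : ℂ) + Complex.I * entry F i (Sum.inr α)

/-- The frame `(1; Γ)` of the graph of `Γ`. -/
def graphFrame (Γ : Matrix (Fin d) (Fin d) ℂ) : Matrix (Fin d ⊕ Fin d) (Fin d) ℂ :=
  Matrix.of fun i k => Sum.elim (fun j => if j = k then (1 : ℂ) else 0) (fun j => Γ j k) i

/-- The complex matrix of a linear map of phase space. -/
def complexMatrix (A : Phase d →L[ℝ] Phase d) : Matrix (Fin d ⊕ Fin d) (Fin d ⊕ Fin d) ℂ :=
  Matrix.of fun i j => (entry A i j : ℂ)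

lemma frame_comp (A F : Phase d →L[ℝ] Phase d) : frame (A ∘L F) = complexMatrix A * frame F := by
  ext i α
  simp only [frame, complexMatrix, Matrix.mul_apply, Matrix.of_apply]
  have h : ∀ b, entry (A ∘L F) i b = ∑ k, entry A i k * entry F k b := fun b => by
    simp only [entry, ContinuousLinearMap.comp_apply]
    exact apply_eq_sum_entry A _ i
  rw [h, h]
  push_cast
  rw [Finset.mul_sum, ← Finset.sum_add_distrib]
  exact Finset.sum_congr rfl fun k _ => by ring

lemma IsSymplectic.frame_eq {F : Phase d →L[ℝ] Phase d} (hF : IsSymplectic F) :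
    frame F = graphFrame (widthMatrix F) * posFrame F := by
  ext i α
  cases i with
  | inl j => simp [graphFrame, Matrix.mul_apply, frame, posFrame]
  | inr j =>
    have h := congrFun (congrFun hF.widthMatrix_mul j) α
    rw [Matrix.mul_apply] at h
    simp only [graphFrame, Matrix.mul_apply, Matrix.of_apply, Sum.elim_inr]
    rw [h]
    rfl

/-- The right-hand side of the Riccati equation for the graph matrix transported by a linear flow
with generator `A`. -/
def riccati (A : Phase d →L[ℝ] Phase d) (Γ : Matrix (Fin d) (Fin d) ℂ) (j k : Fin d) : ℂ :=
  (complexMatrix A * graphFrame Γ) (Sum.inr j) k -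
    ∑ m, Γ j m * (complexMatrix A * graphFrame Γ) (Sum.inl m) k

lemma HasDerivWithinAt.mul_of_eq_zero {f g : ℝ → ℂ} {f' : ℂ} {S : Set ℝ} {t : ℝ}
    (hf : HasDerivWithinAt f f' S t) (h0 : f t = 0) (hg : ContinuousWithinAt g S t) :
    HasDerivWithinAt (fun s => f s * g s) (f' * g t) S t := by
  rw [hasDerivWithinAt_iff_tendsto_slope] at hf ⊢
  have hg' := hg.mono_left (nhdsWithin_mono t (Set.sdiff_subset (s := S) (t := {t})))
  refine (hf.mul hg').congr fun s => ?_
  rw [slope_def_module, slope_def_module, h0]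
  simp [mul_assoc]

lemma hasDerivWithinAt_entry {F : ℝ → Phase d →L[ℝ] Phase d} {F' : Phase d →L[ℝ] Phase d}
    {S : Set ℝ} {t : ℝ} (hF : HasDerivWithinAt F F' S t) (i j : Fin d ⊕ Fin d) :
    HasDerivWithinAt (fun s => entry (F s) i j) (entry F' i j) S t := by
  have h1 := hF.clm_apply (hasDerivWithinAt_const t S (EuclideanSpace.single j (1 : ℝ)))
  have h2 := (EuclideanSpace.proj (𝕜 := ℝ) i).hasFDerivAt.comp_hasDerivWithinAt t h1
  simpa [entry, Function.comp_def] using h2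

lemma hasDerivWithinAt_frame {F : ℝ → Phase d →L[ℝ] Phase d} {F' : Phase d →L[ℝ] Phase d}
    {S : Set ℝ} {t : ℝ} (hF : HasDerivWithinAt F F' S t) (i : Fin d ⊕ Fin d) (α : Fin d) :
    HasDerivWithinAt (fun s => frame (F s) i α) (frame F' i α) S t :=
  (hasDerivWithinAt_entry hF i (Sum.inl α)).ofReal_comp.add
    ((hasDerivWithinAt_entry hF i (Sum.inr α)).ofReal_comp.const_mul Complex.I)

lemma continuousWithinAt_inv_entry {Q : ℝ → Matrix (Fin d) (Fin d) ℂ} {S : Set ℝ} {t : ℝ}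
    (hQ : ∀ j α, ContinuousWithinAt (fun s => Q s j α) S t) (hdet : IsUnit (Q t).det)
    (α k : Fin d) : ContinuousWithinAt (fun s => (Q s)⁻¹ α k) S t := by
  have h1 : ContinuousWithinAt Q S t :=
    continuousWithinAt_pi.2 fun j => continuousWithinAt_pi.2 fun α => hQ j α
  have h2 : ContinuousWithinAt (fun s => (Q s).det) S t :=
    (continuous_id.matrix_det).continuousAt.comp_continuousWithinAt h1
  have h3 : ContinuousWithinAt (fun s => (Q s).adjugate α k) S t :=
    ((continuous_id.matrix_adjugate).matrix_elem α k).continuousAt.comp_continuousWithinAt h1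
  have h4 := (h2.inv₀ hdet.ne_zero).mul h3
  refine h4.congr (fun s _ => ?_) ?_ <;>
  simp [Matrix.inv_def, Ring.inverse_eq_inv']

/-- The width matrix `Γ = P Q⁻¹` solves the Riccati equation. Writing
`Γ(s) - Γ(t) = (P(s) - Γ(t) Q(s)) Q(s)⁻¹`, whose first factor vanishes at `s = t`, avoids
differentiating the matrix inverse: only its continuity is needed. -/
lemma hasDerivWithinAt_widthMatrix {F : ℝ → Phase d →L[ℝ] Phase d} {A : Phase d →L[ℝ] Phase d}
    {S : Set ℝ} {t : ℝ} (hF : HasDerivWithinAt F (A ∘L F t) S t)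
    (hsymp : ∀ s ∈ S, IsSymplectic (F s)) (ht : t ∈ S) (j k : Fin d) :
    HasDerivWithinAt (fun s => widthMatrix (F s) j k) (riccati A (widthMatrix (F t)) j k) S t := by
  set Γ := widthMatrix (F t) with hΓ
  have hfr := hasDerivWithinAt_frame hF
  have hR : ∀ α, HasDerivWithinAt (fun s => frame (F s) (Sum.inr j) α -
      ∑ m, Γ j m * frame (F s) (Sum.inl m) α) (frame (A ∘L F t) (Sum.inr j) α -
      ∑ m, Γ j m * frame (A ∘L F t) (Sum.inl m) α) S t := fun α =>
    (hfr (Sum.inr j) α).sub (HasDerivWithinAt.fun_sum fun m _ =>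
      (hfr (Sum.inl m) α).const_mul (Γ j m))
  have hR0 : ∀ α, frame (F t) (Sum.inr j) α - ∑ m, Γ j m * frame (F t) (Sum.inl m) α = 0 :=
    fun α => by
      have h := congrFun (congrFun (hsymp t ht).widthMatrix_mul j) α
      rw [Matrix.mul_apply] at h
      exact sub_eq_zero.2 h.symm
  have hQ : ∀ α, ContinuousWithinAt (fun s => (posFrame (F s))⁻¹ α k) S t := fun α =>
    continuousWithinAt_inv_entry (fun j α => (hfr (Sum.inl j) α).continuousWithinAt)
      (hsymp t ht).isUnit_det α k
  have hsum : HasDerivWithinAt (fun s => ∑ α, (frame (F s) (Sum.inr j) α -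
      ∑ m, Γ j m * frame (F s) (Sum.inl m) α) * (posFrame (F s))⁻¹ α k)
      (∑ α, (frame (A ∘L F t) (Sum.inr j) α -
      ∑ m, Γ j m * frame (A ∘L F t) (Sum.inl m) α) * (posFrame (F t))⁻¹ α k) S t :=
    HasDerivWithinAt.fun_sum fun α _ => (hR α).mul_of_eq_zero (hR0 α) (hQ α)
  have heq : ∀ s ∈ S, widthMatrix (F s) j k = ∑ α, (frame (F s) (Sum.inr j) α -
      ∑ m, Γ j m * frame (F s) (Sum.inl m) α) * (posFrame (F s))⁻¹ α k + Γ j k := by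
    intro s hs
    have h1 : (Γ * posFrame (F s)) * (posFrame (F s))⁻¹ = Γ := by
      rw [Matrix.mul_assoc, Matrix.mul_nonsing_inv _ (hsymp s hs).isUnit_det, Matrix.mul_one]
    have h2 : ∑ α, (∑ m, Γ j m * frame (F s) (Sum.inl m) α) * (posFrame (F s))⁻¹ α k = Γ j k := by
      conv_rhs => rw [← h1]
      simp only [Matrix.mul_apply]
      rfl
    have h3 : ∑ α, frame (F s) (Sum.inr j) α * (posFrame (F s))⁻¹ α k =
        widthMatrix (F s) j k := by
      rw [widthMatrix, Matrix.mul_apply]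
      rfl
    simp only [sub_mul, Finset.sum_sub_distrib, h2, h3]
    ring
  refine ((hsum.add_const (Γ j k)).congr heq (heq t ht)).congr_deriv ?_
  have h4 : frame (A ∘L F t) * (posFrame (F t))⁻¹ = complexMatrix A * graphFrame Γ := by
    rw [frame_comp, (hsymp t ht).frame_eq, ← Matrix.mul_assoc, Matrix.mul_assoc,
      Matrix.mul_nonsing_inv _ (hsymp t ht).isUnit_det, Matrix.mul_one]
  have h5 : ∀ i, ∑ α, frame (A ∘L F t) i α * (posFrame (F t))⁻¹ α k =
      (complexMatrix A * graphFrame Γ) i k := fun i => by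
    rw [← h4, Matrix.mul_apply]
  simp only [sub_mul, Finset.sum_sub_distrib, h5, riccati]
  congr 1
  simp only [Finset.sum_mul]
  rw [Finset.sum_comm]
  refine Finset.sum_congr rfl fun m _ => ?_
  rw [← h5, Finset.mul_sum]
  exact Finset.sum_congr rfl fun α _ => by ring

/-- For a Hamiltonian generator `J A` the Riccati equation becomes the form needed to solve the
Schrödinger equation. -/
lemma sum_riccati {Γ : Matrix (Fin d) (Fin d) ℂ} (hΓ : Γ.IsSymm) (A : Phase d →L[ℝ] Phase d)
    (z : Phase d) (x : Conf d) :
    ∑ j, ∑ k, riccati (poisson d ∘L A) Γ j k * ((x j - z (Sum.inl j) : ℝ) : ℂ) *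
          ((x k - z (Sum.inl k) : ℝ) : ℂ) =
      -∑ i, ∑ j, entry A i j * (gaussVec z Γ x i * gaussVec z Γ x j) := by
  set u : Fin d → ℂ := fun j => ((x j - z (Sum.inl j) : ℝ) : ℂ) with hu
  set V := gaussVec z Γ x with hV
  have hVl : ∀ j, V (Sum.inl j) = u j := fun j => rfl
  have hVr : ∀ j, V (Sum.inr j) = ∑ k, Γ j k * u k := fun j => rfl
  have hYu : ∀ i, ∑ k, graphFrame Γ i k * u k = V i := fun i => by
    cases i with
    | inl j => simp [graphFrame, hVl]
    | inr j => simp [graphFrame, hVr]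
  have hAY : ∀ (B : Phase d →L[ℝ] Phase d) i, ∑ k, (complexMatrix B * graphFrame Γ) i k * u k =
      ∑ b, entry B i b * V b := fun B i => by
    simp only [Matrix.mul_apply, Finset.sum_mul, complexMatrix, Matrix.of_apply, ← hYu,
      Finset.mul_sum]
    rw [Finset.sum_comm]
    exact Finset.sum_congr rfl fun b _ => Finset.sum_congr rfl fun k _ => by ring
  have hel : ∀ j b, entry (poisson d ∘L A) (Sum.inl j) b = entry A (Sum.inr j) b := fun j b => by
    simp [entry, poisson, phasePoint, mom]
  have her : ∀ j b, entry (poisson d ∘L A) (Sum.inr j) b = -entry A (Sum.inl j) b := fun j b => by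
    simp [entry, poisson, phasePoint, pos]
  have hk : ∀ j, ∑ k, riccati (poisson d ∘L A) Γ j k * u j * u k =
      u j * (-∑ b, entry A (Sum.inl j) b * V b) -
        ∑ m, u j * Γ j m * ∑ b, entry A (Sum.inr m) b * V b := fun j => by
    have h1 : ∀ k, riccati (poisson d ∘L A) Γ j k * u j * u k =
        u j * ((complexMatrix (poisson d ∘L A) * graphFrame Γ) (Sum.inr j) k * u k) -
          ∑ m, u j * Γ j m *
            ((complexMatrix (poisson d ∘L A) * graphFrame Γ) (Sum.inl m) k * u k) := fun k => by
      rw [riccati, sub_mul, sub_mul, Finset.sum_mul, Finset.sum_mul]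
      congr 1
      · ring
      · exact Finset.sum_congr rfl fun m _ => by ring
    simp only [h1, Finset.sum_sub_distrib]
    rw [← Finset.mul_sum, hAY, Finset.sum_comm]
    simp only [← Finset.mul_sum, hAY, hel, her]
    push_cast
    simp only [neg_mul, Finset.sum_neg_distrib]
  rw [Fintype.sum_sum_type]
  calc _ = ∑ j, (u j * (-∑ b, entry A (Sum.inl j) b * V b) -
        ∑ m, u j * Γ j m * ∑ b, entry A (Sum.inr m) b * V b) :=
        Finset.sum_congr rfl fun j _ => hk j
    _ = -∑ j, ∑ b, entry A (Sum.inl j) b * (V (Sum.inl j) * V b) -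
        ∑ m, ∑ b, entry A (Sum.inr m) b * (V (Sum.inr m) * V b) := by
        rw [Finset.sum_sub_distrib, Finset.sum_comm (f := fun j m => u j * Γ j m * _)]
        congr 1
        · rw [← Finset.sum_neg_distrib]
          refine Finset.sum_congr rfl fun j _ => ?_
          rw [mul_neg, Finset.mul_sum, hVl]
          congr 1
          exact Finset.sum_congr rfl fun b _ => by ring
        · refine Finset.sum_congr rfl fun m _ => ?_
          have h2 : V (Sum.inr m) = ∑ j, u j * Γ j m := by
            rw [hVr]
            refine Finset.sum_congr rfl fun j _ => ?_
            rw [hΓ.apply, mul_comm]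
          rw [← Finset.sum_mul, ← h2, Finset.mul_sum]
          exact Finset.sum_congr rfl fun b _ => by ring
    _ = _ := by ring

end

section

/-! ### The propagated coherent state -/

lemma norm_gaussVec_le {z : Phase d} {Γ : Matrix (Fin d) (Fin d) ℂ} {R : ℝ}
    (hΓ : ∀ j, ∑ k, ‖Γ j k‖ ≤ R) (hz : ∀ i, |z i| ≤ R) (hR : 0 ≤ R) (x : Conf d)
    (i : Fin d ⊕ Fin d) : ‖gaussVec z Γ x i‖ ≤ (1 + R) ^ 2 * (1 + ‖x‖) := by
  have hu : ∀ j, ‖((x j - z (Sum.inl j) : ℝ) : ℂ)‖ ≤ (1 + R) * (1 + ‖x‖) := fun j => by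
    rw [Complex.norm_real, Real.norm_eq_abs]
    have h1 : |x j - z (Sum.inl j)| ≤ |x j| + |z (Sum.inl j)| := abs_sub _ _
    have h2 := hz (Sum.inl j)
    have h3 : |x j| ≤ ‖x‖ := PiLp.norm_apply_le x j
    nlinarith [norm_nonneg x, mul_nonneg hR (norm_nonneg x)]
  cases i with
  | inl j =>
    refine (hu j).trans ?_
    gcongr
    nlinarith
  | inr j =>
    calc ‖∑ k, Γ j k * ((x k - z (Sum.inl k) : ℝ) : ℂ)‖
        ≤ ∑ k, ‖Γ j k‖ * ((1 + R) * (1 + ‖x‖)) := by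
          refine (norm_sum_le _ _).trans (Finset.sum_le_sum fun k _ => ?_)
          rw [norm_mul]
          gcongr
          exact hu k
      _ ≤ R * ((1 + R) * (1 + ‖x‖)) := by
          rw [← Finset.sum_mul]
          gcongr
          exact hΓ j
      _ ≤ _ := by nlinarith [norm_nonneg x, mul_nonneg hR (norm_nonneg x), mul_nonneg (mul_nonneg hR hR) (norm_nonneg x)]

lemma norm_gaussCov_le {Γ : Matrix (Fin d) (Fin d) ℂ} {R : ℝ}
    (hΓ : ∀ j, ∑ k, ‖Γ j k‖ ≤ R) (hR : 0 ≤ R) (i j : Fin d ⊕ Fin d) :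
    ‖gaussCov Γ i j‖ ≤ 1 + R := by
  rcases i with i | i <;> rcases j with j | j <;> simp only [gaussCov]
  · simp; linarith
  · split_ifs <;> norm_num <;> linarith
  · split_ifs <;> norm_num <;> linarith
  · have := (Finset.single_le_sum (f := fun k => ‖Γ i k‖) (fun _ _ => norm_nonneg _)
      (Finset.mem_univ j)).trans (hΓ i)
    linarith

lemma norm_weylQuantization_quadPoly_gaussFun_le {ħ : ℝ} (hħ : 0 < ħ) {c : ℂ} {z : Phase d}
    {Γ : Matrix (Fin d) (Fin d) ℂ} (hsymm : Γ.IsSymm) {ψ : 𝓢(Conf d, ℂ)}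
    (hψ : ∀ x, ψ x = gaussFun ħ c z Γ x) {h₀ : ℝ} {g : Phase d} {A : Phase d →L[ℝ] Phase d}
    {R : ℝ} (hΓ : ∀ j, ∑ k, ‖Γ j k‖ ≤ R) (hz : ∀ i, |z i| ≤ R) (hh : |h₀| ≤ R)
    (hg : ∑ i, |g i| ≤ R) (hA : ∑ i, ∑ j, |entry A i j| ≤ R) (x : Conf d) :
    ‖weylQuantization ħ (quadPoly h₀ g A z) ψ x‖ ≤
      (R + R * (1 + R) ^ 2 + R * (1 + R) ^ 4 + ħ * R * (1 + R)) * (1 + ‖x‖) ^ 2 * ‖ψ x‖ := by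
  have hR : 0 ≤ R := (abs_nonneg _).trans hh
  have hV := norm_gaussVec_le hΓ hz hR x
  set V := gaussVec z Γ x
  set W := (1 + R) ^ 2 * (1 + ‖x‖) with hW
  have hW0 : 0 ≤ W := by positivity
  rw [weylQuantization_quadPoly_gaussFun hħ hsymm hψ, norm_mul]
  gcongr
  have h1 : ‖∑ i, (g i : ℂ) * V i‖ ≤ R * W := by
    refine (norm_sum_le _ _).trans ?_
    calc _ ≤ ∑ i, |g i| * W := Finset.sum_le_sum fun i _ => by
          rw [norm_mul, Complex.norm_real, Real.norm_eq_abs]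
          gcongr
          exact hV i
      _ ≤ _ := by rw [← Finset.sum_mul]; gcongr
  have hdouble : ∀ (G : Fin d ⊕ Fin d → Fin d ⊕ Fin d → ℂ) (B : ℝ), 0 ≤ B →
      (∀ i j, ‖G i j‖ ≤ B) → ‖∑ i, ∑ j, (entry A i j : ℂ) * G i j‖ ≤ R * B := by
    intro G B hB hG
    calc _ ≤ ∑ i, ∑ j, |entry A i j| * B := by
          refine (norm_sum_le _ _).trans (Finset.sum_le_sum fun i _ => (norm_sum_le _ _).trans
            (Finset.sum_le_sum fun j _ => ?_))
          rw [norm_mul, Complex.norm_real, Real.norm_eq_abs]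
          gcongr
          exact hG i j
      _ ≤ _ := by
          simp only [← Finset.sum_mul]
          gcongr
  have h2 := hdouble (fun i j => V i * V j) (W * W) (by positivity) fun i j => by
    rw [norm_mul]
    exact mul_le_mul (hV i) (hV j) (norm_nonneg _) hW0
  have h3 := hdouble (gaussCov Γ) (1 + R) (by positivity) (norm_gaussCov_le hΓ hR)
  have h4 : ‖(h₀ : ℂ)‖ ≤ R := by rwa [Complex.norm_real]
  have h5 : ‖(1 / 2 : ℂ)‖ = 1 / 2 := by norm_num
  have h6 : ‖Complex.I * ħ / 2‖ = ħ / 2 := by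
    rw [norm_div, norm_mul, Complex.norm_I, Complex.norm_real, Real.norm_of_nonneg hħ.le]
    norm_num
  calc _ ≤ ‖(h₀ : ℂ)‖ + ‖∑ i, (g i : ℂ) * V i‖ +
        ‖(1 / 2 : ℂ)‖ * ‖∑ i, ∑ j, (entry A i j : ℂ) * (V i * V j)‖ +
        ‖Complex.I * ħ / 2‖ * ‖∑ i, ∑ j, (entry A i j : ℂ) * gaussCov Γ i j‖ := by
        rw [← norm_mul, ← norm_mul]
        exact (norm_sub_le _ _).trans (add_le_add_left
          ((norm_add_le _ _).trans (add_le_add_left (norm_add_le _ _) _)) _)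
    _ ≤ R + R * W + 1 / 2 * (R * (W * W)) + ħ / 2 * (R * (1 + R)) := by
        rw [h5, h6]
        gcongr
    _ ≤ R * (1 + ‖x‖) ^ 2 + R * (1 + R) ^ 2 * (1 + ‖x‖) ^ 2 + R * (1 + R) ^ 4 * (1 + ‖x‖) ^ 2 +
        ħ * R * (1 + R) * (1 + ‖x‖) ^ 2 := by
        have hx : 1 ≤ (1 + ‖x‖) ^ 2 := one_le_pow₀ (by linarith [norm_nonneg x])
        have hx' : (1 + ‖x‖) ≤ (1 + ‖x‖) ^ 2 := by nlinarith [norm_nonneg x]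
        have e1 : R * W ≤ R * (1 + R) ^ 2 * (1 + ‖x‖) ^ 2 := by
          rw [hW, ← mul_assoc]; gcongr
        have e2 : 1 / 2 * (R * (W * W)) ≤ R * (1 + R) ^ 4 * (1 + ‖x‖) ^ 2 := by
          have : R * (W * W) = R * (1 + R) ^ 4 * (1 + ‖x‖) ^ 2 := by rw [hW]; ring
          have h0 : 0 ≤ R * (W * W) := by positivity
          linarith
        have e3 : ħ / 2 * (R * (1 + R)) ≤ ħ * R * (1 + R) * (1 + ‖x‖) ^ 2 := by
          have h0 : 0 ≤ ħ * R * (1 + R) := by positivity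
          nlinarith
        have e4 : R ≤ R * (1 + ‖x‖) ^ 2 := le_mul_of_one_le_right hR hx
        linarith
    _ = _ := by ring

lemma exists_exp_solution {T : ℝ} (hT : 0 ≤ T) {μ : ℝ → ℂ} (hμ : ContinuousOn μ (Set.Icc 0 T))
    (c₀ : ℂ) : ∃ c : ℝ → ℂ, c 0 = c₀ ∧
      ∀ t ∈ Set.Icc 0 T, HasDerivWithinAt c (μ t * c t) (Set.Icc 0 T) t := by
  set ν : ℝ → ℂ := Set.IccExtend hT ((Set.Icc 0 T).domRestrict μ) with hν
  have hνc : Continuous ν := (continuousOn_iff_continuous_domRestrict.1 hμ).Icc_extend'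
  refine ⟨fun t => c₀ * Complex.exp (∫ s in (0 : ℝ)..t, ν s), by simp, fun t ht => ?_⟩
  have h1 := (hνc.integral_hasStrictDerivAt 0 t).hasDerivAt.cexp.const_mul c₀
  have h2 : ν t = μ t := by rw [hν, Set.IccExtend_of_mem hT _ ht]; rfl
  refine h1.hasDerivWithinAt.congr_deriv ?_
  rw [h2]
  ring

lemma frame_id_inl (j α : Fin d) :
    frame (ContinuousLinearMap.id ℝ (Phase d)) (Sum.inl j) α = if j = α then 1 else 0 := by
  by_cases h : j = α <;> simp [frame, entry, h]

lemma frame_id_inr (j α : Fin d) :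
    frame (ContinuousLinearMap.id ℝ (Phase d)) (Sum.inr j) α =
      if j = α then Complex.I else 0 := by
  by_cases h : j = α <;> simp [frame, entry, h]

lemma widthMatrix_id :
    widthMatrix (ContinuousLinearMap.id ℝ (Phase d)) = Complex.I • (1 : Matrix (Fin d) (Fin d) ℂ) := by
  have h1 : posFrame (ContinuousLinearMap.id ℝ (Phase d)) = 1 := by
    ext j α
    exact (frame_id_inl j α).trans (Matrix.one_apply).symm
  have h2 : momFrame (ContinuousLinearMap.id ℝ (Phase d)) = Complex.I • 1 := by
    ext j α
    refine (frame_id_inr j α).trans ?_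
    rw [Matrix.smul_apply, Matrix.one_apply]
    simp
  rw [widthMatrix, h1, h2, inv_one, Matrix.mul_one]

lemma coherentState_eq_gaussFun (ħ : ℝ) (z : Phase d) (x : Conf d) :
    coherentState ħ z x = gaussFun ħ ((((Real.pi * ħ) ^ (-(d : ℝ) / 4) : ℝ) : ℂ) *
      Complex.exp (Complex.I / ħ * ((inner ℝ (mom z) (pos z) / 2 : ℝ) : ℂ))) z
      (widthMatrix (ContinuousLinearMap.id ℝ (Phase d))) x := by
  have hph : gaussPhase z (Complex.I • (1 : Matrix (Fin d) (Fin d) ℂ)) x =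
      ((inner ℝ (mom z) x - inner ℝ (mom z) (pos z) : ℝ) : ℂ) +
        Complex.I / 2 * ((‖x - pos z‖ ^ 2 : ℝ) : ℂ) := by
    rw [gaussPhase]
    congr 1
    · rw [← Complex.ofReal_sum, ← inner_sub_right]
      simp [PiLp.inner_apply, pos, mom, mul_comm]
    · rw [EuclideanSpace.norm_sq_eq]
      simp [Matrix.one_apply, pos, Finset.mul_sum]
      refine Finset.sum_congr rfl fun j _ => by ring
  rw [widthMatrix_id, gaussFun, hph, coherentState, weylOperator, gaussian]
  push_cast
  rw [mul_left_comm, mul_assoc, ← Complex.exp_add, ← Complex.exp_add]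
  congr 2
  rcases eq_or_ne ħ 0 with rfl | hħ
  · simp
  have hh : (ħ : ℂ) ≠ 0 := by exact_mod_cast hħ
  field_simp
  linear_combination (-(‖x - pos z‖ : ℂ) ^ 2) * Complex.I_sq

lemma integral_norm_coherentState_sq {ħ : ℝ} (hħ : 0 < ħ) (z : Phase d) :
    ∫ x, ‖coherentState ħ z x‖ ^ 2 = 1 := by
  have h1 : ∀ x, ‖coherentState ħ z x‖ ^ 2 =
      (Real.pi * ħ) ^ (-(d : ℝ) / 2) * Real.exp (-(1 / ħ) * ‖x - pos z‖ ^ 2) := fun x => by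
    rw [coherentState, weylOperator, norm_mul, norm_exp_I_div_mul, one_mul, gaussian,
      Complex.norm_real, Real.norm_of_nonneg (by positivity), mul_pow, ← Real.rpow_natCast,
      ← Real.rpow_mul (by positivity), ← Real.exp_nat_mul]
    congr 2
    · push_cast; ring
    · push_cast; field_simp
  simp_rw [h1]
  rw [integral_const_mul, integral_sub_right_eq_self (fun x : Conf d => Real.exp (-(1 / ħ) * ‖x‖ ^ 2)),
    GaussianFourier.integral_rexp_neg_mul_sq_norm (by positivity), finrank_euclideanSpace,
    Fintype.card_fin, div_div_eq_mul_div, div_one, ← Real.rpow_add (by positivity)]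
  rw [neg_div, neg_add_cancel, Real.rpow_zero]

end

section

variable {H : ℝ → Phase d → ℝ} {T : ℝ} {z : ℝ → Phase d} {F : ℝ → Phase d →L[ℝ] Phase d} {l : ℕ}

lemma quadraticHamiltonian_eq (t : ℝ) : quadraticHamiltonian H z t =
    quadPoly (H t (z t)) (gradient (H t) (z t)) (hessianAlong H z t) (z t) := rfl

lemma ContinuousOn.phase_apply {f : ℝ → Phase d} {S : Set ℝ} (hf : ContinuousOn f S)
    (i : Fin d ⊕ Fin d) : ContinuousOn (fun t => f t i) S :=
  (EuclideanSpace.proj (𝕜 := ℝ) i).continuous.comp_continuousOn hf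

lemma ContinuousOn.entry {f : ℝ → Phase d →L[ℝ] Phase d} {S : Set ℝ} (hf : ContinuousOn f S)
    (i j : Fin d ⊕ Fin d) : ContinuousOn (fun t => entry (f t) i j) S :=
  ContinuousOn.phase_apply (hf.clm_apply continuousOn_const) i

lemma continuousOn_gaussCov {Γ : ℝ → Matrix (Fin d) (Fin d) ℂ} {S : Set ℝ}
    (hΓ : ∀ j k, ContinuousOn (fun t => Γ t j k) S) (i j : Fin d ⊕ Fin d) :
    ContinuousOn (fun t => gaussCov (Γ t) i j) S := by
  rcases i with i | i <;> rcases j with j | j <;> simp only [gaussCov]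
  · exact continuousOn_const
  · exact continuousOn_const
  · exact continuousOn_const
  · exact hΓ i j

lemma IsLinearizedFlow.exists_posFrame_bound (hF : IsLinearizedFlow H z T F) :
    ∃ R : ℝ, 0 < R ∧ ∀ t ∈ Set.Icc 0 T, ∑ j, ∑ α, ‖posFrame (F t) j α‖ ^ 2 ≤ R := by
  have hcont : ContinuousOn (fun t => ∑ j, ∑ α, ‖posFrame (F t) j α‖ ^ 2) (Set.Icc 0 T) := by
    refine continuousOn_finsetSum _ fun j _ => continuousOn_finsetSum _ fun α _ => ?_
    exact (ContinuousOn.norm fun t ht =>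
      (hasDerivWithinAt_frame (hF.2 t ht) (Sum.inl j) α).continuousWithinAt).pow 2
  obtain ⟨R, hR⟩ := isCompact_Icc.exists_bound_of_continuousOn hcont
  refine ⟨max R 1, by positivity, fun t ht => ?_⟩
  exact (le_abs_self _).trans ((hR t ht).trans (le_max_left _ _))

/-- A bound, uniform in time, for all quantities entering a Gaussian solution. -/
lemma exists_coefficient_bound {h : ℝ → ℝ} {g z : ℝ → Phase d} {A : ℝ → Phase d →L[ℝ] Phase d}
    {Γ : ℝ → Matrix (Fin d) (Fin d) ℂ} {c : ℝ → ℂ} (hvc : ContinuousOn h (Set.Icc 0 T))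
    (hgc : ContinuousOn g (Set.Icc 0 T)) (hMc : ContinuousOn A (Set.Icc 0 T))
    (hΓc : ∀ j k, ContinuousOn (fun t => Γ t j k) (Set.Icc 0 T))
    (hzc : ContinuousOn z (Set.Icc 0 T)) (hcc : ContinuousOn c (Set.Icc 0 T)) :
    ∃ R : ℝ, ∀ t ∈ Set.Icc 0 T, |h t| + ∑ i, |g t i| +
      ∑ i, ∑ j, |entry (A t) i j| + ∑ j, ∑ k, ‖Γ t j k‖ +
      ∑ i, |z t i| + ‖c t‖ + ‖pos (z t)‖ ≤ R := by
  have hposc : ContinuousOn (fun t => ‖pos (z t)‖) (Set.Icc 0 T) := by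
    have hp : Continuous (pos : Phase d → Conf d) := by
      unfold pos
      fun_prop
    exact (hp.comp_continuousOn hzc).norm
  have hcont : ContinuousOn (fun t => |h t| + ∑ i, |g t i| +
    ∑ i, ∑ j, |entry (A t) i j| + ∑ j, ∑ k, ‖Γ t j k‖ +
    ∑ i, |z t i| + ‖c t‖ + ‖pos (z t)‖) (Set.Icc 0 T) := by
    refine ContinuousOn.add (ContinuousOn.add (ContinuousOn.add (ContinuousOn.add
      (ContinuousOn.add (ContinuousOn.add hvc.abs ?_) ?_) ?_) ?_) hcc.norm) hposc
    · exact continuousOn_finsetSum _ fun i _ => (ContinuousOn.phase_apply hgc i).abs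
    · exact continuousOn_finsetSum _ fun i _ => continuousOn_finsetSum _ fun j _ =>
        (ContinuousOn.entry hMc i j).abs
    · exact continuousOn_finsetSum _ fun j _ => continuousOn_finsetSum _ fun k _ =>
        (hΓc j k).norm
    · exact continuousOn_finsetSum _ fun i _ => (ContinuousOn.phase_apply hzc i).abs
  obtain ⟨R, hR⟩ := isCompact_Icc.exists_bound_of_continuousOn hcont
  exact ⟨R, fun t ht => (le_abs_self _).trans (hR t ht)⟩

/-- The coherent state evolves, under the quadratic Hamiltonian, into the Gaussian state centred at
`z_t` with width matrix determined by the linearized flow `F_t`. -/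
theorem exists_gaussian_solution (hT : 0 < T) (hH : ClassicalAssumption l H T)
    (hz : IsHamiltonSolution H T z) (hF : IsLinearizedFlow H z T F) {ħ : ℝ} (hħ : 0 < ħ) :
    ∃ (ψ : ℝ → 𝓢(Conf d, ℂ)) (c : ℝ → ℂ),
      IsSchrodingerSolution ħ T (quadraticHamiltonian H z) (coherentState ħ (z 0)) ψ ∧
      ∀ t ∈ Set.Icc 0 T, ∀ x, ψ t x = gaussFun ħ (c t) (z t) (widthMatrix (F t)) x := by
  have h0 : (0 : ℝ) ∈ Set.Icc 0 T := Set.left_mem_Icc.2 hT.le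
  have hsymp : ∀ t ∈ Set.Icc 0 T, IsSymplectic (F t) := fun t ht => hF.isSymplectic hH ht
  have hzc : ContinuousOn z (Set.Icc 0 T) := (hz.contDiffOn hT hH).continuousOn
  have hgc := (hz.contDiffOn_gradient hT hH).continuousOn
  have hvc := (hz.contDiffOn_value hT hH).continuousOn
  have hMc := (hz.contDiffOn_hessianAlong hT hH).continuousOn
  have hΓ : ∀ t ∈ Set.Icc 0 T, ∀ j k, HasDerivWithinAt (fun s => widthMatrix (F s) j k)
      (riccati (poisson d ∘L hessianAlong H z t) (widthMatrix (F t)) j k) (Set.Icc 0 T) t :=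
    fun t ht j k => hasDerivWithinAt_widthMatrix (hF.2 t ht) hsymp ht j k
  have hΓc : ∀ j k, ContinuousOn (fun s => widthMatrix (F s) j k) (Set.Icc 0 T) :=
    fun j k t ht => (hΓ t ht j k).continuousWithinAt
  -- the amplitude `c` solves a scalar linear equation driven by the action and a trace term in `Γ`
  obtain ⟨c, hc0, hc⟩ := exists_exp_solution hT.le (μ := fun t => Complex.I / ħ *
      ((∑ j, z t (Sum.inr j) * gradient (H t) (z t) (Sum.inr j) - H t (z t) : ℝ) : ℂ) -
      1 / 2 * ∑ i, ∑ j, entry (hessianAlong H z t) i j * gaussCov (widthMatrix (F t)) i j) (by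
    refine ContinuousOn.sub (continuousOn_const.mul (Complex.continuous_ofReal.comp_continuousOn
      (ContinuousOn.sub (continuousOn_finsetSum _ fun j _ => ?_) hvc)))
      (continuousOn_const.mul (continuousOn_finsetSum _ fun i _ =>
        continuousOn_finsetSum _ fun j _ => ?_))
    · exact (ContinuousOn.phase_apply hzc _).mul (ContinuousOn.phase_apply hgc _)
    · exact (Complex.continuous_ofReal.comp_continuousOn (ContinuousOn.entry hMc i j)).mul
        (continuousOn_gaussCov hΓc i j))
    ((((Real.pi * ħ) ^ (-(d : ℝ) / 4) : ℝ) : ℂ) *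
      Complex.exp (Complex.I / ħ * ((inner ℝ (mom (z 0)) (pos (z 0)) / 2 : ℝ) : ℂ)))
  have hcc : ContinuousOn c (Set.Icc 0 T) := fun t ht => (hc t ht).continuousWithinAt
  -- a uniform lower bound on the imaginary part of the width matrix
  obtain ⟨R₀, hR₀, hQ⟩ := hF.exists_posFrame_bound
  have hδ : ∀ t ∈ Set.Icc 0 T, ImBoundedBelow R₀⁻¹ (widthMatrix (F t)) := fun t ht =>
    (hsymp t ht).imBoundedBelow hR₀ (hQ t ht)
  have hex : ∀ t, ∃ φ : 𝓢(Conf d, ℂ), t ∈ Set.Icc 0 T →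
      ∀ x, φ x = gaussFun ħ (c t) (z t) (widthMatrix (F t)) x := by
    intro t
    by_cases ht : t ∈ Set.Icc 0 T
    · obtain ⟨φ, hφ⟩ := exists_schwartz_gaussFun hħ (inv_pos.2 hR₀) (c t) (z t) (hδ t ht)
      exact ⟨φ, fun _ => hφ⟩
    · exact ⟨0, fun h => absurd h ht⟩
  choose ψ hψ using hex
  refine ⟨ψ, c, ⟨fun x => ?_, fun t ht => ?_⟩, hψ⟩
  · rw [hψ 0 h0, coherentState_eq_gaussFun, hc0, hF.1]
  -- bounds on all coefficients, uniform in time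
  obtain ⟨R, hR⟩ := exists_coefficient_bound hvc hgc hMc hΓc hzc hcc
  set D : ℝ → Conf d → ℂ := fun s x =>
    (Complex.I * ħ)⁻¹ * weylQuantization ħ (quadraticHamiltonian H z s) (ψ s) x with hD
  have hderiv : ∀ s ∈ Set.Icc 0 T, ∀ x,
      HasDerivWithinAt (fun s => ψ s x) (D s x) (Set.Icc 0 T) s := by
    intro s hs x
    have hzi : ∀ i, HasDerivWithinAt (fun t => z t i)
        (poisson d (gradient (H s) (z s)) i) (Set.Icc 0 T) s := fun i =>
      (EuclideanSpace.proj (𝕜 := ℝ) i).hasFDerivAt.comp_hasDerivWithinAt s (hz s hs)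
    have h1 := hasDerivWithinAt_gaussFun (z := z) (c := c)
      (Γ := fun s => widthMatrix (F s)) hħ (hψ s hs) (hsymp s hs).isSymm_widthMatrix
      (H s (z s)) (gradient (H s) (z s)) (hessianAlong H z s) hzi (hΓ s hs)
      (sum_riccati (hsymp s hs).isSymm_widthMatrix _ _) (hc s hs) x
    exact h1.congr (fun r hr => hψ r hr x) (hψ s hs x)
  set K := R + R * (1 + R) ^ 2 + R * (1 + R) ^ 4 + ħ * R * (1 + R) with hK
  set B := (1 + R) ^ (2 + (d + 1)) * Real.exp (((2 + (d + 1) : ℕ) : ℝ) ^ 2 / (4 * (R₀⁻¹ / (2 * ħ))))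
    with hB
  have hbound : ∀ s ∈ Set.Icc 0 T, ∀ x,
      (1 + ‖x‖) ^ (d + 1) * ‖D s x‖ ≤ ħ⁻¹ * (K * (R * B)) := by
    intro s hs x
    have hRs := hR s hs
    have p1 : 0 ≤ |H s (z s)| := abs_nonneg _
    have p2 : 0 ≤ ∑ i, |gradient (H s) (z s) i| := Finset.sum_nonneg fun _ _ => abs_nonneg _
    have p3 : 0 ≤ ∑ i, ∑ j, |entry (hessianAlong H z s) i j| :=
      Finset.sum_nonneg fun _ _ => Finset.sum_nonneg fun _ _ => abs_nonneg _
    have p4 : 0 ≤ ∑ j, ∑ k, ‖widthMatrix (F s) j k‖ :=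
      Finset.sum_nonneg fun _ _ => Finset.sum_nonneg fun _ _ => norm_nonneg _
    have p5 : 0 ≤ ∑ i, |z s i| := Finset.sum_nonneg fun _ _ => abs_nonneg _
    have p6 := norm_nonneg (c s)
    have p7 := norm_nonneg (pos (z s))
    have hR0 : 0 ≤ R := by linarith
    have h1 := norm_weylQuantization_quadPoly_gaussFun_le (R := R) hħ
      (hsymp s hs).isSymm_widthMatrix (hψ s hs) (h₀ := H s (z s)) (g := gradient (H s) (z s))
      (A := hessianAlong H z s)
      (fun j => (Finset.single_le_sum (f := fun j => ∑ k, ‖widthMatrix (F s) j k‖)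
        (fun _ _ => Finset.sum_nonneg fun _ _ => norm_nonneg _) (Finset.mem_univ j)).trans
        (by linarith))
      (fun i => (Finset.single_le_sum (f := fun i => |z s i|) (fun _ _ => abs_nonneg _)
        (Finset.mem_univ i)).trans (by linarith)) (by linarith) (by linarith) (by linarith) x
    have h2 := gaussFun_decay hħ (inv_pos.2 hR₀) (z := z s) (hδ s hs) (2 + (d + 1)) x
    have h3 : (1 + ‖x‖) ^ (2 + (d + 1)) * ‖ψ s x‖ ≤ R * B := by
      rw [hψ s hs, gaussFun, norm_mul, mul_left_comm]
      have h4 : ‖c s‖ ≤ R := by linarith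
      refine mul_le_mul h4 (h2.trans ?_) (by positivity) hR0
      rw [hB]
      gcongr
      linarith
    have hKp : 0 ≤ K := by positivity
    rw [hD]
    simp only [norm_mul, norm_inv, Complex.norm_I, one_mul, Complex.norm_real,
      Real.norm_of_nonneg hħ.le]
    rw [mul_left_comm, quadraticHamiltonian_eq]
    refine mul_le_mul_of_nonneg_left ?_ (by positivity)
    calc _ ≤ (1 + ‖x‖) ^ (d + 1) * (K * (1 + ‖x‖) ^ 2 * ‖ψ s x‖) := by gcongr
      _ = K * ((1 + ‖x‖) ^ (2 + (d + 1)) * ‖ψ s x‖) := by rw [pow_add]; ring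
      _ ≤ _ := by gcongr
  obtain ⟨v, hv⟩ := (isPolySymbol_quadPoly (H t (z t)) (gradient (H t) (z t))
    (hessianAlong H z t) (z t)).exists_L2 hħ (ψ t)
  refine ⟨v, hv, hasDerivWithinAt_toL2 hderiv hbound ht ?_⟩
  filter_upwards [hv, Lp.coeFn_smul (Complex.I * ħ)⁻¹ v] with x h1 h2
  rw [h2, Pi.smul_apply, h1]
  rfl

lemma norm_toL2_coherentState {ħ : ℝ} (hħ : 0 < ħ) {z₀ : Phase d} {φ : 𝓢(Conf d, ℂ)}
    (hφ : ∀ x, φ x = coherentState ħ z₀ x) : ‖toL2 φ‖ ^ 2 = 1 := by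
  rw [norm_toL2_sq, ← integral_norm_coherentState_sq hħ z₀]
  simp only [hφ]

/-- The propagated coherent state: it solves the Schrödinger equation, is the image of the initial
state under every unitary propagator, and its expectation values are Gaussian averages. -/
theorem exists_propagated_state (hT : 0 < T) (hH : ClassicalAssumption l H T)
    (hz : IsHamiltonSolution H T z) (hF : IsLinearizedFlow H z T F) {ħ : ℝ} (hħ : 0 < ħ) :
    ∃ ψ : ℝ → 𝓢(Conf d, ℂ),
      IsSchrodingerSolution ħ T (quadraticHamiltonian H z) (coherentState ħ (z 0)) ψ ∧
      (∀ U : ℝ → ℝ → (L2 d ≃ₗᵢ[ℂ] L2 d),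
        IsUnitaryPropagator ħ T (quadraticHamiltonian H z) U →
        ∀ t ∈ Set.Icc 0 T, U t 0 (toL2 (ψ 0)) = toL2 (ψ t)) ∧
      ∀ t ∈ Set.Icc 0 T, ∀ (M : ℕ) (a : Phase d → ℝ), IsPolySymbol M a →
        HasExpectation ħ a (ψ t) (gaussAvg a (z t) (√ħ • F t) : ℝ) := by
  obtain ⟨ψ, c, hψ, hgauss⟩ := exists_gaussian_solution hT hH hz hF hħ
  have hexp : ∀ t ∈ Set.Icc 0 T, ∀ (M : ℕ) (a : Phase d → ℝ), IsPolySymbol M a → ∀ v : L2 d,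
      (v =ᵐ[volume] weylQuantization ħ a (ψ t)) →
      inner ℂ (toL2 (ψ t)) v = ((‖toL2 (ψ t)‖ ^ 2 * gaussAvg a (z t) (√ħ • F t) : ℝ) : ℂ) :=
    fun t ht M a ha v hv =>
      inner_weylQuantization_gaussFun hħ (hF.isSymplectic hH ht) (hgauss t ht) ha hv
  have hnorm : ∀ t ∈ Set.Icc 0 T, ‖toL2 (ψ t)‖ ^ 2 = ‖toL2 (ψ 0)‖ ^ 2 := by
    have hsol := hψ.2
    choose! v hv hd using hsol
    intro t ht
    exact norm_sq_eq_of_schrodinger (f := fun s => toL2 (ψ s)) hd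
      (fun s hs => ⟨_, hexp s hs 2 _ (isPolySymbol_quadPoly _ _ _ _) (v s) (hv s hs)⟩) ht
  refine ⟨ψ, hψ, fun U hU t ht => hU.apply_eq hψ hnorm ht, fun t ht M a ha => ?_⟩
  obtain ⟨v, hv⟩ := ha.exists_L2 hħ (ψ t)
  refine ⟨v, hv, ?_⟩
  rw [hexp t ht M a ha v hv, hnorm t ht, norm_toL2_coherentState hħ hψ.1, one_mul]

end

section

/-! ### Smooth dependence of Gaussian averages on centre and covariance -/

/-- Gaussian integrals of a family `f y p`, all of whose derivatives in the parameter `p` grow at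
most polynomially in `y` and `p`, depend smoothly on `p`. -/
lemma contDiff_integral_exp_smul {P : Type} [NormedAddCommGroup P] [NormedSpace ℝ P] (n : ℕ) :
    ∀ {W : Type} [NormedAddCommGroup W] [NormedSpace ℝ W] {f : Phase d → P → W},
      ContDiff ℝ ∞ (Function.uncurry f) →
      (∀ m : ℕ, ∃ (C : ℝ) (K M : ℕ), ∀ y p,
        ‖iteratedFDeriv ℝ m (f y) p‖ ≤ C * (1 + ‖p‖) ^ K * (1 + ‖y‖) ^ M) →
      ContDiff ℝ n (fun p => ∫ y : Phase d, Real.exp (-‖y‖ ^ 2) • f y p) := by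
  have key : ∀ {W : Type} [NormedAddCommGroup W] [NormedSpace ℝ W] {f : Phase d → P → W},
      ContDiff ℝ ∞ (Function.uncurry f) →
      (∀ m : ℕ, ∃ (C : ℝ) (K M : ℕ), ∀ y p,
        ‖iteratedFDeriv ℝ m (f y) p‖ ≤ C * (1 + ‖p‖) ^ K * (1 + ‖y‖) ^ M) → ∀ p,
      HasFDerivAt (fun p => ∫ y : Phase d, Real.exp (-‖y‖ ^ 2) • f y p)
        (∫ y : Phase d, Real.exp (-‖y‖ ^ 2) • fderiv ℝ (f y) p) p := by
    intro W _ _ f hf hb p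
    have hfy : ∀ y, ContDiff ℝ ∞ (f y) := fun y => hf.comp (contDiff_const.prodMk contDiff_id)
    have hfc : ∀ q, Continuous fun y => f y q := fun q =>
      hf.continuous.comp (continuous_id.prodMk continuous_const)
    have hfc' : ∀ q, Continuous fun y => fderiv ℝ (f y) q := fun q =>
      (ContDiff.fderiv (n := 0) hf contDiff_const (by simp)).continuous
    obtain ⟨C₀, K₀, M₀, h₀⟩ := hb 0
    obtain ⟨C₁, K₁, M₁, h₁⟩ := hb 1
    simp only [norm_iteratedFDeriv_zero] at h₀
    simp only [norm_iteratedFDeriv_one] at h₁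
    have hC₁ : 0 ≤ C₁ := by
      have := (norm_nonneg _).trans (h₁ 0 0)
      simpa using this
    have hexp : Continuous fun y : Phase d => Real.exp (-‖y‖ ^ 2) := by fun_prop
    refine hasFDerivAt_integral_of_dominated_of_fderiv_le
      (F' := fun q y => Real.exp (-‖y‖ ^ 2) • fderiv ℝ (f y) q)
      (bound := fun y => Real.exp (-‖y‖ ^ 2) • (C₁ * (2 + ‖p‖) ^ K₁ * (1 + ‖y‖) ^ M₁))
      (Metric.ball_mem_nhds p one_pos) ?_ ?_ ?_ ?_ ?_ ?_
    · exact Filter.Eventually.of_forall fun q => (hexp.smul (hfc q)).aestronglyMeasurable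
    · exact integrable_exp_neg_sq_smul (hfc p).aestronglyMeasurable (fun y => h₀ y p)
    · exact (hexp.smul (hfc' p)).aestronglyMeasurable
    · refine Filter.Eventually.of_forall fun y q hq => ?_
      rw [norm_smul, Real.norm_of_nonneg (Real.exp_nonneg _), smul_eq_mul]
      gcongr
      have h2 := norm_le_norm_add_norm_sub' q p
      rw [mem_ball_iff_norm] at hq
      have h3 : (1 + ‖q‖) ^ K₁ ≤ (2 + ‖p‖) ^ K₁ := pow_le_pow_left₀ (by positivity) (by linarith) _
      exact (h₁ y q).trans (mul_le_mul_of_nonneg_right (mul_le_mul_of_nonneg_left h3 hC₁)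
        (by positivity))
    · refine integrable_exp_neg_sq_smul (Continuous.aestronglyMeasurable (by fun_prop))
        (C := C₁ * (2 + ‖p‖) ^ K₁) (M := M₁) fun y => ?_
      rw [Real.norm_of_nonneg (by positivity)]
    · refine Filter.Eventually.of_forall fun y q _ => ?_
      exact (((hfy y).differentiable (by simp)) q).hasFDerivAt.const_smul _
  induction n with
  | zero =>
    intro W _ _ f hf hb
    exact contDiff_zero.2 (continuous_iff_continuousAt.2 fun p => (key hf hb p).continuousAt)
  | succ n ih =>
    intro W _ _ f hf hb
    push_cast
    rw [contDiff_succ_iff_hasFDerivAt]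
    refine ⟨_, ih (f := fun y => fderiv ℝ (f y)) ?_ fun m => ?_, key hf hb⟩
    · refine ContDiff.fderiv (f := fun q : Phase d × P => f q.1) (m := ∞) ?_ contDiff_snd (by simp)
      exact hf.comp ((contDiff_fst.comp contDiff_fst).prodMk contDiff_snd)
    · obtain ⟨C, K, M, h⟩ := hb (m + 1)
      refine ⟨C, K, M, fun y p => ?_⟩
      rw [norm_iteratedFDeriv_fderiv]
      exact h y p

/-- The linear map `(z, A) ↦ z + A y`. -/
def affineEval (y : Phase d) : Phase d × (Phase d →L[ℝ] Phase d) →L[ℝ] Phase d :=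
  ContinuousLinearMap.fst ℝ _ _ + (ContinuousLinearMap.apply ℝ (Phase d) y) ∘L
    ContinuousLinearMap.snd ℝ _ _

lemma norm_affineEval_le (y : Phase d) : ‖affineEval y‖ ≤ 1 + ‖y‖ := by
  refine ContinuousLinearMap.opNorm_le_bound _ (by positivity) fun p => ?_
  have h1 : ‖p.2 y‖ ≤ ‖p‖ * ‖y‖ := (p.2.le_opNorm y).trans (by gcongr; exact norm_snd_le p)
  calc ‖p.1 + p.2 y‖ ≤ ‖p‖ + ‖p‖ * ‖y‖ := (norm_add_le _ _).trans (add_le_add (norm_fst_le p) h1)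
    _ = _ := by ring

lemma IsPolySymbol.contDiff_gaussAvg {M : ℕ} {a : Phase d → ℝ} (ha : IsPolySymbol M a) :
    ContDiff ℝ ∞ (fun p : Phase d × (Phase d →L[ℝ] Phase d) => gaussAvg a p.1 p.2) := by
  refine ContDiff.mul contDiff_const (contDiff_infty.2 fun n => ?_)
  refine contDiff_integral_exp_smul n 
    (f := fun y (p : Phase d × (Phase d →L[ℝ] Phase d)) => a (p.1 + p.2 y)) ?_ fun m => ?_
  · refine ha.1.comp ((contDiff_fst.comp contDiff_snd).add ?_)
    exact (contDiff_snd.comp contDiff_snd).clm_apply contDiff_fst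
  · obtain ⟨C, hC, h⟩ := ha.exists_bound m
    refine ⟨C, M, M + m, fun y p => ?_⟩
    have heq : (fun p : Phase d × (Phase d →L[ℝ] Phase d) => a (p.1 + p.2 y)) =
        a ∘ affineEval y := rfl
    rw [heq, (affineEval y).iteratedFDeriv_comp_right ha.1 p (by exact_mod_cast le_top)]
    refine (ContinuousMultilinearMap.norm_compContinuousLinearMap_le _ _).trans ?_
    rw [Finset.prod_const, Finset.card_univ, Fintype.card_fin]
    have h1 : 1 + ‖affineEval y p‖ ≤ (1 + ‖p‖) * (1 + ‖y‖) := by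
      have h2 := ((affineEval y).le_opNorm p).trans
        (mul_le_mul_of_nonneg_right (norm_affineEval_le y) (norm_nonneg p))
      nlinarith [norm_nonneg y, norm_nonneg p]
    calc _ ≤ C * ((1 + ‖p‖) * (1 + ‖y‖)) ^ M * (1 + ‖y‖) ^ m := by
          gcongr
          · exact (h _).trans (by gcongr)
          · exact norm_affineEval_le y
      _ = _ := by rw [mul_pow, pow_add]; ring

end

section

/-! ### Weights and energies along translations of phase space -/

/-- The polynomial `1 + |x|^{2l} + |ξ|²`, of which the weight `k₀` is a power. -/
def basicWeight (l : ℕ) (z : Phase d) : ℝ := 1 + ‖pos z‖ ^ (2 * l) + ‖mom z‖ ^ 2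

lemma one_le_basicWeight (l : ℕ) (z : Phase d) : 1 ≤ basicWeight l z := by
  have h1 : 0 ≤ ‖pos z‖ ^ (2 * l) := by positivity
  have h2 : 0 ≤ ‖mom z‖ ^ 2 := by positivity
  unfold basicWeight
  linarith

lemma basicWeight_pos (l : ℕ) (z : Phase d) : 0 < basicWeight l z :=
  one_pos.trans_le (one_le_basicWeight l z)

lemma weight_rpow (l : ℕ) (z : Phase d) (r : ℝ) :
    weight l z ^ r = basicWeight l z ^ (((l : ℝ) + 1) / (2 * l) * r) := by
  rw [Real.rpow_mul (basicWeight_pos l z).le]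
  rfl

lemma norm_pos_le (z : Phase d) : ‖pos z‖ ≤ ‖z‖ := by
  rw [← sq_le_sq₀ (norm_nonneg _) (norm_nonneg _), norm_sq_pos_add_mom]
  linarith [sq_nonneg ‖mom z‖]

lemma norm_mom_le (z : Phase d) : ‖mom z‖ ≤ ‖z‖ := by
  rw [← sq_le_sq₀ (norm_nonneg _) (norm_nonneg _), norm_sq_pos_add_mom]
  linarith [sq_nonneg ‖pos z‖]

lemma norm_le_pos_add_mom (z : Phase d) : ‖z‖ ≤ ‖pos z‖ + ‖mom z‖ := by
  rw [← sq_le_sq₀ (norm_nonneg _) (by positivity), norm_sq_pos_add_mom]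
  nlinarith [norm_nonneg (pos z), norm_nonneg (mom z)]

lemma add_pow_le_one_add_pow_mul {r s : ℝ} (hr : 0 ≤ r) (hs : 0 ≤ s) (k : ℕ) :
    (r + s) ^ k ≤ (1 + r ^ k) * (1 + s) ^ k := by
  rcases le_total r 1 with h | h
  · calc (r + s) ^ k ≤ (1 + s) ^ k := by gcongr
      _ ≤ _ := le_mul_of_one_le_left (by positivity) (by linarith [pow_nonneg hr k])
  · calc (r + s) ^ k ≤ (r * (1 + s)) ^ k := by gcongr; nlinarith
      _ = r ^ k * (1 + s) ^ k := mul_pow _ _ _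
      _ ≤ _ := by gcongr; linarith

lemma pos_add (z w : Phase d) : pos (z + w) = pos z + pos w := rfl

lemma mom_add (z w : Phase d) : mom (z + w) = mom z + mom w := rfl

lemma basicWeight_add_le {l : ℕ} (hl : 1 ≤ l) (z w : Phase d) :
    basicWeight l (z + w) ≤ 3 * (1 + ‖w‖) ^ (2 * l) * basicWeight l z := by
  have hw : 1 ≤ 1 + ‖w‖ := by linarith [norm_nonneg w]
  have h0 : (1 : ℝ) ≤ (1 + ‖w‖) ^ (2 * l) := one_le_pow₀ hw
  have h1 : ‖pos (z + w)‖ ^ (2 * l) ≤ (1 + ‖pos z‖ ^ (2 * l)) * (1 + ‖w‖) ^ (2 * l) := by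
    refine le_trans ?_ (add_pow_le_one_add_pow_mul (norm_nonneg _) (norm_nonneg w) _)
    rw [pos_add]
    gcongr
    exact (norm_add_le _ _).trans (add_le_add_right (norm_pos_le w) _)
  have h2 : ‖mom (z + w)‖ ^ 2 ≤ (1 + ‖mom z‖ ^ 2) * (1 + ‖w‖) ^ (2 * l) := by
    calc _ ≤ (‖mom z‖ + ‖w‖) ^ 2 := by
          rw [mom_add]
          gcongr
          exact (norm_add_le _ _).trans (add_le_add_right (norm_mom_le w) _)
      _ ≤ (1 + ‖mom z‖ ^ 2) * (1 + ‖w‖) ^ 2 :=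
          add_pow_le_one_add_pow_mul (norm_nonneg _) (norm_nonneg w) _
      _ ≤ _ := by gcongr; omega
  have h3 : 0 ≤ ‖pos z‖ ^ (2 * l) * (1 + ‖w‖) ^ (2 * l) := by positivity
  have h4 : 0 ≤ ‖mom z‖ ^ 2 * (1 + ‖w‖) ^ (2 * l) := by positivity
  unfold basicWeight
  nlinarith

/-- Comparable positive numbers have comparable powers, whatever the sign of the exponent. -/
lemma rpow_le_of_comparable {x y c σ : ℝ} (hx : 0 < x) (hy : 0 < y) (hc : 1 ≤ c)
    (hxy : x ≤ c * y) (hyx : y ≤ c * x) : x ^ σ ≤ c ^ ⌈|σ|⌉₊ * y ^ σ := by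
  have hc0 : 0 < c := one_pos.trans_le hc
  have h1 : c ^ |σ| ≤ c ^ ⌈|σ|⌉₊ := by
    rw [← Real.rpow_natCast]
    exact Real.rpow_le_rpow_of_exponent_le hc (Nat.le_ceil _)
  refine le_trans ?_ (mul_le_mul_of_nonneg_right h1 (by positivity))
  rcases le_total 0 σ with h | h
  · rw [abs_of_nonneg h, ← Real.mul_rpow hc0.le hy.le]
    exact Real.rpow_le_rpow hx.le hxy h
  · rw [abs_of_nonpos h]
    have h2 : y / c ≤ x := by rwa [div_le_iff₀ hc0, mul_comm]
    calc x ^ σ ≤ (y / c) ^ σ := Real.rpow_le_rpow_of_nonpos (by positivity) h2 h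
      _ = _ := by
        rw [Real.div_rpow hy.le hc0.le, Real.rpow_neg hc0.le]
        field_simp

/-- Temperance of the weight: translating by `w` costs at most a power of `1 + |w|`. -/
lemma basicWeight_add_rpow_le {l : ℕ} (hl : 1 ≤ l) (z w : Phase d) (σ : ℝ) :
    basicWeight l (z + w) ^ σ ≤ (3 * (1 + ‖w‖) ^ (2 * l)) ^ ⌈|σ|⌉₊ * basicWeight l z ^ σ := by
  have h0 : (1 : ℝ) ≤ (1 + ‖w‖) ^ (2 * l) := one_le_pow₀ (by linarith [norm_nonneg w])
  refine rpow_le_of_comparable (basicWeight_pos _ _) (basicWeight_pos _ _) (by linarith)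
    (basicWeight_add_le hl z w) ?_
  have h := basicWeight_add_le hl (z + w) (-w)
  rwa [add_neg_cancel_right, norm_neg] at h

lemma IsSymbol.isPolySymbol {l : ℕ} (hl : 1 ≤ l) {ρ : ℝ} {a : Phase d → ℝ}
    (ha : IsSymbol l ρ a) : ∃ M, IsPolySymbol M a := by
  set σ := ((l : ℝ) + 1) / (2 * l) * ρ with hσ
  refine ⟨2 * l * ⌈|σ|⌉₊, ha.1, fun n => ?_⟩
  obtain ⟨C, hC⟩ := ha.2 n
  refine ⟨|C| * (3 ^ ⌈|σ|⌉₊ * basicWeight l (0 : Phase d) ^ σ), fun z => (hC z).trans ?_⟩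
  rw [weight_rpow]
  have h := basicWeight_add_rpow_le hl 0 z σ
  rw [zero_add] at h
  calc C * basicWeight l z ^ σ ≤ |C| * basicWeight l z ^ σ := by
        gcongr
        · exact Real.rpow_nonneg (basicWeight_pos _ _).le _
        · exact le_abs_self C
    _ ≤ |C| * ((3 * (1 + ‖z‖) ^ (2 * l)) ^ ⌈|σ|⌉₊ * basicWeight l (0 : Phase d) ^ σ) := by gcongr
    _ = _ := by rw [mul_pow, ← pow_mul]; ring

lemma energy_nonneg (l : ℕ) (z : Phase d) : 0 ≤ energy l z := by
  unfold energy
  have : 0 ≤ ∑ j, (pos z j) ^ (2 * l) := Finset.sum_nonneg fun j _ => by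
    rw [pow_mul]; positivity
  positivity

lemma one_add_energy_le {l : ℕ} (hl : 1 ≤ l) (z : Phase d) :
    1 + energy l z ≤ (1 + d) * basicWeight l z := by
  have h1 : ∑ j, (pos z j) ^ (2 * l) ≤ d * ‖pos z‖ ^ (2 * l) := by
    calc _ ≤ ∑ _j : Fin d, ‖pos z‖ ^ (2 * l) := Finset.sum_le_sum fun j _ => by
          have h2 : |pos z j| ≤ ‖pos z‖ := PiLp.norm_apply_le (pos z) j
          calc _ ≤ |pos z j| ^ (2 * l) := by rw [← abs_pow]; exact le_abs_self _
            _ ≤ _ := by gcongr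
      _ = _ := by simp
  have h3 : 1 / (2 * (l : ℝ)) ≤ 1 := by
    rw [div_le_one (by positivity)]
    have : (1 : ℝ) ≤ l := by exact_mod_cast hl
    linarith
  have h4 : 0 ≤ ∑ j, (pos z j) ^ (2 * l) := Finset.sum_nonneg fun j _ => by
    rw [pow_mul]; positivity
  have h5 : 1 / (2 * (l : ℝ)) * ∑ j, (pos z j) ^ (2 * l) ≤ d * ‖pos z‖ ^ (2 * l) :=
    (mul_le_of_le_one_left h4 h3).trans h1
  have h6 : 0 ≤ ‖pos z‖ ^ (2 * l) := by positivity
  have h7 : 0 ≤ (d : ℝ) * ‖mom z‖ ^ 2 := by positivity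
  have h8 : (0 : ℝ) ≤ d := by positivity
  unfold energy basicWeight
  nlinarith [sq_nonneg ‖mom z‖]

lemma basicWeight_le {l : ℕ} (hl : 1 ≤ l) (z : Phase d) :
    basicWeight l z ≤ (2 + 2 * l * d ^ (2 * l - 1)) * (1 + energy l z) := by
  have h1 : ‖pos z‖ ^ (2 * l) ≤ (d : ℝ) ^ (2 * l - 1) * ∑ j, (pos z j) ^ (2 * l) := by
    have h := norm_pow_le_sum (2 * l - 1) (pos z)
    rw [Nat.sub_add_cancel (by omega)] at h
    refine h.trans_eq ?_
    congr 1
    refine Finset.sum_congr rfl fun j _ => ?_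
    rw [pow_mul, pow_mul, sq_abs]
  have hl0 : (l : ℝ) ≠ 0 := by positivity
  set S := ∑ j, (pos z j) ^ (2 * l) with hS
  have h4 : 0 ≤ S := Finset.sum_nonneg fun j _ => by rw [pow_mul]; positivity
  set D := (d : ℝ) ^ (2 * l - 1) with hD
  have hD0 : 0 ≤ D := by positivity
  have h5 : D * S = 2 * l * D * (1 / (2 * (l : ℝ)) * S) := by field_simp
  have h6 : 0 ≤ 1 / (2 * (l : ℝ)) * S := by positivity
  have h7 : 0 ≤ 2 * l * D := by positivity
  unfold energy basicWeight
  rw [← hS]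
  nlinarith [sq_nonneg ‖mom z‖, mul_nonneg h7 (sq_nonneg ‖mom z‖)]

/-- The weight is comparable to `1 + E`, so this holds for exponents of either sign. -/
lemma exists_basicWeight_rpow_le (d : ℕ) {l : ℕ} (hl : 1 ≤ l) (σ : ℝ) :
    ∃ C : ℝ, 0 ≤ C ∧ ∀ z : Phase d, basicWeight l z ^ σ ≤ C * (1 + energy l z) ^ σ := by
  set c : ℝ := (2 + 2 * l * d ^ (2 * l - 1)) + (1 + d) with hc
  have hp1 : (0 : ℝ) ≤ 2 * l * d ^ (2 * l - 1) := by positivity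
  have hp2 : (0 : ℝ) ≤ d := by positivity
  refine ⟨c ^ ⌈|σ|⌉₊, by positivity, fun z => ?_⟩
  have h0 := energy_nonneg l z
  refine rpow_le_of_comparable (basicWeight_pos l z) (by linarith) (by linarith) ?_ ?_
  · refine (basicWeight_le hl z).trans (mul_le_mul_of_nonneg_right ?_ (by linarith))
    linarith
  · refine (one_add_energy_le hl z).trans
      (mul_le_mul_of_nonneg_right ?_ (basicWeight_pos l z).le)
    linarith

/-! ### The remainder estimate -/

lemma norm_fderiv_eq_norm_gradient (a : Phase d → ℝ) (z : Phase d) :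
    ‖fderiv ℝ a z‖ = ‖gradient a z‖ :=
  ((InnerProductSpace.toDual ℝ (Phase d)).symm.norm_map _).symm

/-- The anisotropic bounds control the full gradient by the exponent of the position
derivatives, which is the larger one. -/
lemma HasAnisotropicBounds.exists_norm_fderiv_le {l : ℕ} (hl : 1 ≤ l) {ρ : ℝ} {a : Phase d → ℝ}
    (ha : HasAnisotropicBounds l ρ a) : ∃ C : ℝ, 0 ≤ C ∧ ∀ z,
      ‖fderiv ℝ a z‖ ≤ C * basicWeight l z ^ ((((l : ℝ) + 1) * ρ - 1) / (2 * l)) := by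
  obtain ⟨C, hC⟩ := ha
  refine ⟨2 * |C|, by positivity, fun z => ?_⟩
  obtain ⟨-, h1, h2⟩ := hC z
  have hl0 : (0 : ℝ) < l := by exact_mod_cast hl
  have hl1 : (1 : ℝ) ≤ l := by exact_mod_cast hl
  set N := basicWeight l z ^ ((((l : ℝ) + 1) * ρ - 1) / (2 * l)) with hN
  have hN0 : 0 ≤ N := Real.rpow_nonneg (basicWeight_pos _ _).le _
  have e1 : weight l z ^ (ρ - 1 / ((l : ℝ) + 1)) = N := by
    rw [weight_rpow, hN]
    congr 1
    field_simp
  have e2 : weight l z ^ (ρ - (l : ℝ) / ((l : ℝ) + 1)) ≤ N := by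
    rw [weight_rpow, hN]
    refine Real.rpow_le_rpow_of_exponent_le (one_le_basicWeight l z) ?_
    have : ((l : ℝ) + 1) / (2 * l) * (ρ - l / (l + 1)) = ((l + 1) * ρ - l) / (2 * l) := by
      field_simp
    rw [this]
    gcongr
  rw [e1] at h1
  have h3 : C * N ≤ |C| * N := mul_le_mul_of_nonneg_right (le_abs_self C) hN0
  have h4 : C * weight l z ^ (ρ - (l : ℝ) / ((l : ℝ) + 1)) ≤ |C| * N := by
    calc _ ≤ |C| * weight l z ^ (ρ - (l : ℝ) / ((l : ℝ) + 1)) := by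
          refine mul_le_mul_of_nonneg_right (le_abs_self C) ?_
          rw [weight_rpow]
          exact Real.rpow_nonneg (basicWeight_pos _ _).le _
      _ ≤ _ := by gcongr
  rw [norm_fderiv_eq_norm_gradient]
  have h5 := norm_le_pos_add_mom (gradient a z)
  linarith

/-- The difference of a symbol and its Gaussian average is controlled by the mean value
inequality and the slow variation of the weight. -/
lemma exists_gaussAvg_sub_le {l : ℕ} (hl : 1 ≤ l) {σ C₀ : ℝ} (hC₀ : 0 ≤ C₀) {M : ℕ}
    {a : Phase d → ℝ} (ha : IsPolySymbol M a)
    (hgrad : ∀ z, ‖fderiv ℝ a z‖ ≤ C₀ * basicWeight l z ^ σ) :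
    ∃ C : ℝ, 0 ≤ C ∧ ∀ (z : Phase d) (A : Phase d →L[ℝ] Phase d), ‖A‖ ≤ 1 →
      |gaussAvg a z A - a z| ≤ C * ‖A‖ * basicWeight l z ^ σ := by
  set m := ⌈|σ|⌉₊ with hm
  set I : ℝ := ∫ y : Phase d, Real.exp (-‖y‖ ^ 2) * (1 + ‖y‖) ^ (2 * l * m + 1) with hI
  have hI0 : 0 ≤ I := integral_nonneg fun y => by positivity
  refine ⟨(Real.pi ^ d)⁻¹ * (C₀ * 3 ^ m * I), by positivity, fun z A hA => ?_⟩
  set N := basicWeight l z ^ σ with hN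
  have hN0 : 0 ≤ N := Real.rpow_nonneg (basicWeight_pos _ _).le _
  have hdiff : Differentiable ℝ a := ha.1.differentiable (by simp)
  have hpt : ∀ y, |a (z + A y) - a z| ≤ C₀ * 3 ^ m * N * ‖A‖ * (1 + ‖y‖) ^ (2 * l * m + 1) := by
    intro y
    have hAy : ‖A y‖ ≤ ‖A‖ * ‖y‖ := A.le_opNorm y
    have hAy1 : ‖A y‖ ≤ ‖y‖ := hAy.trans (mul_le_of_le_one_left (norm_nonneg y) hA)
    have hb : ∀ ζ ∈ Metric.closedBall z ‖y‖,
        ‖fderiv ℝ a ζ‖ ≤ C₀ * ((3 * (1 + ‖y‖) ^ (2 * l)) ^ m * N) := by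
      intro ζ hζ
      refine (hgrad ζ).trans ?_
      have h1 := basicWeight_add_rpow_le hl z (ζ - z) σ
      rw [add_sub_cancel] at h1
      have h2 : ‖ζ - z‖ ≤ ‖y‖ := by rwa [mem_closedBall_iff_norm] at hζ
      gcongr
      exact h1.trans (by gcongr)
    have h3 := (convex_closedBall z ‖y‖).norm_image_sub_le_of_norm_fderiv_le (𝕜 := ℝ)
      (fun ζ _ => hdiff ζ) hb (Metric.mem_closedBall_self (norm_nonneg y))
      (show z + A y ∈ Metric.closedBall z ‖y‖ by
        rw [mem_closedBall_iff_norm, add_sub_cancel_left]; exact hAy1)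
    rw [add_sub_cancel_left, Real.norm_eq_abs] at h3
    calc _ ≤ C₀ * ((3 * (1 + ‖y‖) ^ (2 * l)) ^ m * N) * (‖A‖ * (1 + ‖y‖)) := by
          refine h3.trans ?_
          gcongr
          refine hAy.trans ?_
          gcongr
          linarith
      _ = _ := by rw [mul_pow, ← pow_mul, pow_succ]; ring
  have hint : Integrable fun y : Phase d => Real.exp (-‖y‖ ^ 2) * (a (z + A y) - a z) := by
    simp only [mul_sub]
    refine (ha.integrable_exp_mul z A).sub ?_
    simpa using ((isPolySymbol_const (d := d) (a z)).integrable_exp_mul z A)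
  have hrep : gaussAvg a z A - a z =
      (Real.pi ^ d)⁻¹ * ∫ y : Phase d, Real.exp (-‖y‖ ^ 2) * (a (z + A y) - a z) := by
    have h1 : gaussAvg a z A - a z = gaussAvg a z A - gaussAvg (fun _ => a z) z A := by
      rw [gaussAvg_const]
    rw [h1, gaussAvg, gaussAvg, ← mul_sub, ← integral_sub (ha.integrable_exp_mul z A)
      ((isPolySymbol_const (d := d) (a z)).integrable_exp_mul z A)]
    simp only [mul_sub]
  have hintI : Integrable fun y : Phase d =>
      Real.exp (-‖y‖ ^ 2) * (1 + ‖y‖) ^ (2 * l * m + 1) :=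
    integrable_exp_neg_sq_smul (C := 1) (M := 2 * l * m + 1)
      (Continuous.aestronglyMeasurable (by fun_prop)) fun y => by
        rw [Real.norm_of_nonneg (by positivity), one_mul]
  rw [hrep, abs_mul, abs_of_nonneg (by positivity : 0 ≤ (Real.pi ^ d)⁻¹)]
  have hfin : |∫ y : Phase d, Real.exp (-‖y‖ ^ 2) * (a (z + A y) - a z)| ≤
      C₀ * 3 ^ m * N * ‖A‖ * I := by
    rw [hI, ← integral_const_mul, ← Real.norm_eq_abs]
    refine (norm_integral_le_integral_norm _).trans (integral_mono hint.norm
      (hintI.const_mul _) fun y => ?_)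
    simp only [norm_mul, Real.norm_eq_abs, Real.abs_exp]
    calc _ ≤ Real.exp (-‖y‖ ^ 2) * (C₀ * 3 ^ m * N * ‖A‖ * (1 + ‖y‖) ^ (2 * l * m + 1)) := by
          gcongr
          exact hpt y
      _ = _ := by ring
  calc _ ≤ (Real.pi ^ d)⁻¹ * (C₀ * 3 ^ m * N * ‖A‖ * I) := by gcongr
    _ = _ := by ring

end

section

variable {H : ℝ → Phase d → ℝ} {T : ℝ} {z : ℝ → Phase d} {F : ℝ → Phase d →L[ℝ] Phase d} {l : ℕ}

lemma sqrt_mul_norm_le {κ ħ₀ : ℝ} (hF : ContinuousOn F (Set.Icc 0 T))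
    (hκ : √ħ₀ * supNorm F T ≤ κ) {ħ : ℝ} (hħ : ħ ≤ ħ₀) {t : ℝ} (ht : t ∈ Set.Icc 0 T) :
    √ħ * ‖F t‖ ≤ κ := by
  have hbdd : BddAbove ((fun t => ‖F t‖) '' Set.Icc 0 T) :=
    (isCompact_Icc.image_of_continuousOn hF.norm).bddAbove
  have h1 : ‖F t‖ ≤ supNorm F T := le_csSup hbdd ⟨t, ht, rfl⟩
  refine le_trans ?_ hκ
  gcongr

lemma continuous_energy (l : ℕ) : Continuous (energy l : Phase d → ℝ) := by
  unfold energy pos mom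
  fun_prop

lemma energy_le_supEnergy (hz : ContinuousOn z (Set.Icc 0 T)) {t : ℝ} (ht : t ∈ Set.Icc 0 T) :
    energy l (z t) ≤ supEnergy l z t := by
  have hc : ContinuousOn (fun s => energy l (z s)) (Set.Icc 0 t) :=
    (continuous_energy l).comp_continuousOn (hz.mono (Set.Icc_subset_Icc_right ht.2))
  exact le_csSup (isCompact_Icc.image_of_continuousOn hc).bddAbove ⟨t, ⟨ht.1, le_rfl⟩, rfl⟩

/-- Smoothness of the remainder on `(0, ħ₀] × [0,T]`; the square root is smooth as `ħ > 0`. -/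
lemma contDiffOn_gaussAvg_sub {M : ℕ} {a : Phase d → ℝ} (ha : IsPolySymbol M a)
    (hz : ContDiffOn ℝ ∞ z (Set.Icc 0 T)) (hF : ContDiffOn ℝ ∞ F (Set.Icc 0 T)) (ħ₀ : ℝ) :
    ContDiffOn ℝ ∞ (fun p : ℝ × ℝ => gaussAvg a (z p.2) (√p.1 • F p.2) - a (z p.2))
      (Set.Ioc 0 ħ₀ ×ˢ Set.Icc 0 T) := by
  have hz2 : ContDiffOn ℝ ∞ (fun p : ℝ × ℝ => z p.2) (Set.Ioc 0 ħ₀ ×ˢ Set.Icc 0 T) :=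
    hz.comp contDiffOn_snd fun p hp => hp.2
  have hF2 : ContDiffOn ℝ ∞ (fun p : ℝ × ℝ => F p.2) (Set.Ioc 0 ħ₀ ×ˢ Set.Icc 0 T) :=
    hF.comp contDiffOn_snd fun p hp => hp.2
  have hsqrt : ContDiffOn ℝ ∞ (fun p : ℝ × ℝ => √p.1) (Set.Ioc 0 ħ₀ ×ˢ Set.Icc 0 T) :=
    contDiffOn_fst.sqrt fun p hp => hp.1.1.ne'
  exact (ha.contDiff_gaussAvg.comp_contDiffOn (hz2.prodMk (hsqrt.smul hF2))).sub
    (ha.1.comp_contDiffOn hz2)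

end

end
end Semiclassical

theorem proposition3p3 (d l : ℕ) (hd : 1 ≤ d) (hl : 2 ≤ l)
    (H : ℝ → Phase d → ℝ) (z₀ : Phase d)
    (κ : ℝ) (hκ₀ : 0 < κ) (hκ₁ : κ ≤ 1)
    (ρ : ℝ) (hρ : 0 ≤ ρ) (a : Phase d → ℝ)
    (ha : IsSymbol l ρ a) (ha' : HasAnisotropicBounds l ρ a) :
    ∃ Γ₁ : ℝ, 0 < Γ₁ ∧
      ∀ ħ₀ T : ℝ, 0 < ħ₀ → 0 < T → ClassicalAssumption l H T →
      ∀ (z : ℝ → Phase d) (F : ℝ → Phase d →L[ℝ] Phase d),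
        z 0 = z₀ → IsHamiltonSolution H T z → IsLinearizedFlow H z T F →
        √ħ₀ * supNorm F T ≤ κ →
        ∃ b : ℝ → ℝ → ℝ,
          ContDiffOn ℝ ∞ (fun p : ℝ × ℝ => b p.1 p.2) (Set.Ioc 0 ħ₀ ×ˢ Set.Icc 0 T) ∧
          (∀ ħ ∈ Set.Ioc 0 ħ₀, ∃ ψ : ℝ → 𝓢(Conf d, ℂ),
            IsSchrodingerSolution ħ T (quadraticHamiltonian H z) (coherentState ħ z₀) ψ ∧
            (∀ U : ℝ → ℝ → (L2 d ≃ₗᵢ[ℂ] L2 d),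
              IsUnitaryPropagator ħ T (quadraticHamiltonian H z) U →
              ∀ t ∈ Set.Icc 0 T, U t 0 (toL2 (ψ 0)) = toL2 (ψ t)) ∧
            ∀ t ∈ Set.Icc 0 T, HasExpectation ħ a (ψ t) ((a (z t) + b ħ t : ℝ) : ℂ)) ∧
          ∀ ħ ∈ Set.Ioc 0 ħ₀, ∀ t ∈ Set.Icc 0 T,
            |b ħ t| ≤ Γ₁ * √ħ * ‖F t‖ *
              (1 + energy l (z t)) ^ ((((l : ℝ) + 1) * ρ - 1) / (2 * l)) ∧
            (1 ≤ ((l : ℝ) + 1) * ρ →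
              |b ħ t| ≤ Γ₁ * √ħ * ‖F t‖ *
                (1 + supEnergy l z t) ^ ((((l : ℝ) + 1) * ρ - 1) / (2 * l))) := by
  have hl1 : 1 ≤ l := one_le_two.trans hl
  obtain ⟨M, haM⟩ := ha.isPolySymbol hl1
  obtain ⟨C₀, hC₀, hgrad⟩ := ha'.exists_norm_fderiv_le hl1
  set σ : ℝ := (((l : ℝ) + 1) * ρ - 1) / (2 * l) with hσ
  obtain ⟨C₁, hC₁, hrem⟩ := exists_gaussAvg_sub_le hl1 hC₀ haM hgrad
  obtain ⟨C₂, hC₂, hen⟩ := exists_basicWeight_rpow_le d hl1 σ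
  refine ⟨C₁ * C₂ + 1, by positivity, ?_⟩
  intro ħ₀ T hħ₀ hT hH z F hz0 hz hF hκ
  have hzs := hz.contDiffOn hT hH
  have hFs := hF.contDiffOn hT hH hz
  refine ⟨fun ħ t => gaussAvg a (z t) (√ħ • F t) - a (z t),
    contDiffOn_gaussAvg_sub haM hzs hFs ħ₀, fun ħ hħ => ?_, fun ħ hħ t ht => ?_⟩
  · obtain ⟨ψ, h1, h2, h3⟩ := exists_propagated_state hT hH hz hF hħ.1
    rw [hz0] at h1
    refine ⟨ψ, h1, h2, fun t ht => ?_⟩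
    have h4 := h3 t ht M a haM
    rwa [add_sub_cancel]
  · have hE := energy_nonneg l (z t)
    have hnorm : ‖√ħ • F t‖ = √ħ * ‖F t‖ := by
      rw [norm_smul, Real.norm_of_nonneg (Real.sqrt_nonneg _)]
    have hA : ‖√ħ • F t‖ ≤ 1 := by
      rw [hnorm]
      exact (sqrt_mul_norm_le hFs.continuousOn hκ hħ.2 ht).trans hκ₁
    have hpow : 0 ≤ (1 + energy l (z t)) ^ σ := by positivity
    have hmain : |gaussAvg a (z t) (√ħ • F t) - a (z t)| ≤
        (C₁ * C₂ + 1) * √ħ * ‖F t‖ * (1 + energy l (z t)) ^ σ := by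
      calc _ ≤ C₁ * ‖√ħ • F t‖ * basicWeight l (z t) ^ σ := hrem _ _ hA
        _ ≤ C₁ * ‖√ħ • F t‖ * (C₂ * (1 + energy l (z t)) ^ σ) := by
          gcongr
          exact hen _
        _ = C₁ * C₂ * (√ħ * ‖F t‖ * (1 + energy l (z t)) ^ σ) := by rw [hnorm]; ring
        _ ≤ (C₁ * C₂ + 1) * (√ħ * ‖F t‖ * (1 + energy l (z t)) ^ σ) := by
          gcongr
          linarith
        _ = _ := by ring
    refine ⟨hmain, fun hρ1 => hmain.trans ?_⟩
    have hσ0 : 0 ≤ σ := div_nonneg (by linarith) (by positivity)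
    have hle := energy_le_supEnergy (l := l) hzs.continuousOn ht
    gcongr
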